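/- Let $(p_k)_{k\ge 0}$ be a probability distribution on the nonnegative integers with $p_0=0$, with mean $m=\sum_k k p_k>1$, and with $\sum_k \beta^k p_k<\infty$ for some $\beta>1$. Let $\mathcal T$ be a rooted Galton–Watson tree with root $o$ and offspring distribution $(p_k)$, that is, the numbers $d_v$ of offspring of the vertices $v$ are i.i.d. with law $(p_k)$. Let $|v|$ be the distance of $v$ from $o$, and let $0<\lambda<m$. Given $\mathcal T$, let $(X_n)_{n\ge 0}$ be the $\lambda$-biased random walk on $\mathcal T$ with $X_0=o$: from a vertex $v\ne o$ it moves to the parent of $v$ with probability $\lambda/(\lambda+d_v)$ and to each of the $d_v$ offspring of $v$ with probability $1/(\lambda+d_v)$, and from $o$ it moves to each of the $d_o$ offspring of $o$ with probability $1/d_o$. Call $t$ a regeneration time if $|X_t|>|X_s|$ for all $s<t$ and $|X_u|\ge|X_t|$ for all $u\ge t$. Let $\tau_1$ be the smallest regeneration time $t>0$ and, for $i\ge 1$, let $\tau_{i+1}$ be the smallest regeneration time $t>\tau_i$. Then, under the annealed law (that is, averaging over both the tree and the walk), $\tau_1$ and $\tau_2$ are almost surely finite, and $$E_{\mathtt{GW}}\big[(\tau_2-\tau_1)^k\big]<\infty\qquad\text{for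 every integer } k\ge 0 .$$ -/

import Mathlib

open MeasureTheory ProbabilityTheory
open scoped ENNReal

noncomputable section

namespace GWWalk

/-- Vertices in Ulam–Harris labelling: the root `o` is `[]`, the `i`-th offspring of `v` is `i :: v`
(so the parent of `i :: v` is `v`), and the distance of `v` from the root is `v.length`. -/
abbrev Vertex : Type := List ℕ

instance instMeasurableSpaceVertex : MeasurableSpace Vertex := ⊤

instance instDiscreteVertex : DiscreteMeasurableSpace Vertex := ⟨fun _ => trivial⟩

/-- A rooted tree, coded by the numbers `d v` of offspring of all labels: the vertices of the tree
are the root and the `i :: v` with `v` a vertex of the tree and `i < d v`. The values of `d` at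
labels outside the tree play no role. -/
abbrev Env : Type := Vertex → ℕ

/-- The mean `m = ∑ k p_k` of the offspring distribution. -/
def offspringMean (p : PMF ℕ) : ℝ≥0∞ := ∑' k : ℕ, (k : ℝ≥0∞) * p k

/-- The Galton–Watson law: the numbers of offspring are i.i.d. with law `p`. -/
def gw (p : PMF ℕ) : Measure Env := Measure.infinitePi fun _ : Vertex => p.toMeasure

instance instProbGW (p : PMF ℕ) : IsProbabilityMeasure (gw p) := by
  unfold gw; infer_instance

/-- Law of the next position of the `lam`-biased walk at a vertex that has `n` offspring. Away from
the root the walk moves to the parent with probability `lam / (lam + n)` and to each offspring with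
probability `1 / (lam + n)`. The root has no parent, and there the walk moves to each of the
offspring with probability `1 / n` (and it stays put in the degenerate case `n = 0`). -/
def stepLaw (lam : ℝ) (n : ℕ) : Vertex → Measure Vertex
  | [] => if n = 0 then Measure.dirac [] else
      ∑ i ∈ Finset.range n, ENNReal.ofReal (1 / n) • Measure.dirac [i]
  | j :: u => ENNReal.ofReal (lam / (lam + n)) • Measure.dirac u +
      ∑ i ∈ Finset.range n, ENNReal.ofReal (1 / (lam + n)) • Measure.dirac (i :: j :: u)

lemma isProbabilityMeasure_stepLaw {lam : ℝ} (hlam : 0 < lam) (n : ℕ) (v : Vertex) :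
    IsProbabilityMeasure (stepLaw lam n v) := by
  constructor
  cases v with
  | nil =>
    unfold stepLaw
    split_ifs with h
    · simp
    · have hn : (0 : ℝ) < n := by exact_mod_cast Nat.pos_of_ne_zero h
      simp only [Measure.coe_finsetSum, Finset.sum_apply, Measure.smul_apply, measure_univ,
        smul_eq_mul, mul_one, Finset.sum_const, Finset.card_range, nsmul_eq_mul]
      rw [← ENNReal.ofReal_natCast, ← ENNReal.ofReal_mul hn.le, mul_one_div_cancel hn.ne',
        ENNReal.ofReal_one]
  | cons j u =>
    have hn : (0 : ℝ) ≤ n := Nat.cast_nonneg n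
    simp only [stepLaw, Measure.coe_add, Pi.add_apply, Measure.coe_finsetSum, Finset.sum_apply,
      Measure.smul_apply, measure_univ, smul_eq_mul, mul_one, Finset.sum_const, Finset.card_range,
      nsmul_eq_mul]
    rw [← ENNReal.ofReal_natCast, ← ENNReal.ofReal_mul hn, ← ENNReal.ofReal_add (by positivity)
      (by positivity), ← ENNReal.ofReal_one]
    congr 1
    field_simp

/-- The transition kernel of the `lam`-biased walk on the tree `d`. -/
def stepKernel (lam : ℝ) (d : Env) : Kernel Vertex Vertex where
  toFun v := stepLaw lam (d v) v
  measurable' := Measurable.of_discrete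

lemma isMarkovKernel_stepKernel {lam : ℝ} (hlam : 0 < lam) (d : Env) :
    IsMarkovKernel (stepKernel lam d) :=
  ⟨fun v => isProbabilityMeasure_stepLaw hlam (d v) v⟩

/-- The transition kernel of the walk, given the whole history up to time `n`. -/
def histKernel (lam : ℝ) (d : Env) (n : ℕ) :
    Kernel ((_ : Finset.Iic n) → Vertex) Vertex :=
  (stepKernel lam d).comap (fun x => x ⟨n, Finset.mem_Iic.2 le_rfl⟩) (measurable_pi_apply _)

lemma isMarkovKernel_histKernel {lam : ℝ} (hlam : 0 < lam) (d : Env) (n : ℕ) :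
    IsMarkovKernel (histKernel lam d n) := by
  have := isMarkovKernel_stepKernel hlam d
  unfold histKernel; infer_instance

/-- The quenched law: the law of the `lam`-biased walk `(X_n)` on the tree `d` with `X_0 = o`. -/
def quenched (lam : ℝ) (hlam : 0 < lam) (d : Env) : Measure (ℕ → Vertex) :=
  haveI := isMarkovKernel_histKernel hlam d
  Kernel.trajMeasure (X := fun _ => Vertex) (Measure.dirac []) (histKernel lam d)

instance instProbQuenched (lam : ℝ) (hlam : 0 < lam) (d : Env) :
    IsProbabilityMeasure (quenched lam hlam d) := by
  have := isMarkovKernel_histKernel hlam d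
  unfold quenched; infer_instance

/-- The paths that agree with `x` up to time `n`. -/
def cyl (n : ℕ) (x : ℕ → Vertex) : Set (ℕ → Vertex) := {y | ∀ i ≤ n, y i = x i}

lemma quenched_cyl (lam : ℝ) (hlam : 0 < lam) (d : Env) (x : ℕ → Vertex) (n : ℕ) :
    quenched lam hlam d (cyl n x) = (if x 0 = [] then 1 else 0) *
      ∏ i ∈ Finset.range n, stepLaw lam (d (x i)) (x i) {x (i + 1)} := by
  have hM := isMarkovKernel_histKernel hlam d
  have hcyl : ∀ n, cyl n x = Preorder.frestrictLe (π := fun _ : ℕ => Vertex) n ⁻¹'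
      {Preorder.frestrictLe (π := fun _ : ℕ => Vertex) n x} := by
    intro n
    ext y
    simp only [cyl, Set.mem_ofPred_eq, Set.mem_preimage, Set.mem_singleton_iff, funext_iff]
    exact ⟨fun h i => h i (Finset.mem_Iic.1 i.2), fun h i hi => h ⟨i, Finset.mem_Iic.2 hi⟩⟩
  induction n with
  | zero =>
    rw [hcyl, ← Measure.map_apply (by fun_prop) (measurableSet_singleton _), quenched,
      Kernel.trajMeasure, Measure.map_comp _ _ (by fun_prop), Kernel.traj_map_frestrictLe,
      Kernel.partialTraj_self, Measure.id_comp,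
      Measure.map_apply (by fun_prop) (measurableSet_singleton _), Measure.dirac_apply]
    have : ((MeasurableEquiv.piUnique fun _ : Finset.Iic 0 => Vertex).symm []
        = Preorder.frestrictLe (π := fun _ : ℕ => Vertex) 0 x) ↔ x 0 = [] := by
      rw [MeasurableEquiv.symm_apply_eq]
      exact eq_comm
    have hmem : ([] : Vertex) ∈ (MeasurableEquiv.piUnique fun _ : Finset.Iic 0 => Vertex).symm ⁻¹'
        {Preorder.frestrictLe (π := fun _ : ℕ => Vertex) 0 x} ↔ x 0 = [] := this
    by_cases h0 : x 0 = []
    · rw [Set.indicator_of_mem (hmem.2 h0)]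
      simp [h0]
    · rw [Set.indicator_of_notMem (fun h => h0 (hmem.1 h))]
      simp [h0]
  | succ n ih =>
    have h1 : cyl (n + 1) x = (fun y : ℕ → Vertex =>
        (Preorder.frestrictLe (π := fun _ : ℕ => Vertex) n y, y (n + 1))) ⁻¹'
        ({Preorder.frestrictLe (π := fun _ : ℕ => Vertex) n x} ×ˢ {x (n + 1)}) := by
      ext y
      have h2 : y ∈ cyl n x ↔ Preorder.frestrictLe (π := fun _ : ℕ => Vertex) n y =
          Preorder.frestrictLe (π := fun _ : ℕ => Vertex) n x := by
        rw [hcyl]; rfl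
      simp only [Set.mem_preimage, Set.mem_prod, Set.mem_singleton_iff, ← h2]
      simp only [cyl, Set.mem_ofPred_eq]
      exact ⟨fun h => ⟨fun i hi => h i (by omega), h _ le_rfl⟩, fun h i hi => by
        rcases Nat.lt_or_ge n i with hi' | hi'
        · obtain rfl : i = n + 1 := by omega
          exact h.2
        · exact h.1 i hi'⟩
    rw [quenched] at ih ⊢
    rw [h1, ← Measure.map_apply (by fun_prop)
      ((measurableSet_singleton _).prod (measurableSet_singleton _)),
      ← Kernel.map_frestrictLe_trajMeasure_compProd_eq_map_trajMeasure,
      Measure.compProd_apply_prod (measurableSet_singleton _) (measurableSet_singleton _),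
      lintegral_singleton, Measure.map_apply (by fun_prop) (measurableSet_singleton _), ← hcyl,
      ih, Finset.prod_range_succ, mul_comm, mul_assoc]
    rfl

lemma measurable_quenched (lam : ℝ) (hlam : 0 < lam) : Measurable (quenched lam hlam) := by
  refine Measurable.measure_of_isPiSystem_of_isProbabilityMeasure
    (S := {s | ∃ n x, s = cyl n x}) ?_ ?_ ?_
  · have hmeas : ∀ n x, MeasurableSet (cyl n x) := by
      intro n x
      simp only [cyl, Set.ofPred_forall]
      exact MeasurableSet.iInter fun i => MeasurableSet.iInter fun _ =>
        measurableSet_eq_fun (measurable_pi_apply i) measurable_const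
    apply le_antisymm
    · refine iSup_le fun i => ?_
      rintro _ ⟨s, -, rfl⟩
      let ext (f : Fin (i + 1) → Vertex) : ℕ → Vertex := fun j =>
        if h : j < i + 1 then f ⟨j, h⟩ else []
      have : (fun y : ℕ → Vertex => y i) ⁻¹' s =
          ⋃ f : {f : Fin (i + 1) → Vertex // f (Fin.last i) ∈ s}, cyl i (ext f.1) := by
        ext y
        simp only [Set.mem_preimage, Set.mem_iUnion, cyl, Set.mem_ofPred_eq, ext]
        constructor
        · intro hy
          exact ⟨⟨fun j => y j, hy⟩, fun j hj => by simp [Nat.lt_succ_of_le hj]⟩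
        · rintro ⟨f, hf⟩
          have := hf i le_rfl
          simp only [Nat.lt_succ_self, dite_true] at this
          rw [this]
          exact f.2
      rw [this]
      exact MeasurableSet.iUnion fun f =>
        MeasurableSpace.measurableSet_generateFrom ⟨_, _, rfl⟩
    · refine MeasurableSpace.generateFrom_le ?_
      rintro _ ⟨n, x, rfl⟩
      exact hmeas n x
  · have key : ∀ n x m z, n ≤ m → (cyl n x ∩ cyl m z).Nonempty →
        cyl n x ∩ cyl m z = cyl m z := by
      rintro n x m z hnm ⟨y, hy1, hy2⟩
      refine Set.inter_eq_right.2 fun w hw i hi => ?_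
      rw [hw i (hi.trans hnm), ← hy2 i (hi.trans hnm), hy1 i hi]
    rintro _ ⟨n, x, rfl⟩ _ ⟨m, z, rfl⟩ hne
    rcases le_total n m with h | h
    · exact ⟨m, z, key n x m z h hne⟩
    · refine ⟨n, x, ?_⟩
      rw [Set.inter_comm] at hne ⊢
      exact key m z n x h hne
  · rintro _ ⟨n, x, rfl⟩
    simp only [quenched_cyl]
    refine Measurable.const_mul (Finset.measurable_prod _ fun i _ => ?_) _
    exact (Measurable.of_discrete (f := fun k : ℕ => stepLaw lam k (x i) {x (i + 1)})).comp
      (measurable_pi_apply (x i))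

/-- The quenched laws, as a kernel from trees to paths. -/
def quenchedKernel (lam : ℝ) (hlam : 0 < lam) : Kernel Env (ℕ → Vertex) where
  toFun := quenched lam hlam
  measurable' := measurable_quenched lam hlam

instance instMarkovQuenchedKernel (lam : ℝ) (hlam : 0 < lam) :
    IsMarkovKernel (quenchedKernel lam hlam) :=
  ⟨fun d => instProbQuenched lam hlam d⟩

/-- The annealed law of the pair `(tree, walk)`: the tree has the Galton–Watson law, and given the
tree the walk has the quenched law. -/
def annealed (p : PMF ℕ) (lam : ℝ) (hlam : 0 < lam) : Measure (Env × (ℕ → Vertex)) :=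
  (gw p) ⊗ₘ (quenchedKernel lam hlam)

/-- `t` is a regeneration time of the path `x`: a new level is reached at time `t`, and the path
stays at or beyond this level ever after. -/
def IsRegenerationTime (x : ℕ → Vertex) (t : ℕ) : Prop :=
  (∀ s < t, (x s).length < (x t).length) ∧ ∀ u ≥ t, (x t).length ≤ (x u).length

/-- The successive positive regeneration times `τ_1 < τ_2 < …` (with `τ_0 = 0`):
`τ_{i+1}` is the infimum of the regeneration times `t > τ_i`, which is `∞` if there is none. -/
def regenTime (x : ℕ → Vertex) : ℕ → ℕ∞
  | 0 => 0
  | i + 1 => ⨅ t : {t : ℕ // regenTime x i < (t : ℕ∞) ∧ IsRegenerationTime x t}, ((t : ℕ) : ℕ∞)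

end GWWalk

end

noncomputable section

namespace GWWalk

open scoped NNReal

/-! When the walk enters a vertex for the first time, the subtree there is unexplored. Seen from
that vertex, and until it leaves the subtree, the walk therefore has a fixed law `freshLaw`,
independent of the past (`pathLaw_fresh`). Let δ be the probability under this law that the subtree
is ever left. Besides this renewal property and δ < 1, the proof needs two estimates.

(1) The annealed probability to reach level n + 1 and return to the root later is at most C κ ^ n
with κ < 1 (`exists_pathLaw_reachReturn_le`). An energy argument, which uses λ < m and a second
moment of the offspring law, shows that the mean escape probability is positive; branching then
makes the escape probability positive almost surely (`measure_esc_eq_zero`), which also yields δ <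
1. The probability to come down from a vertex is a product of return probabilities along its
ancestral line, and each ancestor with a side branch of escape probability at least ε contributes a
factor at most λ / (λ + ε). For a large exponent A, the A-th powers of these products, summed over a
generation, have exponentially small expectation.

(2) On every tree without leaves, the probability that the walk avoids the root for n steps and sees
at most N vertices is at most M (1 - 1 / M) ^ n, where M is of order N ^ 3. This comes from a
Lyapunov function (`quenched_slow_le`).

Now take h checkpoint levels at spacing h. If none of them is a regeneration level, then either the
walk climbs h levels above some checkpoint and later falls below it, which has probability O(h κ ^
h) by (1), or it falls below every checkpoint before reaching the next level, which has probability
at most δ ^ h by renewal. Also by renewal, more than h vertices are visited at a given level with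
probability at most δ ^ h. Otherwise, a walk that has not passed level (h + 1) h by time h ^ 10 has
seen only O(h ^ 3) vertices, and (2) bounds this by a polynomial times exp(-c h), because N ^ 3 is
of order h ^ 9. So a gap longer than h ^ 10 has probability O(h ^ 9 κ ^ h) for some κ < 1, and all
moments are finite. The first regeneration time is not a stopping time; summing over the candidates
for it costs only the factor 1 / (1 - δ) (`pathLaw_longGap_le`). -/

/-! ### Subtrees and the branching property -/

/-- The subtree of `d` rooted at `u`. -/
def sub (u : Vertex) (d : Env) : Env := fun v => d (v ++ u)

lemma measurable_sub (u : Vertex) : Measurable (sub u) :=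
  measurable_pi_iff.2 fun v => measurable_pi_apply (v ++ u)

lemma sub_sub (u v : Vertex) (d : Env) : sub v (sub u d) = sub (v ++ u) d := by
  funext w; simp [sub]

@[simp] lemma sub_nil (d : Env) : sub [] d = d := by funext w; simp [sub]

open Classical in
/-- Replace the subtree of `d` at `u` by `d'`. -/
def glue (u : Vertex) (z : Env × Env) : Env := fun v =>
  if u <:+ v then z.2 (v.take (v.length - u.length)) else z.1 v

lemma measurable_glue (u : Vertex) : Measurable (glue u) := by
  refine measurable_pi_iff.2 fun v => ?_
  unfold glue
  split_ifs
  · exact (measurable_pi_apply _).comp measurable_snd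
  · exact (measurable_pi_apply _).comp measurable_fst

lemma sub_glue (u : Vertex) (z : Env × Env) : sub u (glue u z) = z.2 := by
  funext v
  simp [sub, glue]

lemma glue_of_not (u : Vertex) (z : Env × Env) {v : Vertex} (h : ¬ u <:+ v) :
    glue u z v = z.1 v := by
  simp [glue, h]

/-- Every label of the glued tree reads one coordinate of one of two independent trees, and distinct
labels read distinct coordinates, so the result is again i.i.d. This encodes the independence of the
subtree at `u` from the rest without σ-algebras. -/
lemma map_glue (p : PMF ℕ) (u : Vertex) : ((gw p).prod (gw p)).map (glue u) = gw p := by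
  classical
  conv_rhs => rw [gw]
  refine Measure.eq_infinitePi _ fun s t ht => ?_
  have hpre : glue u ⁻¹' (Set.pi s t) =
      (Set.pi (s.filter fun v => ¬ u <:+ v : Finset Vertex) t) ×ˢ
        (Set.pi ((s.filter fun v => u <:+ v).image
          fun v : Vertex => v.take (v.length - u.length) : Finset Vertex) fun w => t (w ++ u)) := by
    ext z
    simp only [Set.mem_preimage, Set.mem_pi, Set.mem_prod, Finset.mem_coe, Finset.mem_filter,
      Finset.mem_image, glue]
    constructor
    · intro h
      refine ⟨fun v hv => ?_, ?_⟩
      · simpa [hv.2] using h v hv.1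
      · rintro _ ⟨v, ⟨hv, w, rfl⟩, rfl⟩
        simpa using h _ hv
    · rintro ⟨h1, h2⟩ v hv
      split_ifs with hu
      · have := h2 _ ⟨v, ⟨hv, hu⟩, rfl⟩
        obtain ⟨w, rfl⟩ := hu
        simpa using this
      · exact h1 v ⟨hv, hu⟩
  rw [Measure.map_apply (measurable_glue u) (MeasurableSet.pi s.countable_toSet fun i _ => ht i),
    hpre, Measure.prod_prod, gw, Measure.infinitePi_pi _ (fun i _ => ht i),
    Measure.infinitePi_pi _ (fun i _ => ht _), Finset.prod_image, ← Finset.prod_filter_not_mul_prod_filter s (fun v => u <:+ v)]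
  · congr 1
    refine Finset.prod_congr rfl fun v hv => ?_
    obtain ⟨w, rfl⟩ := (Finset.mem_filter.1 hv).2
    simp
  · intro v hv w hw h
    obtain ⟨v, rfl⟩ := (Finset.mem_filter.1 hv).2
    obtain ⟨w, rfl⟩ := (Finset.mem_filter.1 hw).2
    simpa using h

/-- Branching property: the subtree at `u` is a Galton–Watson tree independent of the labels
outside of it. -/
lemma lintegral_branching (p : PMF ℕ) (u : Vertex) {A B : Env → ℝ≥0∞} (hA : Measurable A)
    (hB : Measurable B) (hAu : ∀ d d' : Env, (∀ v, ¬ u <:+ v → d v = d' v) → A d = A d') :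
    ∫⁻ d, A d * B (sub u d) ∂(gw p) = (∫⁻ d, A d ∂(gw p)) * ∫⁻ d, B d ∂(gw p) := by
  have hAB : Measurable fun d => A d * B (sub u d) := hA.mul (hB.comp (measurable_sub u))
  conv_lhs => rw [← map_glue p u]
  rw [lintegral_map hAB (measurable_glue u)]
  rw [← lintegral_prod_mul hA.aemeasurable hB.aemeasurable]
  refine lintegral_congr fun z => ?_
  rw [sub_glue, hAu (glue u z) z.1 fun v hv => glue_of_not u z hv]

lemma lintegral_sub (p : PMF ℕ) (u : Vertex) {B : Env → ℝ≥0∞} (hB : Measurable B) :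
    ∫⁻ d, B (sub u d) ∂(gw p) = ∫⁻ d, B d ∂(gw p) := by
  have := lintegral_branching p u (A := fun _ => 1) measurable_const hB (fun _ _ _ => rfl)
  simpa using this

lemma lintegral_root (p : PMF ℕ) (f : ℕ → ℝ≥0∞) :
    ∫⁻ d, f (d []) ∂(gw p) = ∑' k, f k * p k := by
  have h : (gw p).map (fun d : Env => d []) = p.toMeasure :=
    Measure.infinitePi_map_eval (fun _ : Vertex => p.toMeasure) []
  rw [← lintegral_map (f := f) Measurable.of_discrete (measurable_pi_apply _), h,
    lintegral_countable']
  refine tsum_congr fun k => ?_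
  rw [PMF.toMeasure_apply_singleton _ _ (measurableSet_singleton k)]

lemma ae_pos (p : PMF ℕ) (hp0 : p 0 = 0) : ∀ᵐ d ∂(gw p), ∀ v, 1 ≤ d v := by
  rw [ae_all_iff]
  intro v
  have h : (gw p).map (fun d : Env => d v) = p.toMeasure :=
    Measure.infinitePi_map_eval (fun _ : Vertex => p.toMeasure) v
  have h0 : p.toMeasure {0} = 0 := by
    rw [PMF.toMeasure_apply_singleton _ _ (measurableSet_singleton _), hp0]
  rw [← h, Measure.map_apply (measurable_pi_apply v) (measurableSet_singleton _)] at h0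
  rw [ae_iff]
  refine measure_mono_null (fun d hd => ?_) h0
  simp at hd ⊢
  exact hd

/-! ### One step of the walk -/

/-- `f` depends on the path up to time `t` only. -/
def Adapted {α : Type*} (t : ℕ) (f : (ℕ → Vertex) → α) : Prop :=
  ∀ x y : ℕ → Vertex, (∀ i ≤ t, x i = y i) → f x = f y

/-- The path with a given history up to time `t`, and staying at the root afterwards. -/
def ofHist (t : ℕ) (h : (i : Finset.Iic t) → Vertex) : ℕ → Vertex := fun i =>
  if hi : i ≤ t then h ⟨i, Finset.mem_Iic.2 hi⟩ else []

lemma ofHist_frestrictLe (t : ℕ) (x : ℕ → Vertex) {i : ℕ} (hi : i ≤ t) :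
    ofHist t (Preorder.frestrictLe (π := fun _ : ℕ => Vertex) t x) i = x i := by
  simp [ofHist, hi]

lemma Adapted.eq_hist {α : Type*} {t : ℕ} {f : (ℕ → Vertex) → α} (h : Adapted t f)
    (x : ℕ → Vertex) :
    f x = f (ofHist t (Preorder.frestrictLe (π := fun _ : ℕ => Vertex) t x)) :=
  h _ _ fun _ hi => (ofHist_frestrictLe t x hi).symm

lemma Adapted.measurable {α : Type*} [MeasurableSpace α] {t : ℕ} {f : (ℕ → Vertex) → α}
    (h : Adapted t f) : Measurable f := by
  have : f = (fun g => f (ofHist t g)) ∘ Preorder.frestrictLe (π := fun _ : ℕ => Vertex) t := by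
    funext x; exact h.eq_hist x
  rw [this]
  exact (Measurable.of_discrete).comp (by fun_prop)

lemma Adapted.measurableSet {t : ℕ} {S : (ℕ → Vertex) → Prop} (h : Adapted t S) :
    MeasurableSet {x | S x} :=
  measurableSet_setOfPred.2 h.measurable

/-- The Markov property in the only form used below: the last coordinate of an adapted function is
resampled from the step law. `Function.update` keeps everything a function of whole paths. -/
lemma lintegral_step {lam : ℝ} (hlam : 0 < lam) (d : Env) (t : ℕ) {f : (ℕ → Vertex) → ℝ≥0∞}
    (hf : Adapted (t + 1) f) :
    ∫⁻ x, f x ∂(quenched lam hlam d) =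
      ∫⁻ x, ∫⁻ y, f (Function.update x (t + 1) y) ∂(stepLaw lam (d (x t)) (x t))
        ∂(quenched lam hlam d) := by
  have hM := isMarkovKernel_histKernel hlam d
  set r := Preorder.frestrictLe (π := fun _ : ℕ => Vertex) t
  let F : ((i : Finset.Iic t) → Vertex) × Vertex → ℝ≥0∞ := fun z =>
    f (Function.update (ofHist t z.1) (t + 1) z.2)
  have hF : Measurable F := Measurable.of_discrete
  have hr : Measurable r := by fun_prop
  have h1 : ∀ x y, f (Function.update x (t + 1) y) = F (r x, y) := by
    intro x y
    refine hf _ _ fun i hi => ?_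
    by_cases hit : i = t + 1
    · subst hit; simp
    · simp only [Function.update_of_ne hit]
      exact (ofHist_frestrictLe t x (by omega)).symm
  have h2 : ∀ x, f x = F (r x, x (t + 1)) := by
    intro x; rw [← h1, Function.update_eq_self]
  have key := Kernel.map_frestrictLe_trajMeasure_compProd_eq_map_trajMeasure
    (X := fun _ => Vertex) (μ₀ := Measure.dirac []) (κ := histKernel lam d) (a := t)
  simp_rw [h1]
  calc ∫⁻ x, f x ∂(quenched lam hlam d) = ∫⁻ x, F (r x, x (t + 1)) ∂(quenched lam hlam d) :=
        lintegral_congr h2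
    _ = ∫⁻ z, F z ∂((quenched lam hlam d).map fun x => (r x, x (t + 1))) := by
        rw [lintegral_map hF (by fun_prop)]
    _ = ∫⁻ z, F z ∂(((quenched lam hlam d).map r) ⊗ₘ histKernel lam d t) := by
        rw [quenched, key]
    _ = ∫⁻ x, ∫⁻ y, F (r x, y) ∂(stepLaw lam (d (x t)) (x t)) ∂(quenched lam hlam d) := by
        rw [Measure.lintegral_compProd hF, lintegral_map _ hr]
        · rfl
        · exact Measurable.of_discrete

lemma lintegral_stepLaw_cons (lam : ℝ) (n : ℕ) (j : ℕ) (u : Vertex) (f : Vertex → ℝ≥0∞) :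
    ∫⁻ y, f y ∂(stepLaw lam n (j :: u)) = ENNReal.ofReal (lam / (lam + n)) * f u +
      ∑ i ∈ Finset.range n, ENNReal.ofReal (1 / (lam + n)) * f (i :: j :: u) := by
  simp [stepLaw, lintegral_add_measure, lintegral_finsetSum_measure]

lemma lintegral_stepLaw_nil (lam : ℝ) {n : ℕ} (hn : n ≠ 0) (f : Vertex → ℝ≥0∞) :
    ∫⁻ y, f y ∂(stepLaw lam n []) =
      ∑ i ∈ Finset.range n, ENNReal.ofReal (1 / n) * f [i] := by
  simp [stepLaw, hn, lintegral_finsetSum_measure]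

/-- `w` is an offspring of `v` in the tree `d`, or its parent. -/
def Nbr (d : Env) (v w : Vertex) : Prop := (∃ i < d v, w = i :: v) ∨ ∃ i, v = i :: w

lemma ae_stepLaw_nbr (lam : ℝ) (d : Env) (v : Vertex) (hd : 1 ≤ d v) :
    ∀ᵐ w ∂(stepLaw lam (d v) v), Nbr d v w := by
  rw [ae_iff]
  cases v with
  | nil =>
    have h0 : d [] ≠ 0 := by omega
    simp only [stepLaw, h0, if_false, Measure.coe_finsetSum, Finset.sum_apply, Measure.smul_apply,
      Finset.sum_eq_zero_iff, Finset.mem_range, smul_eq_mul, mul_eq_zero]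
    intro i hi
    right
    simp [Nbr, hi]
  | cons j u =>
    simp only [stepLaw, Measure.coe_add, Pi.add_apply, Measure.coe_finsetSum, Finset.sum_apply,
      Measure.smul_apply, add_eq_zero, Finset.sum_eq_zero_iff, Finset.mem_range, smul_eq_mul,
      mul_eq_zero]
    refine ⟨Or.inr ?_, fun i hi => Or.inr ?_⟩
    · simp [Nbr]
    · simp [Nbr, hi]

/-- `x` is a nearest neighbour path in `d` started at the root. -/
def IsWalk (d : Env) (x : ℕ → Vertex) : Prop := x 0 = [] ∧ ∀ t, Nbr d (x t) (x (t + 1))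

lemma quenched_ae_start {lam : ℝ} (hlam : 0 < lam) (d : Env) :
    ∀ᵐ x ∂(quenched lam hlam d), x 0 = [] := by
  have h := quenched_cyl lam hlam d (fun _ => []) 0
  simp only [if_true, Finset.range_zero, Finset.prod_empty, mul_one] at h
  have h1 : MeasurableSet (cyl 0 (fun _ => [])) := by
    have : Adapted 0 (fun y : ℕ → Vertex => ∀ i ≤ 0, y i = []) := by
      intro x y hxy
      simp only [eq_iff_iff]
      exact forall₂_congr fun i hi => by rw [hxy i hi]
    exact this.measurableSet
  rw [← prob_compl_eq_zero_iff h1] at h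
  rw [ae_iff]
  refine measure_mono_null (fun x hx => ?_) h
  simp only [Set.mem_compl_iff, cyl]
  exact fun hc => hx (hc 0 le_rfl)

lemma ae_isWalk {lam : ℝ} (hlam : 0 < lam) (d : Env) (hd : ∀ v, 1 ≤ d v) :
    ∀ᵐ x ∂(quenched lam hlam d), IsWalk d x := by
  unfold IsWalk
  rw [Filter.eventually_and, ae_all_iff]
  constructor
  · exact quenched_ae_start hlam d
  · intro t
    classical
    have hA : Adapted (t + 1) fun x : ℕ → Vertex =>
        if Nbr d (x t) (x (t + 1)) then (0 : ℝ≥0∞) else 1 := by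
      intro x y hxy
      simp only [hxy t (by omega), hxy (t + 1) le_rfl]
    have h := lintegral_step hlam d t hA
    have h0 : ∀ x : ℕ → Vertex, ∫⁻ y, (if Nbr d (Function.update x (t + 1) y t)
        (Function.update x (t + 1) y (t + 1)) then (0 : ℝ≥0∞) else 1)
        ∂(stepLaw lam (d (x t)) (x t)) = 0 := by
      intro x
      rw [lintegral_eq_zero_iff Measurable.of_discrete]
      filter_upwards [ae_stepLaw_nbr lam d (x t) (hd _)] with y hy
      simp [hy]
    simp only [h0, lintegral_zero] at h
    rw [lintegral_eq_zero_iff hA.measurable] at h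
    filter_upwards [h] with x hx
    by_contra hc
    simp [hc] at hx

/-- The supermartingale inequality. It is used with `c = 1` for hitting probabilities, and with `c <
1` to bound the survival of a killed walk. The starting time `t₀` is free because some potentials
make sense only after the walk has left the root. -/
lemma lintegral_le_geom {lam : ℝ} (hlam : 0 < lam) (d : Env) (hd : ∀ v, 1 ≤ d v)
    {Φ : ℕ → (ℕ → Vertex) → ℝ≥0∞} (c : ℝ≥0∞) (t₀ : ℕ) (hΦ : ∀ t, Adapted t (Φ t))
    (hstep : ∀ t x, t₀ ≤ t → IsWalk d x →
      ∫⁻ y, Φ (t + 1) (Function.update x (t + 1) y) ∂(stepLaw lam (d (x t)) (x t)) ≤ c * Φ t x)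
    (n : ℕ) :
    ∫⁻ x, Φ (t₀ + n) x ∂(quenched lam hlam d) ≤ c ^ n * ∫⁻ x, Φ t₀ x ∂(quenched lam hlam d) := by
  induction n with
  | zero => simp
  | succ n ih =>
    rw [← add_assoc, lintegral_step hlam d (t₀ + n) (hΦ _)]
    calc _ ≤ ∫⁻ x, c * Φ (t₀ + n) x ∂(quenched lam hlam d) := by
          refine lintegral_mono_ae ?_
          filter_upwards [ae_isWalk hlam d hd] with x hx
          exact hstep _ x (by omega) hx
      _ = c * ∫⁻ x, Φ (t₀ + n) x ∂(quenched lam hlam d) :=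
          lintegral_const_mul _ (hΦ _).measurable
      _ ≤ c * (c ^ n * ∫⁻ x, Φ t₀ x ∂(quenched lam hlam d)) := by gcongr
      _ = _ := by rw [pow_succ']; ring

/-! ### The annealed law of the path -/

/-- The law of the walk alone, averaged over the tree. -/
def pathLaw (p : PMF ℕ) (lam : ℝ) (hlam : 0 < lam) : Measure (ℕ → Vertex) :=
  (annealed p lam hlam).map Prod.snd

instance instProbPathLaw (p : PMF ℕ) (lam : ℝ) (hlam : 0 < lam) :
    IsProbabilityMeasure (pathLaw p lam hlam) := by
  unfold pathLaw annealed
  exact Measure.isProbabilityMeasure_map measurable_snd.aemeasurable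

lemma pathLaw_apply (p : PMF ℕ) {lam : ℝ} (hlam : 0 < lam) {E : Set (ℕ → Vertex)}
    (hE : MeasurableSet E) :
    pathLaw p lam hlam E = ∫⁻ d, quenched lam hlam d E ∂(gw p) := by
  rw [pathLaw, annealed, ← Measure.snd, Measure.snd_compProd, Measure.bind_apply hE (by fun_prop)]
  rfl

lemma ae_pathLaw (p : PMF ℕ) (hp0 : p 0 = 0) {lam : ℝ} (hlam : 0 < lam)
    {P : (ℕ → Vertex) → Prop} (hP : MeasurableSet {x | P x})
    (h : ∀ d x, (∀ v, 1 ≤ d v) → IsWalk d x → P x) : ∀ᵐ x ∂(pathLaw p lam hlam), P x := by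
  rw [ae_iff]
  have hc : {x | ¬ P x} = {x | P x}ᶜ := rfl
  have hm : Measurable fun d => quenched lam hlam d {x | P x}ᶜ :=
    (Measure.measurable_coe hP.compl).comp (measurable_quenched lam hlam)
  rw [hc, pathLaw_apply p hlam hP.compl, lintegral_eq_zero_iff hm]
  filter_upwards [ae_pos p hp0] with d hd
  rw [← hc, Pi.zero_apply, ← ae_iff]
  filter_upwards [ae_isWalk hlam d hd] with x hx using h d x hd hx

/-- `x` is a nearest neighbour path started at the root. -/
def IsPath (x : ℕ → Vertex) : Prop :=
  x 0 = [] ∧ ∀ t, (∃ i, x (t + 1) = i :: x t) ∨ ∃ i, x t = i :: x (t + 1)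

lemma IsWalk.isPath {d : Env} {x : ℕ → Vertex} (h : IsWalk d x) : IsPath x :=
  ⟨h.1, fun t => (h.2 t).imp (fun ⟨i, _, h⟩ => ⟨i, h⟩) id⟩

lemma measurableSet_isPath : MeasurableSet {x | IsPath x} := by
  have h0 : Adapted 0 fun x : ℕ → Vertex => x 0 = [] := fun x y hxy => by simp only [hxy 0 le_rfl]
  have ht : ∀ t, Adapted (t + 1) fun x : ℕ → Vertex =>
      (∃ i, x (t + 1) = i :: x t) ∨ ∃ i, x t = i :: x (t + 1) := fun t x y hxy => by
    simp only [hxy t (by omega), hxy (t + 1) le_rfl]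
  have : {x | IsPath x} = {x | x 0 = []} ∩ ⋂ t, {x | (∃ i, x (t + 1) = i :: x t) ∨
      ∃ i, x t = i :: x (t + 1)} := by
    ext x; simp [IsPath]
  rw [this]
  exact h0.measurableSet.inter (MeasurableSet.iInter fun t => (ht t).measurableSet)

lemma ae_isPath (p : PMF ℕ) (hp0 : p 0 = 0) {lam : ℝ} (hlam : 0 < lam) :
    ∀ᵐ x ∂(pathLaw p lam hlam), IsPath x :=
  ae_pathLaw p hp0 hlam measurableSet_isPath fun _ _ _ h => h.isPath

/-! ### Sums over the offspring of the root -/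

lemma measurable_sum_children {M : Type*} [AddCommMonoid M] [MeasurableSpace M] [MeasurableAdd₂ M]
    {f : ℕ → Env → M} (hf : ∀ i, Measurable (f i)) :
    Measurable fun d : Env => ∑ i ∈ Finset.range (d []), f i d := by
  have h : Measurable fun z : ℕ × Env => ∑ i ∈ Finset.range z.1, f i z.2 :=
    measurable_from_prod_countable_right fun n => by
      simpa using Finset.measurable_sum (Finset.range n) fun i _ => hf i
  have h2 : Measurable fun d : Env => (d [], d) := (measurable_pi_apply _).prodMk measurable_id
  exact h.comp h2

lemma sum_range_eq_tsum (n : ℕ) (f : ℕ → ℝ≥0∞) :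
    ∑ i ∈ Finset.range n, f i = ∑' i, if i < n then f i else 0 := by
  rw [tsum_eq_sum (s := Finset.range n)]
  · exact Finset.sum_congr rfl fun i hi => by simp [Finset.mem_range.1 hi]
  · intro i hi
    simp [Finset.mem_range] at hi
    simp [hi]

/-- The number of summands is random, so the sum is written as a series with indicators of `i < d
[]`; these depend on the root only, and the branching property applies to each term. The map `σ`
allows the `i`-th term to look at the subtree of a sibling of `i`. -/
lemma lintegral_sum_children_comp (p : PMF ℕ) (σ : ℕ → ℕ) {A : ℕ → Env → ℝ≥0∞}
    {B : Env → ℝ≥0∞} (hA : ∀ i, Measurable (A i)) (hB : Measurable B)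
    (hAu : ∀ i, ∀ d d' : Env, (∀ v, ¬ [σ i] <:+ v → d v = d' v) → A i d = A i d') :
    ∫⁻ d, ∑ i ∈ Finset.range (d []), A i d * B (sub [σ i] d) ∂(gw p) =
      (∫⁻ d, ∑ i ∈ Finset.range (d []), A i d ∂(gw p)) * ∫⁻ d, B d ∂(gw p) := by
  have hm : ∀ i, MeasurableSet {d : Env | i < d []} := fun i =>
    measurableSet_lt measurable_const (measurable_pi_apply _)
  have hA' : ∀ i, Measurable fun d : Env => if i < d [] then A i d else 0 := fun i =>
    Measurable.ite (hm i) (hA i) measurable_const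
  simp_rw [sum_range_eq_tsum]
  rw [lintegral_tsum fun i => (hA' i).aemeasurable, lintegral_tsum, ← ENNReal.tsum_mul_right]
  · refine tsum_congr fun i => ?_
    rw [← lintegral_branching p [σ i] (hA' i) hB]
    · refine lintegral_congr fun d => ?_
      split_ifs <;> simp
    · intro d d' h
      rw [hAu i d d' h, h [] (by simp)]
  · exact fun i => (Measurable.ite (hm i) ((hA i).mul (hB.comp (measurable_sub _)))
      measurable_const).aemeasurable

lemma lintegral_sum_children (p : PMF ℕ) {A : ℕ → Env → ℝ≥0∞} {B : Env → ℝ≥0∞}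
    (hA : ∀ i, Measurable (A i)) (hB : Measurable B)
    (hAu : ∀ i, ∀ d d' : Env, (∀ v, ¬ [i] <:+ v → d v = d' v) → A i d = A i d') :
    ∫⁻ d, ∑ i ∈ Finset.range (d []), A i d * B (sub [i] d) ∂(gw p) =
      (∫⁻ d, ∑ i ∈ Finset.range (d []), A i d ∂(gw p)) * ∫⁻ d, B d ∂(gw p) :=
  lintegral_sum_children_comp p id hA hB hAu

lemma lintegral_offspring (p : PMF ℕ) :
    ∫⁻ d, ∑ _i ∈ Finset.range (d []), (1 : ℝ≥0∞) ∂(gw p) = offspringMean p := by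
  simp only [Finset.sum_const, Finset.card_range, nsmul_eq_mul, mul_one]
  exact lintegral_root p fun k => (k : ℝ≥0∞)

lemma lintegral_sum_sub (p : PMF ℕ) {B : Env → ℝ≥0∞} (hB : Measurable B) :
    ∫⁻ d, ∑ i ∈ Finset.range (d []), B (sub [i] d) ∂(gw p) =
      offspringMean p * ∫⁻ d, B d ∂(gw p) := by
  have := lintegral_sum_children p (A := fun _ _ => 1) (fun _ => measurable_const) hB
    (fun _ _ _ _ => rfl)
  simpa [← lintegral_offspring p] using this

/-! ### The escape probability -/

/-- The probability to reach level `n` below the root before the parent of the root, which is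
attached to the root by an edge, when the walk is started at the root. -/
def escAux (c : ℝ≥0) : ℕ → Env → ℝ≥0
  | 0, _ => 1
  | n + 1, d => (∑ i ∈ Finset.range (d []), escAux c n (sub [i] d)) /
      (c + ∑ i ∈ Finset.range (d []), escAux c n (sub [i] d))

lemma measurable_escAux (c : ℝ≥0) (n : ℕ) : Measurable (escAux c n) := by
  induction n with
  | zero => exact measurable_const
  | succ n ih =>
    have h := measurable_sum_children (f := fun i d => escAux c n (sub [i] d))
      fun i => ih.comp (measurable_sub _)
    exact h.div (measurable_const.add h)

lemma div_add_mono {c s t : ℝ≥0} (hc : 0 < c) (hst : s ≤ t) : s / (c + s) ≤ t / (c + t) := by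
  rw [div_le_div_iff₀ (by positivity) (by positivity)]
  nlinarith [mul_le_mul_of_nonneg_right hst hc.le]

lemma escAux_le_one (c : ℝ≥0) (n : ℕ) (d : Env) : escAux c n d ≤ 1 := by
  cases n with
  | zero => simp [escAux]
  | succ n => exact div_le_one_of_le₀ (by simp) (by positivity)

lemma escAux_antitone {c : ℝ≥0} (hc : 0 < c) (d : Env) : Antitone fun n => escAux c n d := by
  refine antitone_nat_of_succ_le fun n => ?_
  induction n generalizing d with
  | zero => exact escAux_le_one c 1 d
  | succ n ih => exact div_add_mono hc (Finset.sum_le_sum fun i _ => ih _)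

/-- The probability never to hit the parent of the root, when started at the root. -/
def esc (c : ℝ≥0) (d : Env) : ℝ≥0 := ⨅ n, escAux c n d

lemma measurable_esc (c : ℝ≥0) : Measurable (esc c) :=
  Measurable.iInf fun n => measurable_escAux c n

lemma esc_le_escAux (c : ℝ≥0) (n : ℕ) (d : Env) : esc c d ≤ escAux c n d :=
  ciInf_le (OrderBot.bddBelow _) n

lemma esc_le_one (c : ℝ≥0) (d : Env) : esc c d ≤ 1 := esc_le_escAux c 0 d

lemma tendsto_escAux {c : ℝ≥0} (hc : 0 < c) (d : Env) :
    Filter.Tendsto (fun n => escAux c n d) Filter.atTop (nhds (esc c d)) :=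
  tendsto_atTop_ciInf (escAux_antitone hc d) (OrderBot.bddBelow _)

lemma esc_eq {c : ℝ≥0} (hc : 0 < c) (d : Env) :
    esc c d = (∑ i ∈ Finset.range (d []), esc c (sub [i] d)) /
      (c + ∑ i ∈ Finset.range (d []), esc c (sub [i] d)) := by
  have h := tendsto_finsetSum (Finset.range (d [])) fun i _ => tendsto_escAux hc (sub [i] d)
  refine tendsto_nhds_unique ((tendsto_escAux hc d).comp (Filter.tendsto_add_atTop_nat 1)) ?_
  exact h.div (tendsto_const_nhds.add h) (by positivity)

/-! ### Energy of the uniform flow and the mean escape probability -/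

/-- The normalised size of generation `n`. -/
def wt (m : ℝ≥0) : ℕ → Env → ℝ≥0
  | 0, _ => 1
  | n + 1, d => (∑ i ∈ Finset.range (d []), wt m n (sub [i] d)) / m

/-- The energy of the flow which is proportional to the number of descendants in
generation `n`. -/
def energy (c m : ℝ≥0) : ℕ → Env → ℝ≥0
  | 0, _ => 1
  | n + 1, d => wt m (n + 1) d ^ 2 +
      c / m ^ 2 * ∑ i ∈ Finset.range (d []), energy c m n (sub [i] d)

lemma measurable_wt (m : ℝ≥0) (n : ℕ) : Measurable (wt m n) := by
  induction n with
  | zero => exact measurable_const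
  | succ n ih =>
    exact (measurable_sum_children (f := fun i d => wt m n (sub [i] d))
      fun i => ih.comp (measurable_sub _)).div_const m

lemma measurable_energy (c m : ℝ≥0) (n : ℕ) : Measurable (energy c m n) := by
  induction n with
  | zero => exact measurable_const
  | succ n ih =>
    exact ((measurable_wt m (n + 1)).pow_const 2).add
      ((measurable_sum_children (f := fun i d => energy c m n (sub [i] d))
      fun i => ih.comp (measurable_sub _)).const_mul _)

/-- Thomson's principle for a flow of strength `wt`: the energy of any flow is at least its squared
strength over the effective conductance. In recursive form it is Cauchy–Schwarz over the offspring
of the root. -/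
lemma wt_sq_le {c : ℝ≥0} (m : ℝ≥0) (hc : 0 < c) (n : ℕ) (d : Env) :
    wt m n d ^ 2 ≤ energy c m n d * escAux c n d := by
  induction n generalizing d with
  | zero => simp [wt, energy, escAux]
  | succ n ih =>
    have h := Finset.sum_sq_le_sum_mul_sum_of_sq_le_mul (Finset.range (d []))
      (r := fun i => wt m n (sub [i] d)) (f := fun i => energy c m n (sub [i] d))
      (g := fun i => escAux c n (sub [i] d)) (fun _ _ => bot_le) (fun _ _ => bot_le)
      fun i _ => ih _
    simp only [energy, escAux, wt]
    set W := ∑ i ∈ Finset.range (d []), wt m n (sub [i] d)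
    set Q := ∑ i ∈ Finset.range (d []), energy c m n (sub [i] d)
    set s := ∑ i ∈ Finset.range (d []), escAux c n (sub [i] d)
    rw [← mul_div_assoc, le_div_iff₀ (by positivity)]
    calc (W / m) ^ 2 * (c + s) = c / m ^ 2 * W ^ 2 + (W / m) ^ 2 * s := by
          rw [div_pow, div_eq_mul_inv, div_eq_mul_inv]; ring
      _ ≤ c / m ^ 2 * (Q * s) + (W / m) ^ 2 * s := by gcongr
      _ = _ := by ring

lemma coe_wt_succ {m : ℝ≥0} (hm : 0 < m) (n : ℕ) (d : Env) : (wt m (n + 1) d : ℝ≥0∞) =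
    (∑ i ∈ Finset.range (d []), (wt m n (sub [i] d) : ℝ≥0∞)) * (m : ℝ≥0∞)⁻¹ := by
  simp only [wt]
  rw [ENNReal.coe_div hm.ne', div_eq_mul_inv]
  push_cast
  rfl

lemma lintegral_wt (p : PMF ℕ) {m : ℝ≥0} (hmean : offspringMean p = m) (hm : 0 < m) (n : ℕ) :
    ∫⁻ d, (wt m n d : ℝ≥0∞) ∂(gw p) = 1 := by
  induction n with
  | zero => simp [wt]
  | succ n ih =>
    have hB : Measurable fun d => (wt m n d : ℝ≥0∞) := (measurable_wt m n).coe_nnreal_ennreal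
    simp_rw [coe_wt_succ hm]
    have hS := measurable_sum_children (f := fun i d => (wt m n (sub [i] d) : ℝ≥0∞))
      fun i => hB.comp (measurable_sub [i])
    rw [lintegral_mul_const _ hS, lintegral_sum_sub p hB, ih, hmean, mul_one,
      ENNReal.mul_inv_cancel (by exact_mod_cast hm.ne') ENNReal.coe_ne_top]

lemma bounded_of_recursion {u : ℕ → ℝ≥0∞} {a r : ℝ≥0∞} (ha : a ≠ ⊤) (hr : r < 1)
    (h0 : u 0 ≠ ⊤) (hu : ∀ n, u (n + 1) ≤ a + r * u n) :
    ∃ C : ℝ≥0∞, C ≠ ⊤ ∧ ∀ n, u n ≤ C := by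
  have h1 : (1 - r) ≠ 0 := (tsub_pos_of_lt hr).ne'
  have h2 : (1 - r) ≠ ⊤ := ne_top_of_le_ne_top ENNReal.one_ne_top tsub_le_self
  have h3 : 1 + r * (1 - r)⁻¹ = (1 - r)⁻¹ := by
    calc 1 + r * (1 - r)⁻¹ = (1 - r) * (1 - r)⁻¹ + r * (1 - r)⁻¹ := by
          rw [ENNReal.mul_inv_cancel h1 h2]
      _ = _ := by rw [← add_mul, tsub_add_cancel_of_le hr.le, one_mul]
  refine ⟨(u 0 + a) * (1 - r)⁻¹, ENNReal.mul_ne_top (by finiteness) (by simp [h1]), fun n => ?_⟩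
  induction n with
  | zero =>
    calc u 0 ≤ (u 0 + a) * 1 := by rw [mul_one]; exact le_self_add
      _ ≤ _ := by gcongr; rw [ENNReal.one_le_inv]; exact tsub_le_self
  | succ n ih =>
    calc u (n + 1) ≤ a + r * u n := hu n
      _ ≤ (u 0 + a) * 1 + r * ((u 0 + a) * (1 - r)⁻¹) := by
          gcongr
          rw [mul_one]; exact le_add_self
      _ = (u 0 + a) * (1 + r * (1 - r)⁻¹) := by ring
      _ = _ := by rw [h3]

lemma sq_sum_eq {ι R : Type*} [DecidableEq ι] [CommSemiring R] (s : Finset ι) (f : ι → R) :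
    (∑ i ∈ s, f i) ^ 2 = ∑ i ∈ s, f i ^ 2 + ∑ i ∈ s, (∑ j ∈ s.erase i, f j) * f i := by
  rw [sq, Finset.sum_mul, ← Finset.sum_add_distrib]
  refine Finset.sum_congr rfl fun i hi => ?_
  rw [← Finset.add_sum_erase s f hi]
  ring

lemma sub_eq_of_eq {i j : ℕ} (hij : j ≠ i) {d d' : Env} (h : ∀ v, ¬ [i] <:+ v → d v = d' v) :
    sub [j] d = sub [j] d' := by
  funext v
  refine h _ fun ⟨w, hw⟩ => hij ?_
  simpa using (List.append_inj' hw rfl).2.symm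

/-- The square of a sum over the offspring splits into diagonal terms, which give the contraction
factor `1 / m`, and cross terms, which are products of independent variables of mean one. -/
lemma lintegral_wt_sq_succ (p : PMF ℕ) {m : ℝ≥0} (hmean : offspringMean p = m) (hm : 0 < m)
    (n : ℕ) :
    ∫⁻ d, (wt m (n + 1) d : ℝ≥0∞) ^ 2 ∂(gw p) ≤ (∫⁻ d, (d [] : ℝ≥0∞) ^ 2 ∂(gw p)) *
      (m : ℝ≥0∞)⁻¹ ^ 2 + (m : ℝ≥0∞)⁻¹ * ∫⁻ d, (wt m n d : ℝ≥0∞) ^ 2 ∂(gw p) := by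
  set w : Env → ℝ≥0∞ := fun d => (wt m n d : ℝ≥0∞)
  have hw : Measurable w := (measurable_wt m n).coe_nnreal_ennreal
  have hw2 : Measurable fun d => w d ^ 2 := hw.pow_const 2
  have hi : ∀ i, Measurable fun d : Env => w (sub [i] d) := fun i => hw.comp (measurable_sub _)
  have hS1 := measurable_sum_children (f := fun i d => w (sub [i] d) ^ 2)
    fun i => (hi i).pow_const 2
  have hE : ∀ i, Measurable fun d : Env => ∑ j ∈ (Finset.range (d [])).erase i, w (sub [j] d) := by
    intro i
    have h : Measurable fun z : ℕ × Env => ∑ j ∈ (Finset.range z.1).erase i, w (sub [j] z.2) :=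
      measurable_from_prod_countable_right fun n => by
        simpa using Finset.measurable_sum ((Finset.range n).erase i) fun j _ => hi j
    have h2 : Measurable fun d : Env => (d [], d) := (measurable_pi_apply _).prodMk measurable_id
    exact h.comp h2
  have hroot : Measurable fun d : Env => (d [] : ℝ≥0∞) :=
    (Measurable.of_discrete (f := fun k : ℕ => (k : ℝ≥0∞))).comp (measurable_pi_apply ([] : Vertex))
  have hone : ∫⁻ d, w d ∂(gw p) = 1 := lintegral_wt p hmean hm n
  have hroot_indep : ∀ i, ∀ d d' : Env, (∀ v, ¬ [i] <:+ v → d v = d' v) →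
      (d [] : ℝ≥0∞) = d' [] := fun i d d' h => by rw [h [] (by simp)]
  have h2 : ∫⁻ d, ∑ i ∈ Finset.range (d []),
      (∑ j ∈ (Finset.range (d [])).erase i, w (sub [j] d)) * w (sub [i] d) ∂(gw p) ≤
      ∫⁻ d, (d [] : ℝ≥0∞) ^ 2 ∂(gw p) := by
    -- The subtree at `i` is integrated out first. Then the excluded index is restored, which only
    -- increases the sum, so that the remaining factor can be integrated in the same way.
    rw [lintegral_sum_children p hE hw, hone, mul_one]
    · calc _ ≤ ∫⁻ d, ∑ i ∈ Finset.range (d []), (d [] : ℝ≥0∞) * w (sub [i] d) ∂(gw p) := by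
            refine lintegral_mono fun d => ?_
            calc _ ≤ ∑ i ∈ Finset.range (d []), ∑ j ∈ Finset.range (d []), w (sub [j] d) := by
                  refine Finset.sum_le_sum fun i _ => ?_
                  exact Finset.sum_le_sum_of_subset (Finset.erase_subset _ _)
              _ = _ := by simp [Finset.mul_sum]
        _ = _ := by
            rw [lintegral_sum_children p (fun _ => hroot) hw hroot_indep, hone, mul_one]
            refine lintegral_congr fun d => ?_
            simp [sq]
    · intro i d d' h
      rw [h [] (by simp)]
      refine Finset.sum_congr rfl fun j hj => ?_
      rw [sub_eq_of_eq (Finset.ne_of_mem_erase hj) h]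
  have hmm : (m : ℝ≥0∞)⁻¹ ^ 2 * m = (m : ℝ≥0∞)⁻¹ := by
    rw [sq, mul_assoc, ENNReal.inv_mul_cancel (by exact_mod_cast hm.ne') ENNReal.coe_ne_top,
      mul_one]
  calc _ = ∫⁻ d, (∑ i ∈ Finset.range (d []), w (sub [i] d) ^ 2 + ∑ i ∈ Finset.range (d []),
        (∑ j ∈ (Finset.range (d [])).erase i, w (sub [j] d)) * w (sub [i] d)) *
          (m : ℝ≥0∞)⁻¹ ^ 2 ∂(gw p) := by
        refine lintegral_congr fun d => ?_
        rw [coe_wt_succ hm, mul_pow, sq_sum_eq]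
    _ = (m * ∫⁻ d, w d ^ 2 ∂(gw p) + ∫⁻ d, ∑ i ∈ Finset.range (d []),
        (∑ j ∈ (Finset.range (d [])).erase i, w (sub [j] d)) * w (sub [i] d) ∂(gw p)) *
          (m : ℝ≥0∞)⁻¹ ^ 2 := by
        rw [lintegral_mul_const' _ _ (by finiteness), lintegral_add_left hS1,
          lintegral_sum_sub p hw2, hmean]
    _ ≤ (m * ∫⁻ d, w d ^ 2 ∂(gw p) + ∫⁻ d, (d [] : ℝ≥0∞) ^ 2 ∂(gw p)) *
          (m : ℝ≥0∞)⁻¹ ^ 2 := by gcongr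
    _ = _ := by
        rw [add_mul, add_comm, mul_right_comm, mul_comm (m : ℝ≥0∞), hmm]

/-- Two affine recursions: second moments of `wt` contract by `1 / m`, hence are bounded, and they
feed the recursion for the mean energy, which contracts by `c / m`. The latter is where the bias
must be below the mean. -/
lemma exists_lintegral_energy_le (p : PMF ℕ) {c m : ℝ≥0} (hmean : offspringMean p = m)
    (hm : 1 < m) (hcm : c < m) (hD : ∫⁻ d, (d [] : ℝ≥0∞) ^ 2 ∂(gw p) ≠ ⊤) :
    ∃ C : ℝ≥0∞, C ≠ ⊤ ∧ ∀ n, ∫⁻ d, (energy c m n d : ℝ≥0∞) ∂(gw p) ≤ C := by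
  have hm0 : 0 < m := zero_lt_one.trans hm
  have hm0' : (m : ℝ≥0∞) ≠ 0 := by exact_mod_cast hm0.ne'
  obtain ⟨V, hV, hVn⟩ := bounded_of_recursion (u := fun n => ∫⁻ d, (wt m n d : ℝ≥0∞) ^ 2 ∂(gw p))
    (a := (∫⁻ d, (d [] : ℝ≥0∞) ^ 2 ∂(gw p)) * (m : ℝ≥0∞)⁻¹ ^ 2) (r := (m : ℝ≥0∞)⁻¹)
    (by finiteness) (by rw [ENNReal.inv_lt_one]; exact_mod_cast hm) (by simp [wt])
    fun n => lintegral_wt_sq_succ p hmean hm0 n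
  refine bounded_of_recursion (a := V) (r := c / m) hV ?_ (by simp [energy]) fun n => ?_
  · rw [ENNReal.div_lt_iff (Or.inl hm0') (Or.inl ENNReal.coe_ne_top), one_mul]
    exact_mod_cast hcm
  · have hq : Measurable fun d => (energy c m n d : ℝ≥0∞) :=
      (measurable_energy c m n).coe_nnreal_ennreal
    have hS := measurable_sum_children (f := fun i d => (energy c m n (sub [i] d) : ℝ≥0∞))
      fun i => hq.comp (measurable_sub [i])
    have h : ∀ d, (energy c m (n + 1) d : ℝ≥0∞) = (wt m (n + 1) d : ℝ≥0∞) ^ 2 +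
        (c / m ^ 2 : ℝ≥0) * ∑ i ∈ Finset.range (d []), (energy c m n (sub [i] d) : ℝ≥0∞) := by
      intro d
      simp only [energy]
      push_cast
      rfl
    have hcc : ((c / m ^ 2 : ℝ≥0) : ℝ≥0∞) * m = c / m := by
      rw [← ENNReal.coe_div hm0.ne', ← ENNReal.coe_mul]
      congr 1
      field_simp
    simp_rw [h]
    rw [lintegral_add_left ((measurable_wt m (n + 1)).coe_nnreal_ennreal.pow_const 2),
      lintegral_const_mul _ hS, lintegral_sum_sub p hq, hmean, ← mul_assoc, hcc]
    gcongr
    exact hVn (n + 1)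

/-- The mean of `escAux` stays away from zero uniformly in `n`, by `wt_sq_le` and the energy bound;
monotone convergence passes this to the limit. -/
lemma lintegral_esc_pos (p : PMF ℕ) {c m : ℝ≥0} (hmean : offspringMean p = m)
    (hm : 1 < m) (hc : 0 < c) (hcm : c < m) (hD : ∫⁻ d, (d [] : ℝ≥0∞) ^ 2 ∂(gw p) ≠ ⊤) :
    ∫⁻ d, (esc c d : ℝ≥0∞) ∂(gw p) ≠ 0 := by
  have hm0 : 0 < m := zero_lt_one.trans hm
  obtain ⟨C, hC, hCn⟩ := exists_lintegral_energy_le p hmean hm hcm hD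
  lift C to ℝ≥0 using hC
  set a : ℝ≥0 := C + 1
  have ha : 0 < a := by positivity
  have hmeas : ∀ n, Measurable fun d => (escAux c n d : ℝ≥0∞) := fun n =>
    (measurable_escAux c n).coe_nnreal_ennreal
  have hlow : ∀ n, (a : ℝ≥0∞)⁻¹ ≤ ∫⁻ d, (escAux c n d : ℝ≥0∞) ∂(gw p) := by
    intro n
    -- The arithmetic–geometric mean inequality linearises `wt_sq_le`. After integration the energy
    -- term is at most 1 since `a` exceeds the energy bound, while the left side is 2, so the escape
    -- term keeps at least 1.
    have hpt : ∀ d, 2 * wt m n d ≤ a⁻¹ * energy c m n d + a * escAux c n d := by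
      intro d
      have h := wt_sq_le m hc n d
      rw [← NNReal.coe_le_coe] at h ⊢
      push_cast at h ⊢
      have ha' : (0 : ℝ) < a := ha
      refine le_of_sq_le_sq ?_ (by positivity)
      have h1 : (a : ℝ)⁻¹ * a = 1 := inv_mul_cancel₀ ha'.ne'
      nlinarith [sq_nonneg ((a : ℝ)⁻¹ * energy c m n d - a * escAux c n d)]
    have h2 : (2 : ℝ≥0∞) ≤ 1 + a * ∫⁻ d, (escAux c n d : ℝ≥0∞) ∂(gw p) := by
      calc (2 : ℝ≥0∞) = ∫⁻ d, 2 * (wt m n d : ℝ≥0∞) ∂(gw p) := by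
            rw [lintegral_const_mul _ (measurable_wt m n).coe_nnreal_ennreal,
              lintegral_wt p hmean hm0, mul_one]
        _ ≤ ∫⁻ d, ((a⁻¹ : ℝ≥0) : ℝ≥0∞) * energy c m n d + a * escAux c n d ∂(gw p) := by
            refine lintegral_mono fun d => ?_
            have := ENNReal.coe_le_coe.2 (hpt d)
            rwa [ENNReal.coe_add, ENNReal.coe_mul, ENNReal.coe_mul, ENNReal.coe_mul] at this
        _ = ((a⁻¹ : ℝ≥0) : ℝ≥0∞) * ∫⁻ d, (energy c m n d : ℝ≥0∞) ∂(gw p) +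
            a * ∫⁻ d, (escAux c n d : ℝ≥0∞) ∂(gw p) := by
            rw [lintegral_add_right _ ((hmeas n).const_mul _),
              lintegral_const_mul _ (measurable_energy c m n).coe_nnreal_ennreal,
              lintegral_const_mul _ (hmeas n)]
        _ ≤ _ := by
            gcongr
            calc ((a⁻¹ : ℝ≥0) : ℝ≥0∞) * ∫⁻ d, (energy c m n d : ℝ≥0∞) ∂(gw p)
                ≤ ((a⁻¹ : ℝ≥0) : ℝ≥0∞) * a := by
                  gcongr
                  refine (hCn n).trans ?_
                  exact_mod_cast (le_add_of_nonneg_right zero_le_one : C ≤ C + 1)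
              _ = 1 := by
                  rw [← ENNReal.coe_mul, inv_mul_cancel₀ ha.ne', ENNReal.coe_one]
    have h3 : (1 : ℝ≥0∞) ≤ a * ∫⁻ d, (escAux c n d : ℝ≥0∞) ∂(gw p) := by
      rw [← one_add_one_eq_two] at h2
      exact (ENNReal.add_le_add_iff_left ENNReal.one_ne_top).1 h2
    rw [← one_div]
    exact ENNReal.div_le_of_le_mul' h3
  have hlim : ∫⁻ d, (esc c d : ℝ≥0∞) ∂(gw p) =
      ⨅ n, ∫⁻ d, (escAux c n d : ℝ≥0∞) ∂(gw p) := by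
    rw [← lintegral_iInf hmeas]
    · refine lintegral_congr fun d => ?_
      rw [esc, ENNReal.coe_iInf]
    · intro n k hnk d
      exact ENNReal.coe_le_coe.2 (escAux_antitone hc d hnk)
    · simp [escAux]
  rw [hlim]
  exact (lt_of_lt_of_le (by simp) (le_iInf hlow)).ne'

/-! ### Almost sure positivity of the escape probability -/

lemma lintegral_ite_root (p : PMF ℕ) (k : ℕ) :
    ∫⁻ d, (if d [] = k then 1 else 0 : ℝ≥0∞) ∂(gw p) = p k := by
  rw [lintegral_root p fun n => if n = k then 1 else 0, tsum_eq_single k]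
  · simp
  · intro n hn; simp [hn]

lemma measurable_root {α : Type*} [MeasurableSpace α] (f : ℕ → α) :
    Measurable fun d : Env => f (d []) :=
  (Measurable.of_discrete (f := f)).comp (measurable_pi_apply ([] : Vertex))

lemma prob_one_lt_one (p : PMF ℕ) (hm : 1 < offspringMean p) : p 1 < 1 := by
  refine lt_of_le_of_ne (p.coe_le_one 1) fun h => ?_
  have hs := (PMF.apply_eq_one_iff p 1).1 h
  refine hm.ne' ?_
  rw [offspringMean, tsum_eq_single 1]
  · simp [h]
  · intro n hn
    have : n ∉ p.support := by rw [hs]; simpa using hn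
    rw [PMF.mem_support_iff, not_not] at this
    simp [this]

/-- A zero-one law. If the escape probability vanishes at the root, it vanishes at all offspring;
looking at two of them at most, the probability `x` of this event satisfies `x ≤ (p 1 + (1 - p 1) *
x) * x`. As `x < 1` and `p 1 < 1`, this forces `x = 0`. -/
lemma measure_esc_eq_zero (p : PMF ℕ) (hp0 : p 0 = 0) {c : ℝ≥0} (hc : 0 < c)
    (hm : 1 < offspringMean p) (hesc : ∫⁻ d, (esc c d : ℝ≥0∞) ∂(gw p) ≠ 0) :
    gw p {d | esc c d = 0} = 0 := by
  set x := gw p {d | esc c d = 0} with hx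
  have hmz : MeasurableSet {d | esc c d = 0} := measurableSet_eq_fun (measurable_esc c)
    measurable_const
  have hx1 : x < 1 := by
    refine lt_of_le_of_ne prob_le_one fun h => hesc ?_
    rw [lintegral_eq_zero_iff (measurable_esc c).coe_nnreal_ennreal]
    have := (mem_ae_iff_prob_eq_one hmz).2 h
    filter_upwards [this] with d hd
    simpa using hd
  set B : Env → ℝ≥0∞ := fun d => if esc c d = 0 then 1 else 0
  have hB : Measurable B := Measurable.ite hmz measurable_const measurable_const
  have hBx : ∫⁻ d, B d ∂(gw p) = x := by
    rw [hx, ← lintegral_indicator_one hmz]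
    exact lintegral_congr fun d => by simp [B, Set.indicator]
  -- The condition imposed by the second offspring, void if the root has only one. It does not
  -- involve the subtree at `[0]`, so it is independent of the condition there.
  set A : Env → ℝ≥0∞ := fun d => (if d [] = 1 then 1 else 0) +
    (if d [] = 1 then 0 else 1) * B (sub [1] d)
  have hA1 : Measurable fun d : Env => (if d [] = 1 then 1 else 0 : ℝ≥0∞) :=
    measurable_root fun n => if n = 1 then 1 else 0
  have hA2 : Measurable fun d : Env => (if d [] = 1 then 0 else 1 : ℝ≥0∞) :=
    measurable_root fun n => if n = 1 then 0 else 1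
  have hA : Measurable A := hA1.add (hA2.mul (hB.comp (measurable_sub _)))
  set r := ∫⁻ d, (if d [] = 1 then 0 else 1 : ℝ≥0∞) ∂(gw p) with hr
  have hpr : p 1 + r = 1 := by
    rw [hr, ← lintegral_ite_root p 1, ← lintegral_add_left hA1]
    calc _ = ∫⁻ _d, (1 : ℝ≥0∞) ∂(gw p) := lintegral_congr fun d => by split_ifs <;> simp
      _ = 1 := by simp
  have hAx : ∫⁻ d, A d ∂(gw p) = p 1 + r * x := by
    rw [lintegral_add_left hA1, lintegral_ite_root, lintegral_branching p [1] hA2 hB, hBx]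
    intro d d' h
    rw [h [] (by simp)]
  have key : x ≤ (p 1 + r * x) * x := by
    calc x = ∫⁻ d, B d ∂(gw p) := hBx.symm
      _ ≤ ∫⁻ d, A d * B (sub [0] d) ∂(gw p) := by
          refine lintegral_mono_ae ?_
          filter_upwards [ae_pos p hp0] with d hd
          by_cases h0 : esc c d = 0
          · have hch : ∀ i < d [], esc c (sub [i] d) = 0 := by
              rw [esc_eq hc, div_eq_zero_iff] at h0
              intro i hi
              rcases h0 with h0 | h0
              · exact (Finset.sum_eq_zero_iff.1 h0) i (Finset.mem_range.2 hi)
              · exact absurd h0 (by positivity)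
            have h1 := hd []
            have hB0 : B (sub [0] d) = 1 := by simp [B, hch 0 (by omega)]
            rw [hB0, mul_one]
            by_cases h2 : d [] = 1
            · simp [A, B, h2, h0]
            · have hB1 : B (sub [1] d) = 1 := by simp [B, hch 1 (by omega)]
              simp [A, h2, hB1, B, h0]
          · simp [B, h0]
      _ = _ := by
          rw [lintegral_branching p [0] hA hB, hAx, hBx]
          intro d d' h
          simp only [A]
          rw [h [] (by simp), sub_eq_of_eq (by omega) h]
  by_contra hx0
  have hp1 := prob_one_lt_one p hm
  have hr1 : r ≤ 1 := by rw [← hpr]; exact le_add_self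
  have hr0 : r ≠ 0 := fun h => by rw [h, add_zero] at hpr; exact hp1.ne hpr
  have hlt : p 1 + r * x < 1 := by
    rw [← hpr]
    refine ENNReal.add_lt_add_left hp1.ne_top ?_
    calc r * x < r * 1 := by
          refine (ENNReal.mul_lt_mul_iff_right hr0 (ne_top_of_le_ne_top ENNReal.one_ne_top hr1)).2 hx1
      _ = r := mul_one r
  refine absurd key (not_le.2 ?_)
  calc (p 1 + r * x) * x < 1 * x :=
        (ENNReal.mul_lt_mul_iff_left hx0 hx1.ne_top).2 hlt
    _ = x := one_mul x

lemma exists_measure_esc_lt_le (p : PMF ℕ) {c : ℝ≥0} (h0 : gw p {d | esc c d = 0} = 0)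
    {η : ℝ≥0∞} (hη : η ≠ 0) : ∃ ε : ℝ≥0, 0 < ε ∧ gw p {d | esc c d < ε} ≤ η := by
  have hmeas : ∀ n : ℕ, MeasurableSet {d | esc c d < 1 / ((n : ℝ≥0) + 1)} := fun n =>
    measurableSet_lt (measurable_esc c) measurable_const
  have hanti : Antitone fun n : ℕ => {d | esc c d < 1 / ((n : ℝ≥0) + 1)} := by
    intro a b hab d hd
    simp only [Set.mem_ofPred_eq] at hd ⊢
    refine lt_of_lt_of_le hd ?_
    gcongr
  have hlim := tendsto_measure_iInter_atTop (μ := gw p) (fun n => (hmeas n).nullMeasurableSet)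
    hanti ⟨0, measure_ne_top _ _⟩
  have hI : (⋂ n : ℕ, {d | esc c d < 1 / ((n : ℝ≥0) + 1)}) ⊆ {d | esc c d = 0} := by
    intro d hd
    by_contra hne
    obtain ⟨n, hn⟩ := exists_nat_one_div_lt (pos_iff_ne_zero.2 hne)
    exact absurd (Set.mem_iInter.1 hd n) (not_lt.2 hn.le)
  rw [measure_mono_null hI h0] at hlim
  obtain ⟨n, hn⟩ := (hlim.eventually (Iio_mem_nhds (pos_iff_ne_zero.2 hη))).exists
  exact ⟨1 / ((n : ℝ≥0) + 1), by positivity, hn.le⟩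

/-! ### Side branches along an ancestral line -/

open Classical in
/-- `ρ` if the root has an offspring other than `i` from which the walk escapes with probability
at least `ε`, and `1` otherwise. -/
def sideFactor (c ε : ℝ≥0) (ρ : ℝ≥0∞) (i : ℕ) (d : Env) : ℝ≥0∞ :=
  if ∃ j < d [], j ≠ i ∧ ε ≤ esc c (sub [j] d) then ρ else 1

/-- The sum over generation `n` of the products of the `sideFactor`s along the path from the
root. -/
def sideSum (c ε : ℝ≥0) (ρ : ℝ≥0∞) : ℕ → Env → ℝ≥0∞
  | 0, _ => 1
  | n + 1, d => ∑ i ∈ Finset.range (d []), sideFactor c ε ρ i d * sideSum c ε ρ n (sub [i] d)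

lemma measurable_sideFactor (c ε : ℝ≥0) (ρ : ℝ≥0∞) (i : ℕ) :
    Measurable (sideFactor c ε ρ i) := by
  classical
  unfold sideFactor
  refine Measurable.ite ?_ measurable_const measurable_const
  have : {d : Env | ∃ j < d [], j ≠ i ∧ ε ≤ esc c (sub [j] d)} =
      ⋃ j, ({d : Env | j < d []} ∩ {_d | j ≠ i}) ∩ {d | ε ≤ esc c (sub [j] d)} := by
    ext d; simp [and_assoc]
  rw [this]
  exact MeasurableSet.iUnion fun j => ((measurableSet_lt measurable_const
    (measurable_pi_apply _)).inter (MeasurableSet.const _)).inter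
    (measurableSet_le measurable_const ((measurable_esc c).comp (measurable_sub _)))

lemma measurable_sideSum (c ε : ℝ≥0) (ρ : ℝ≥0∞) (n : ℕ) : Measurable (sideSum c ε ρ n) := by
  induction n with
  | zero => exact measurable_const
  | succ n ih =>
    exact measurable_sum_children (f := fun i d => sideFactor c ε ρ i d *
      sideSum c ε ρ n (sub [i] d)) fun i => (measurable_sideFactor c ε ρ i).mul
      (ih.comp (measurable_sub _))

lemma sideFactor_congr (c ε : ℝ≥0) (ρ : ℝ≥0∞) (i : ℕ) (d d' : Env)
    (h : ∀ v, ¬ [i] <:+ v → d v = d' v) : sideFactor c ε ρ i d = sideFactor c ε ρ i d' := by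
  have : (∃ j < d [], j ≠ i ∧ ε ≤ esc c (sub [j] d)) ↔
      ∃ j < d' [], j ≠ i ∧ ε ≤ esc c (sub [j] d') := by
    rw [h [] (by simp)]
    refine exists_congr fun j => and_congr_right fun _ => and_congr_right fun hj => ?_
    rw [sub_eq_of_eq hj h]
  simp only [sideFactor, this]

lemma lintegral_sideSum (p : PMF ℕ) (c ε : ℝ≥0) (ρ : ℝ≥0∞) (n : ℕ) :
    ∫⁻ d, sideSum c ε ρ n d ∂(gw p) =
      (∫⁻ d, ∑ i ∈ Finset.range (d []), sideFactor c ε ρ i d ∂(gw p)) ^ n := by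
  induction n with
  | zero => simp [sideSum]
  | succ n ih =>
    simp only [sideSum]
    rw [lintegral_sum_children p (measurable_sideFactor c ε ρ) (measurable_sideSum c ε ρ n)
      (sideFactor_congr c ε ρ), ih, pow_succ']

/-- A single offspring has no sibling and contributes 1, whence `p 1`. Otherwise one sibling of each
offspring is inspected, and the factor exceeds `ρ` only if that sibling has escape probability below
`ε`. -/
lemma lintegral_sideFactor_le (p : PMF ℕ) (c ε : ℝ≥0) {ρ : ℝ≥0∞} :
    ∫⁻ d, ∑ i ∈ Finset.range (d []), sideFactor c ε ρ i d ∂(gw p) ≤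
      p 1 + offspringMean p * (ρ + gw p {d | esc c d < ε}) := by
  set B : Env → ℝ≥0∞ := fun d => ρ + if esc c d < ε then 1 else 0
  have hm : MeasurableSet {d | esc c d < ε} := measurableSet_lt (measurable_esc c) measurable_const
  have hB : Measurable B := measurable_const.add (Measurable.ite hm measurable_const
    measurable_const)
  have hBi : ∫⁻ d, B d ∂(gw p) = ρ + gw p {d | esc c d < ε} := by
    rw [lintegral_add_left measurable_const, ← lintegral_indicator_one hm]
    simp only [lintegral_const, measure_univ, mul_one]
    congr 1
  -- The inspected sibling: 1 for the offspring 0, and 0 for every other one.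
  set σ : ℕ → ℕ := fun i => if i = 0 then 1 else 0
  have hσ : ∀ i, σ i ≠ i := fun i => by simp only [σ]; split_ifs <;> omega
  have hA1 : Measurable fun d : Env => (if d [] = 1 then 1 else 0 : ℝ≥0∞) :=
    measurable_root fun n => if n = 1 then 1 else 0
  have h1 := lintegral_sum_children_comp p σ (A := fun _ _ => 1) (fun _ => measurable_const) hB
    (fun _ _ _ _ => rfl)
  simp only [one_mul] at h1
  rw [lintegral_offspring, hBi] at h1
  rw [← h1, ← lintegral_ite_root p 1, ← lintegral_add_left hA1]
  refine lintegral_mono fun d => ?_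
  by_cases hd : d [] = 1
  · simp only [hd, Finset.range_one, Finset.sum_singleton, if_true]
    refine le_trans ?_ le_self_add
    unfold sideFactor
    rw [if_neg]
    rintro ⟨j, hj, hj0, -⟩
    omega
  · refine le_trans (Finset.sum_le_sum fun i hi => ?_) le_add_self
    have hi' := Finset.mem_range.1 hi
    unfold sideFactor
    split_ifs with h
    · exact le_self_add
    · have hlt : esc c (sub [σ i] d) < ε := by
        by_contra hc
        refine h ⟨σ i, ?_, hσ i, not_lt.1 hc⟩
        simp only [σ]; split_ifs <;> omega
      simp [B, hlt]

/-! ### Return to the root from a high level -/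

/-- `v` is a vertex of the tree `d`. -/
def InTree (d : Env) (v : Vertex) : Prop := ∀ i w, (i :: w) <:+ v → i < d w

lemma inTree_nil (d : Env) : InTree d [] := by
  intro i w h; simp at h

lemma inTree_cons {d : Env} {i : ℕ} {v : Vertex} :
    InTree d (i :: v) ↔ i < d v ∧ InTree d v := by
  constructor
  · intro h
    exact ⟨h i v List.suffix_rfl, fun j w hw => h j w (hw.trans (List.suffix_cons i v))⟩
  · rintro ⟨h1, h2⟩ j w hw
    rcases List.suffix_cons_iff.1 hw with h | h
    · obtain ⟨rfl, rfl⟩ := List.cons_eq_cons.1 h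
      exact h1
    · exact h2 j w h

lemma inTree_append_singleton {d : Env} {i : ℕ} {v : Vertex} (h : InTree d (v ++ [i])) :
    i < d [] ∧ InTree (sub [i] d) v :=
  ⟨h i [] ⟨v, by simp⟩, fun j w ⟨z, hz⟩ => h j (w ++ [i]) ⟨z, by rw [← hz]; simp⟩⟩

lemma IsWalk.inTree {d : Env} {x : ℕ → Vertex} (h : IsWalk d x) (t : ℕ) : InTree d (x t) := by
  induction t with
  | zero => rw [h.1]; exact inTree_nil d
  | succ t ih =>
    rcases h.2 t with ⟨i, hi, h'⟩ | ⟨i, h'⟩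
    · rw [h']; exact inTree_cons.2 ⟨hi, ih⟩
    · rw [h'] at ih; exact (inTree_cons.1 ih).2

/-- The probability to hit the parent of the root, when started at the root. -/
def ret (c : ℝ≥0) (d : Env) : ℝ≥0 := 1 - esc c d

lemma coe_ret (c : ℝ≥0) (d : Env) : (ret c d : ℝ) = 1 - esc c d := by
  rw [ret, NNReal.coe_sub (esc_le_one c d), NNReal.coe_one]

lemma ret_le_one (c : ℝ≥0) (d : Env) : ret c d ≤ 1 := tsub_le_self

lemma ret_eq {c : ℝ≥0} (hc : 0 < c) (d : Env) :
    ret c d = c / (c + ∑ i ∈ Finset.range (d []), esc c (sub [i] d)) := by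
  rw [← NNReal.coe_inj, coe_ret, esc_eq hc]
  push_cast
  field_simp
  ring

/-- The probability to hit the root, when started at `v`. -/
def hit (c : ℝ≥0) (d : Env) : Vertex → ℝ≥0
  | [] => 1
  | i :: v => hit c d v * ret c (sub (i :: v) d)

lemma hit_le_one (c : ℝ≥0) (d : Env) (v : Vertex) : hit c d v ≤ 1 := by
  induction v with
  | nil => exact le_rfl
  | cons i v ih => exact mul_le_one' ih (ret_le_one c _)

/-- All terms contain the factor `hit c d u`. With `r` the return probability at `j :: u` and `S`
the sum of the escape probabilities of its offspring, what remains is `r * (lam + S) = lam`, which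
is `ret_eq`. -/
lemma hit_harmonic {lam : ℝ} (hlam : 0 < lam) (d : Env) (j : ℕ) (u : Vertex) :
    ∫⁻ y, (hit lam.toNNReal d y : ℝ≥0∞) ∂(stepLaw lam (d (j :: u)) (j :: u)) =
      hit lam.toNNReal d (j :: u) := by
  set c := lam.toNNReal with hcdef
  have hc : 0 < c := Real.toNNReal_pos.2 hlam
  have hcl : (c : ℝ) = lam := Real.coe_toNNReal _ hlam.le
  set n := d (j :: u)
  rw [lintegral_stepLaw_cons]
  have hr := ret_eq hc (sub (j :: u) d)
  have hn : (sub (j :: u) d) [] = n := by simp [sub, n]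
  rw [hn] at hr
  have hcomp : ∀ i, hit c d (i :: j :: u) =
      hit c d (j :: u) * ret c (sub [i] (sub (j :: u) d)) := by
    intro i; rw [sub_sub]; rfl
  have hreal : lam / (lam + n) * (hit c d u : ℝ) +
      ∑ i ∈ Finset.range n, 1 / (lam + n) * (hit c d (i :: j :: u) : ℝ) = hit c d (j :: u) := by
    have hH : (hit c d (j :: u) : ℝ) = hit c d u * (1 - (esc c (sub (j :: u) d) : ℝ)) := by
      rw [hit, NNReal.coe_mul, coe_ret]
    simp only [hcomp, NNReal.coe_mul, hH, coe_ret]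
    set r : ℝ := 1 - (esc c (sub (j :: u) d) : ℝ) with hrdef
    set S : ℝ := ∑ i ∈ Finset.range n, (esc c (sub [i] (sub (j :: u) d)) : ℝ) with hS
    have hr' : r = lam / (lam + S) := by
      rw [hrdef, ← coe_ret, hr]
      push_cast
      rw [hcl]
    have hSpos : 0 < lam + S := add_pos_of_pos_of_nonneg hlam
      (Finset.sum_nonneg fun _ _ => NNReal.coe_nonneg _)
    have hrS : r * (lam + S) = lam := by rw [hr']; field_simp
    have hsum : ∑ i ∈ Finset.range n, 1 / (lam + n) *
        ((hit c d u : ℝ) * r * (1 - (esc c (sub [i] (sub (j :: u) d)) : ℝ))) =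
        1 / (lam + n) * ((hit c d u : ℝ) * r * (n - S)) := by
      rw [← Finset.mul_sum, ← Finset.mul_sum, Finset.sum_sub_distrib]
      simp [hS]
    rw [hsum]
    field_simp
    linear_combination -(hit c d u : ℝ) * hrS
  have hcast : ∀ v, (hit c d v : ℝ≥0∞) = ENNReal.ofReal (hit c d v) := fun v =>
    (ENNReal.ofReal_coe_nnreal).symm
  simp_rw [hcast]
  rw [← hreal, ENNReal.ofReal_add (by positivity)
    (Finset.sum_nonneg fun i _ => by positivity), ENNReal.ofReal_mul (by positivity),
    ENNReal.ofReal_sum_of_nonneg fun i _ => by positivity]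
  congr 1
  exact Finset.sum_congr rfl fun i _ => by rw [ENNReal.ofReal_mul (by positivity)]

/-- The product of the return probabilities over the strict ancestors of `v`. -/
def retProd (c : ℝ≥0) (d : Env) : Vertex → ℝ≥0
  | [] => 1
  | _ :: v => retProd c d v * ret c (sub v d)

/-- The factor at the vertex itself is dropped: only strict ancestors have a next vertex on the
line, with respect to which side branches are defined. The remaining factors all live in the subtree
at `[i]`. -/
lemma hit_append_singleton_le (c : ℝ≥0) (d : Env) (u : Vertex) (i : ℕ) :
    hit c d (u ++ [i]) ≤ retProd c (sub [i] d) u := by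
  have h : hit c d (u ++ [i]) = retProd c (sub [i] d) u * ret c (sub u (sub [i] d)) := by
    induction u with
    | nil => simp [hit, retProd]
    | cons j u ih =>
      rw [List.cons_append, hit, ih, retProd, sub_sub, sub_sub, List.cons_append]
  rw [h]
  exact mul_le_of_le_one_right' (ret_le_one c _)

lemma retProd_append_singleton (c : ℝ≥0) (d : Env) (u : Vertex) (i : ℕ) :
    retProd c d (u ++ [i]) = ret c d * retProd c (sub [i] d) u := by
  induction u with
  | nil => simp [retProd]
  | cons j u ih => rw [List.cons_append, retProd, ih, retProd, sub_sub, mul_assoc]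

/-- By `ret_eq`, one offspring with escape probability at least `ε` already brings the return
probability below `c / (c + ε)`. Using only offspring other than `i` keeps the bound independent of
the subtree at `i`. -/
lemma ret_pow_le_sideFactor {c ε : ℝ≥0} (hc : 0 < c) (A i : ℕ) (d : Env) :
    ((ret c d : ℝ≥0∞)) ^ A ≤ sideFactor c ε ((c / (c + ε) : ℝ≥0) ^ A) i d := by
  unfold sideFactor
  split_ifs with h
  · obtain ⟨j, hj, -, hj2⟩ := h
    have : ret c d ≤ c / (c + ε) := by
      rw [ret_eq hc]
      gcongr
      exact hj2.trans (Finset.single_le_sum (f := fun i => esc c (sub [i] d))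
        (fun _ _ => bot_le) (Finset.mem_range.2 hj))
    gcongr
  · exact pow_le_one' (by exact_mod_cast ret_le_one c d) A

lemma retProd_pow_le {c ε : ℝ≥0} (hc : 0 < c) (A : ℕ) (v : Vertex) (d : Env)
    (hv : InTree d v) :
    (retProd c d v : ℝ≥0∞) ^ A ≤ sideSum c ε ((c / (c + ε) : ℝ≥0) ^ A) v.length d := by
  induction v using List.reverseRecOn generalizing d with
  | nil => simp [retProd, sideSum]
  | append_singleton u i ih =>
    obtain ⟨hi, hu⟩ := inTree_append_singleton hv
    rw [retProd_append_singleton, ENNReal.coe_mul, mul_pow, List.length_append,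
      List.length_singleton, sideSum]
    refine le_trans (mul_le_mul' (ret_pow_le_sideFactor (ε := ε) hc A i d) (ih _ hu)) ?_
    exact Finset.single_le_sum (f := fun i => sideFactor c ε ((c / (c + ε) : ℝ≥0) ^ A) i d *
      sideSum c ε ((c / (c + ε) : ℝ≥0) ^ A) u.length (sub [i] d)) (fun _ _ => bot_le)
      (Finset.mem_range.2 hi)

lemma hit_pow_le {c ε : ℝ≥0} (hc : 0 < c) (A n : ℕ) {v : Vertex} {d : Env}
    (hv : InTree d v) (hn : v.length = n + 1) :
    (hit c d v : ℝ≥0∞) ^ A ≤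
      ∑ i ∈ Finset.range (d []), sideSum c ε ((c / (c + ε) : ℝ≥0) ^ A) n (sub [i] d) := by
  rcases List.eq_nil_or_concat v with rfl | ⟨u, i, rfl⟩
  · simp at hn
  · rw [List.concat_eq_append] at *
    obtain ⟨hi, hu⟩ := inTree_append_singleton hv
    have hun : u.length = n := by simpa using hn
    calc (hit c d (u ++ [i]) : ℝ≥0∞) ^ A ≤ (retProd c (sub [i] d) u : ℝ≥0∞) ^ A := by
          gcongr
          exact hit_append_singleton_le c d u i
      _ ≤ sideSum c ε ((c / (c + ε) : ℝ≥0) ^ A) n (sub [i] d) := by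
          rw [← hun]; exact retProd_pow_le hc A u _ hu
      _ ≤ _ := Finset.single_le_sum (f := fun i => sideSum c ε ((c / (c + ε) : ℝ≥0) ^ A) n
          (sub [i] d)) (fun _ _ => bot_le) (Finset.mem_range.2 hi)

open Classical in
/-- The walk reaches level `n` and hits the root afterwards, up to time `t`. -/
def ReachReturn (n t : ℕ) (x : ℕ → Vertex) : Prop :=
  ∃ s u, s < u ∧ u ≤ t ∧ (x s).length = n ∧ x u = []

lemma adapted_reachReturn (n t : ℕ) : Adapted t (ReachReturn n t) := by
  intro x y h
  unfold ReachReturn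
  simp only [eq_iff_iff]
  refine exists_congr fun s => exists_congr fun u => and_congr_right fun h1 =>
    and_congr_right fun h2 => ?_
  rw [h s (by omega), h u h2]

/-- Optional stopping in disguise: once level `n` is reached, the probability to come back is
controlled by the harmonic function `hit` at the entrance vertex, which is at most `z`. -/
lemma quenched_reachReturn_le {lam : ℝ} (hlam : 0 < lam) {d : Env} (hd : ∀ v, 1 ≤ d v) {n : ℕ}
    (hn : n ≠ 0) {z : ℝ≥0∞}
    (hz : ∀ v, InTree d v → v.length = n → (hit lam.toNNReal d v : ℝ≥0∞) ≤ z) :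
    quenched lam hlam d {x | ∃ t, ReachReturn n t x} ≤ z := by
  classical
  set h : Vertex → ℝ≥0∞ := fun v => (hit lam.toNNReal d v : ℝ≥0∞)
  set R : ℕ → (ℕ → Vertex) → Prop := fun t x => ∃ s ≤ t, (x s).length = n
  have hR : ∀ t, Adapted t (R t) := by
    intro t x y hxy
    simp only [R, eq_iff_iff]
    refine exists_congr fun s => and_congr_right fun hs => ?_
    rw [hxy s hs]
  -- The supermartingale: `z` before level `n` is reached, then `hit` along the walk, frozen at 1
  -- after the return to the root. It can only decrease in mean on entering level `n`, by `hz`.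
  set Φ : ℕ → (ℕ → Vertex) → ℝ≥0∞ := fun t x =>
    if ReachReturn n t x then 1 else if R t x then h (x t) else z with hΦdef
  have hΦ : ∀ t, Adapted t (Φ t) := by
    intro t x y hxy
    simp only [hΦdef, adapted_reachReturn n t x y hxy, hR t x y hxy, hxy t le_rfl]
  have hmono : ∀ t x, ReachReturn n t x → ReachReturn n (t + 1) x := by
    rintro t x ⟨s, u, h1, h2, h3⟩
    exact ⟨s, u, h1, by omega, h3⟩
  have hstep : ∀ t x, 0 ≤ t → IsWalk d x →
      ∫⁻ y, Φ (t + 1) (Function.update x (t + 1) y) ∂(stepLaw lam (d (x t)) (x t)) ≤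
        1 * Φ t x := by
    intro t x _ hx
    have := isProbabilityMeasure_stepLaw hlam (d (x t)) (x t)
    rw [one_mul]
    have hup : ∀ y, ∀ i ≤ t, Function.update x (t + 1) y i = x i := fun y i hi =>
      Function.update_of_ne (by omega) _ _
    by_cases h1 : ReachReturn n t x
    · calc _ ≤ ∫⁻ _y, (1 : ℝ≥0∞) ∂(stepLaw lam (d (x t)) (x t)) := by
            refine lintegral_mono fun y => ?_
            have : ReachReturn n (t + 1) (Function.update x (t + 1) y) := by
              refine hmono _ _ ?_
              rwa [adapted_reachReturn n t _ x (hup y)]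
            simp [hΦdef, this]
        _ = 1 := by simp
        _ = Φ t x := by simp [hΦdef, h1]
    · by_cases h2 : R t x
      · have hΦt : Φ t x = h (x t) := by simp [hΦdef, h1, h2]
        have hlow : ∀ y, Φ (t + 1) (Function.update x (t + 1) y) = h y := by
          intro y
          have hR' : R (t + 1) (Function.update x (t + 1) y) := by
            obtain ⟨s, hs, hs'⟩ := h2
            exact ⟨s, by omega, by rw [hup y s hs]; exact hs'⟩
          by_cases hy : y = []
          · subst hy
            have : ReachReturn n (t + 1) (Function.update x (t + 1) []) := by
              obtain ⟨s, hs, hs'⟩ := h2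
              exact ⟨s, t + 1, by omega, le_rfl, by rw [hup [] s hs]; exact hs', by simp⟩
            simp [hΦdef, this, h, hit]
          · have : ¬ ReachReturn n (t + 1) (Function.update x (t + 1) y) := by
              rintro ⟨s, u, hsu, hu, hs', hu'⟩
              rcases Nat.lt_or_ge t u with h3 | h3
              · obtain rfl : u = t + 1 := by omega
                exact hy (by simpa using hu')
              · refine h1 ⟨s, u, hsu, h3, ?_, ?_⟩
                · rwa [hup y s (by omega)] at hs'
                · rwa [hup y u h3] at hu'
            simp [hΦdef, this, hR']
        have hne : x t ≠ [] := by
          intro h0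
          obtain ⟨s, hs, hs'⟩ := h2
          rcases Nat.lt_or_ge s t with h3 | h3
          · exact h1 ⟨s, t, h3, le_rfl, hs', h0⟩
          · obtain rfl : s = t := by omega
            rw [h0] at hs'
            exact hn hs'.symm
        simp_rw [hlow]
        rw [hΦt]
        obtain ⟨j, u, hju⟩ := List.exists_cons_of_ne_nil hne
        rw [hju]
        exact (hit_harmonic hlam d j u).le
      · have hΦt : Φ t x = z := by simp [hΦdef, h1, h2]
        rw [hΦt]
        calc _ ≤ ∫⁻ _y, z ∂(stepLaw lam (d (x t)) (x t)) := by
              refine lintegral_mono_ae ?_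
              filter_upwards [ae_stepLaw_nbr lam d (x t) (hd _)] with y hy
              have hno : ¬ ReachReturn n (t + 1) (Function.update x (t + 1) y) := by
                rintro ⟨s, u, hsu, hu, hs', hu'⟩
                exact h2 ⟨s, by omega, by rwa [hup y s (by omega)] at hs'⟩
              by_cases hRy : R (t + 1) (Function.update x (t + 1) y)
              · simp only [hΦdef, hno, hRy, if_true, if_false, Function.update_self]
                obtain ⟨s, hs, hs'⟩ := hRy
                rcases Nat.lt_or_ge t s with h3 | h3
                · obtain rfl : s = t + 1 := by omega
                  rw [Function.update_self] at hs'
                  refine hz y ?_ hs'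
                  rcases hy with ⟨i, hi, rfl⟩ | ⟨i, hi⟩
                  · exact inTree_cons.2 ⟨hi, hx.inTree t⟩
                  · have := hx.inTree t
                    rw [hi] at this
                    exact (inTree_cons.1 this).2
                · exact absurd ⟨s, h3, by rwa [hup y s h3] at hs'⟩ h2
              · simp [hΦdef, hno, hRy]
          _ = z := by simp
  have hmain : ∀ t, quenched lam hlam d {x | ReachReturn n t x} ≤ z := by
    intro t
    have h1 := lintegral_le_geom hlam d hd 1 0 hΦ hstep t
    rw [one_pow, one_mul, zero_add] at h1
    have h0 : ∫⁻ x, Φ 0 x ∂(quenched lam hlam d) ≤ z := by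
      calc _ ≤ ∫⁻ _x, z ∂(quenched lam hlam d) := by
            refine lintegral_mono_ae ?_
            filter_upwards [ae_isWalk hlam d hd] with x hx
            have hno : ¬ ReachReturn n 0 x := by rintro ⟨s, u, h1, h2, -⟩; omega
            have hnoR : ¬ R 0 x := by
              rintro ⟨s, hs, hs'⟩
              obtain rfl : s = 0 := by omega
              rw [hx.1] at hs'
              exact hn hs'.symm
            simp [hΦdef, hno, hnoR]
        _ = z := by simp
    refine le_trans ?_ (h1.trans h0)
    rw [← lintegral_indicator_one (adapted_reachReturn n t).measurableSet]
    refine lintegral_mono fun x => ?_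
    by_cases hx : ReachReturn n t x
    · simp [hΦdef, hx, Set.indicator]
    · simp [hx, Set.indicator]
  have hU : {x | ∃ t, ReachReturn n t x} = ⋃ t, {x | ReachReturn n t x} := by ext x; simp
  rw [hU, Monotone.measure_iUnion]
  · exact iSup_le hmain
  · intro s t hst x
    simp only [Set.mem_ofPred_eq]
    rintro ⟨a, b, h1, h2, h3⟩
    exact ⟨a, b, h1, h2.trans hst, h3⟩

lemma measurableSet_exists_reachReturn (n : ℕ) :
    MeasurableSet {x | ∃ t, ReachReturn n t x} := by
  have : {x | ∃ t, ReachReturn n t x} = ⋃ t, {x | ReachReturn n t x} := by ext x; simp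
  rw [this]
  exact MeasurableSet.iUnion fun t => (adapted_reachReturn n t).measurableSet

/-- Either the hitting probability is at most `κ ^ n`, or its ratio to `κ ^ n` is at least 1 and
raising it to the power `A` makes the second term at least 1. This turns a bound for `A`-th powers
into one for the probability itself. -/
lemma hit_le_add {c ε : ℝ≥0} (hc : 0 < c) (A n : ℕ) {κ : ℝ≥0} (hκ : 0 < κ) {v : Vertex} {d : Env}
    (hv : InTree d v) (hn : v.length = n + 1) :
    (hit c d v : ℝ≥0∞) ≤ (κ ^ n : ℝ≥0) + (((κ ^ n)⁻¹ ^ A : ℝ≥0) : ℝ≥0∞) *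
      ∑ i ∈ Finset.range (d []), sideSum c ε ((c / (c + ε) : ℝ≥0) ^ A) n (sub [i] d) := by
  rcases le_total (hit c d v) (κ ^ n) with h | h
  · exact le_trans (by exact_mod_cast h) le_self_add
  · refine le_trans ?_ le_add_self
    calc (hit c d v : ℝ≥0∞) ≤ 1 := by exact_mod_cast hit_le_one c d v
      _ ≤ (((κ ^ n)⁻¹ ^ A * hit c d v ^ A : ℝ≥0) : ℝ≥0∞) := by
          rw [← mul_pow]
          have : 1 ≤ (κ ^ n)⁻¹ * hit c d v := by
            rw [← inv_mul_cancel₀ (pow_pos hκ n).ne']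
            gcongr
          exact_mod_cast one_le_pow₀ this
      _ ≤ _ := by
          rw [ENNReal.coe_mul, ENNReal.coe_pow (hit c d v)]
          gcongr
          exact hit_pow_le hc A n hv hn

/-- The probability to return to the root from level `n + 1` is exponentially small in `n`. -/
lemma exists_pathLaw_reachReturn_le (p : PMF ℕ) (hp0 : p 0 = 0) {lam : ℝ} (hlam : 0 < lam)
    {m : ℝ≥0} (hmean : offspringMean p = m) (hm : 1 < m) (hcm : lam.toNNReal < m)
    (hD : ∫⁻ d, (d [] : ℝ≥0∞) ^ 2 ∂(gw p) ≠ ⊤) :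
    ∃ C κ : ℝ≥0, κ < 1 ∧ ∀ n, pathLaw p lam hlam {x | ∃ t, ReachReturn (n + 1) t x} ≤
      (C * κ ^ n : ℝ≥0) := by
  set c := lam.toNNReal with hcdef
  have hc : 0 < c := Real.toNNReal_pos.2 hlam
  have hm1 : 1 < offspringMean p := by rw [hmean]; exact_mod_cast hm
  have hz := measure_esc_eq_zero p hp0 hc hm1 (lintegral_esc_pos p hmean hm hc hcm hD)
  obtain ⟨P, hP⟩ : ∃ P : ℝ≥0, p 1 = P := ⟨(p 1).toNNReal, (ENNReal.coe_toNNReal (p.apply_ne_top 1)).symm⟩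
  have hP1 : P < 1 := by
    have := prob_one_lt_one p hm1
    rw [hP] at this
    exact_mod_cast this
  -- `η` bounds both `P(esc < ε)` and `(c / (c + ε)) ^ A`. The constant makes their total
  -- contribution `(1 - P) / 2`, so the growth rate `θ` of the side sums lies below 1.
  set η : ℝ≥0 := (1 - P) / (4 * m) with hη
  have hηpos : 0 < η := div_pos (tsub_pos_of_lt hP1) (by positivity)
  set θ : ℝ≥0 := P + m * (η + η) with hθ
  have hPs : P + (1 - P) = 1 := add_tsub_cancel_of_le hP1.le
  have hmη : m * (η + η) = (1 - P) / 2 := by rw [hη]; field_simp; ring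
  have hPpos : 0 < 1 - P := tsub_pos_of_lt hP1
  have hθ1 : θ < 1 := by
    calc θ = P + (1 - P) / 2 := by rw [hθ, hmη]
      _ < P + (1 - P) := by gcongr; exact NNReal.half_lt_self hPpos.ne'
      _ = 1 := hPs
  have hθ0 : 0 < θ := by rw [hθ]; positivity
  obtain ⟨ε, hε, hεη⟩ := exists_measure_esc_lt_le p hz (η := η) (by exact_mod_cast hηpos.ne')
  have hρ : c / (c + ε) < 1 := by
    rw [div_lt_one (by positivity)]
    exact lt_add_of_pos_right c hε
  obtain ⟨A, hA⟩ := exists_pow_lt_of_lt_one hηpos hρ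
  -- The exponent balances the two terms of `hit_le_add`: `κ ^ (-n * A) * θ ^ n = κ ^ n`.
  set κ : ℝ≥0 := θ ^ (((A + 1 : ℕ) : ℝ)⁻¹) with hκ
  have hκA : κ ^ (A + 1) = θ := NNReal.rpow_inv_natCast_pow θ (Nat.succ_ne_zero A)
  have hκ1 : κ < 1 := NNReal.rpow_lt_one hθ1 (by positivity)
  have hκ0 : 0 < κ := NNReal.rpow_pos hθ0
  have hSF : ∫⁻ d, ∑ i ∈ Finset.range (d []),
      sideFactor c ε ((c / (c + ε) : ℝ≥0) ^ A) i d ∂(gw p) ≤ θ := by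
    refine (lintegral_sideFactor_le p c ε).trans ?_
    rw [hP, hmean, hθ]
    push_cast
    gcongr
    exact_mod_cast hA.le
  refine ⟨1 + m, κ, hκ1, fun n => ?_⟩
  rw [pathLaw_apply p hlam (measurableSet_exists_reachReturn _)]
  set ρ : ℝ≥0∞ := ((c / (c + ε) : ℝ≥0) : ℝ≥0∞) ^ A with hρdef
  have hS := measurable_sum_children (f := fun i d => sideSum c ε ρ n (sub [i] d))
    fun i => (measurable_sideSum c ε ρ n).comp (measurable_sub [i])
  calc _ ≤ ∫⁻ d, ((κ ^ n : ℝ≥0) + (((κ ^ n)⁻¹ ^ A : ℝ≥0) : ℝ≥0∞) *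
        ∑ i ∈ Finset.range (d []), sideSum c ε ρ n (sub [i] d) : ℝ≥0∞) ∂(gw p) := by
        refine lintegral_mono_ae ?_
        filter_upwards [ae_pos p hp0] with d hd
        exact quenched_reachReturn_le hlam hd (Nat.succ_ne_zero n) fun v hv hvn =>
          hit_le_add hc A n hκ0 hv hvn
    _ = (κ ^ n : ℝ≥0) + (((κ ^ n)⁻¹ ^ A : ℝ≥0) : ℝ≥0∞) * (m * (∫⁻ d, ∑ i ∈ Finset.range (d []),
        sideFactor c ε ρ i d ∂(gw p)) ^ n) := by
        rw [lintegral_add_left measurable_const, lintegral_const_mul _ hS,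
          lintegral_sum_sub p (measurable_sideSum c ε ρ n), lintegral_sideSum, hmean]
        simp
    _ ≤ (κ ^ n : ℝ≥0) + (((κ ^ n)⁻¹ ^ A : ℝ≥0) : ℝ≥0∞) * (m * (θ : ℝ≥0∞) ^ n) := by gcongr
    _ = ((κ ^ n + (κ ^ n)⁻¹ ^ A * (m * θ ^ n) : ℝ≥0) : ℝ≥0∞) := by push_cast; rfl
    _ = _ := by
        congr 1
        have h1 : (κ ^ n)⁻¹ ^ A * (κ ^ n) ^ A = 1 := by
          rw [← mul_pow, inv_mul_cancel₀ (pow_pos hκ0 n).ne', one_pow]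
        calc κ ^ n + (κ ^ n)⁻¹ ^ A * (m * θ ^ n)
            = κ ^ n + ((κ ^ n)⁻¹ ^ A * (κ ^ n) ^ A) * (m * κ ^ n) := by
              rw [← hκA]; ring
          _ = _ := by rw [h1]; ring

/-! ### Positive probability of never returning -/

/-- The paths that do not return to the root. -/
def NoReturn (x : ℕ → Vertex) : Prop := ∀ u, 1 ≤ u → x u ≠ []

lemma IsPath.noReturn_iff {x : ℕ → Vertex} (h : IsPath x) :
    NoReturn x ↔ ¬ ∃ t, ReachReturn 1 t x := by
  have h1 : (x 1).length = 1 := by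
    rcases h.2 0 with ⟨i, hi⟩ | ⟨i, hi⟩
    · rw [hi, h.1]; rfl
    · rw [h.1] at hi; simp at hi
  constructor
  · rintro hx ⟨t, s, u, hsu, -, -, hu⟩
    exact hx u (by omega) hu
  · intro hx u hu hxu
    refine hx ⟨u, 1, u, ?_, le_rfl, h1, hxu⟩
    rcases Nat.lt_or_ge 1 u with h2 | h2
    · exact h2
    · obtain rfl : u = 1 := by omega
      rw [hxu] at h1; simp at h1

lemma pathLaw_noReturn_pos (p : PMF ℕ) (hp0 : p 0 = 0) {lam : ℝ} (hlam : 0 < lam)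
    {m : ℝ≥0} (hmean : offspringMean p = m) (hm : 1 < m) (hcm : lam.toNNReal < m)
    (hD : ∫⁻ d, (d [] : ℝ≥0∞) ^ 2 ∂(gw p) ≠ ⊤) :
    pathLaw p lam hlam {x | NoReturn x} ≠ 0 := by
  have hc : 0 < lam.toNNReal := Real.toNNReal_pos.2 hlam
  have hm1 : 1 < offspringMean p := by rw [hmean]; exact_mod_cast hm
  have hz := measure_esc_eq_zero p hp0 hc hm1 (lintegral_esc_pos p hmean hm hc hcm hD)
  have hE := measurableSet_exists_reachReturn 1
  intro h0
  have hQ : pathLaw p lam hlam {x | ∃ t, ReachReturn 1 t x}ᶜ = 0 := by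
    refine le_antisymm ?_ bot_le
    rw [← h0]
    refine measure_mono_ae ?_
    filter_upwards [ae_isPath p hp0 hlam] with x hx hx'
    exact hx.noReturn_iff.2 hx'
  have hm : Measurable fun d => quenched lam hlam d {x | ∃ t, ReachReturn 1 t x}ᶜ :=
    (Measure.measurable_coe hE.compl).comp (measurable_quenched lam hlam)
  rw [pathLaw_apply p hlam hE.compl, lintegral_eq_zero_iff hm] at hQ
  have hall : ∀ᵐ d ∂(gw p), ∀ i : ℕ, esc lam.toNNReal (sub [i] d) ≠ 0 := by
    rw [ae_all_iff]
    intro i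
    have h1 : MeasurableSet {d | esc lam.toNNReal d = 0} :=
      measurableSet_eq_fun (measurable_esc _) measurable_const
    have h2 : Measurable ({d : Env | esc lam.toNNReal d = 0}.indicator (1 : Env → ℝ≥0∞)) :=
      measurable_one.indicator h1
    have h3 : Measurable fun d : Env =>
        {d : Env | esc lam.toNNReal d = 0}.indicator (1 : Env → ℝ≥0∞) (sub [i] d) :=
      h2.comp (measurable_sub _)
    have := lintegral_sub p [i] h2
    rw [lintegral_indicator_one h1, hz, lintegral_eq_zero_iff h3] at this
    filter_upwards [this] with d hd hd0
    simp [Set.indicator, hd0] at hd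
  have hfalse : ∀ᵐ _d ∂(gw p), False := by
    filter_upwards [hQ, hall, ae_pos p hp0] with d h1 h2 h3
    have hne : (Finset.range (d [])).Nonempty := by
      rw [Finset.nonempty_range_iff]; have := h3 []; omega
    -- The largest return probability among the finitely many offspring of the root. It is below 1,
    -- so an almost sure return on this tree is impossible.
    set z : ℝ≥0 := (Finset.range (d [])).sup' hne fun i => ret lam.toNNReal (sub [i] d) with hz
    have hz1 : z < 1 := by
      rw [hz, Finset.sup'_lt_iff]
      intro i _
      exact tsub_lt_self zero_lt_one (pos_iff_ne_zero.2 (h2 i))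
    have hle := quenched_reachReturn_le hlam h3 (n := 1) one_ne_zero (z := z) (by
      intro v hv hv1
      obtain ⟨i, rfl⟩ := List.length_eq_one_iff.1 hv1
      have hi : i < d [] := (inTree_cons.1 hv).1
      have : hit lam.toNNReal d [i] ≤ z := by
        rw [hit, hit, one_mul]
        exact Finset.le_sup' (fun i => ret lam.toNNReal (sub [i] d)) (Finset.mem_range.2 hi)
      exact_mod_cast this)
    have h4 := (prob_compl_eq_zero_iff hE).1 h1
    rw [h4] at hle
    exact absurd hle (not_le.2 (by exact_mod_cast hz1))
  have := hfalse.exists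
  exact this.elim fun _ h => h

/-! ### The walk seen from a vertex which it visits for the first time -/

open Classical in
/-- The position of `w` relative to `v`: `0 :: u` if `w` is the vertex `u` of the subtree at `v`,
and the root if `w` is not in this subtree. -/
def enc (v w : Vertex) : Vertex := if v <:+ w then 0 :: w.take (w.length - v.length) else []

@[simp] lemma enc_append (v u : Vertex) : enc v (u ++ v) = 0 :: u := by simp [enc]

open Classical in
/-- The path after time `t`, seen from its position at time `t`, and stopped when it leaves the
subtree at this position. -/
def rel (t : ℕ) (x : ℕ → Vertex) : ℕ → Vertex := fun n =>
  if ∀ i, t ≤ i → i ≤ t + n → x t <:+ x i then enc (x t) (x (t + n)) else []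

lemma rel_congr {t n : ℕ} {x y : ℕ → Vertex} (h : ∀ i ≤ t + n, x i = y i) :
    rel t x n = rel t y n := by
  have : (∀ i, t ≤ i → i ≤ t + n → x t <:+ x i) ↔ ∀ i, t ≤ i → i ≤ t + n → y t <:+ y i :=
    forall_congr' fun i => forall₂_congr fun _ hi => by rw [h t (by omega), h i hi]
  unfold rel
  rw [if_congr this rfl rfl, h t (by omega), h (t + n) le_rfl]

lemma adapted_rel (t n : ℕ) : Adapted (t + n) fun x => rel t x n := fun _ _ h => rel_congr h

lemma measurable_rel (t : ℕ) : Measurable (rel t) :=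
  measurable_pi_iff.2 fun n => (adapted_rel t n).measurable

lemma rel_zero (t : ℕ) (x : ℕ → Vertex) : rel t x 0 = [0] := by
  have : ∀ i, t ≤ i → i ≤ t + 0 → x t <:+ x i := by
    intro i h1 h2
    obtain rfl : i = t := by omega
    exact List.suffix_rfl
  rw [rel, if_pos this]
  simp [enc]

/-- The position `0 :: u'` of the parent of `u`. -/
def relParent : Vertex → Vertex
  | [] => []
  | _ :: u => 0 :: u

/-- The transition probabilities of the path `rel t x`. -/
def relStep (lam : ℝ) (k : ℕ) : Vertex → Vertex → ℝ≥0∞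
  | [], y => if y = [] then 1 else 0
  | _ :: u, y => ENNReal.ofReal (lam / (lam + k)) * (if relParent u = y then 1 else 0) +
      ∑ i ∈ Finset.range k, ENNReal.ofReal (1 / (lam + k)) * if 0 :: i :: u = y then 1 else 0

/-- A step from the subtree at `v` to the parent of `v` is recorded as absorption at `[]`. The root
is excluded as `v` because the step law there has no move to a parent. -/
lemma lintegral_enc (lam : ℝ) (k j : ℕ) (u v y : Vertex) (hv : v ≠ []) :
    ∫⁻ w, (if enc v w = y then 1 else 0) ∂(stepLaw lam k (u ++ v)) = relStep lam k (j :: u) y := by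
  cases u with
  | nil =>
    obtain ⟨i, v, rfl⟩ := List.exists_cons_of_ne_nil hv
    have h1 : enc (i :: v) v = [] := by
      rw [enc, if_neg]
      intro h
      have := h.length_le
      simp at this
    have h2 : ∀ l, enc (i :: v) (l :: i :: v) = 0 :: [l] := fun l => enc_append (i :: v) [l]
    rw [List.nil_append, lintegral_stepLaw_cons]
    simp only [h1, h2, relStep, relParent]
    congr!
  | cons i u =>
    have h2 : ∀ l, enc v (l :: i :: (u ++ v)) = 0 :: l :: i :: u := fun l =>
      enc_append v (l :: i :: u)
    rw [List.cons_append, lintegral_stepLaw_cons]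
    simp only [enc_append, h2, relStep, relParent]
    congr!

/-- `S` is decided at time `t`, and it implies that the walk visits the subtree at `v` for the
first time at time `t`, at `v`. -/
structure FreshAt (t : ℕ) (v : Vertex) (S : (ℕ → Vertex) → Prop) : Prop where
  adapted : Adapted t S
  eq : ∀ x, S x → x t = v
  fresh : ∀ x, S x → ∀ i < t, ¬ v <:+ x i

open Classical in
-- The Markov property at time `t`. On `S` the relative path is a Markov chain whose transitions
-- involve the environment only through the subtree at `v`; this is what separates past and future
-- once the tree is averaged.
lemma quenched_inter_rel {lam : ℝ} (hlam : 0 < lam) (d : Env) {t : ℕ} {v : Vertex} (hv : v ≠ [])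
    {S : (ℕ → Vertex) → Prop} (hS : FreshAt t v S) (y : ℕ → Vertex) (s : ℕ) :
    quenched lam hlam d {x | S x ∧ ∀ i ≤ s, rel t x i = y i} = quenched lam hlam d {x | S x} *
      ((if y 0 = [0] then 1 else 0) *
        ∏ i ∈ Finset.range s, relStep lam (sub v d (y i).tail) (y i) (y (i + 1))) := by
  have hA : ∀ s, Adapted (t + s) fun x => S x ∧ ∀ i ≤ s, rel t x i = y i := by
    intro s x z h
    have h1 : S x = S z := hS.adapted x z fun i hi => h i (by omega)
    have h2 : (∀ i ≤ s, rel t x i = y i) ↔ ∀ i ≤ s, rel t z i = y i :=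
      forall₂_congr fun i hi => by rw [rel_congr fun j hj => h j (by omega)]
    simp only [h1, h2]
  have hind : ∀ s, quenched lam hlam d {x | S x ∧ ∀ i ≤ s, rel t x i = y i} =
      ∫⁻ x, (if S x ∧ ∀ i ≤ s, rel t x i = y i then 1 else 0) ∂(quenched lam hlam d) := by
    intro s
    rw [← lintegral_indicator_one (hA s).measurableSet]
    exact lintegral_congr fun x => by simp [Set.indicator]
  induction s with
  | zero =>
    simp only [Nat.le_zero_eq, forall_eq, rel_zero, Finset.range_zero, Finset.prod_empty, mul_one]
    by_cases h : y 0 = [0]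
    · simp [h]
    · simp [h, Ne.symm h]
  | succ s ih =>
    have hAf : Adapted (t + s + 1) fun x =>
        if S x ∧ ∀ i ≤ s + 1, rel t x i = y i then (1 : ℝ≥0∞) else 0 := by
      intro x z h
      have := hA (s + 1) x z h
      simp only at this
      simp only [this]
    have hAs : Adapted (t + s) fun x =>
        if S x ∧ ∀ i ≤ s, rel t x i = y i then (1 : ℝ≥0∞) else 0 := by
      intro x z h
      have := hA s x z h
      simp only at this
      simp only [this]
    rw [hind, lintegral_step hlam d (t + s) hAf, Finset.prod_range_succ, ← mul_assoc, ← mul_assoc,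
      mul_assoc (quenched lam hlam d _), ← ih, hind, ← lintegral_mul_const _ hAs.measurable]
    refine lintegral_congr fun x => ?_
    have hup : ∀ w, ∀ i ≤ t + s, Function.update x (t + s + 1) w i = x i := fun w i hi =>
      Function.update_of_ne (by omega) _ _
    -- The history up to time `t + s` does not feel the resampled coordinate, so the indicator
    -- splits into a past factor and the event of the last step.
    have hsplit : ∀ w, (if S (Function.update x (t + s + 1) w) ∧
        ∀ i ≤ s + 1, rel t (Function.update x (t + s + 1) w) i = y i then (1 : ℝ≥0∞) else 0) =
        (if S x ∧ ∀ i ≤ s, rel t x i = y i then 1 else 0) *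
          (if rel t (Function.update x (t + s + 1) w) (s + 1) = y (s + 1) then 1 else 0) := by
      intro w
      have h1 : S (Function.update x (t + s + 1) w) = S x :=
        hS.adapted _ _ fun i hi => hup w i (by omega)
      have h2 : (∀ i ≤ s + 1, rel t (Function.update x (t + s + 1) w) i = y i) ↔
          (∀ i ≤ s, rel t x i = y i) ∧
            rel t (Function.update x (t + s + 1) w) (s + 1) = y (s + 1) := by
        constructor
        · intro h
          refine ⟨fun i hi => ?_, h _ le_rfl⟩
          rw [← h i (by omega)]
          exact (rel_congr fun j hj => hup w j (by omega)).symm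
        · rintro ⟨h3, h4⟩ i hi
          rcases Nat.lt_or_ge s i with h5 | h5
          · obtain rfl : i = s + 1 := by omega
            exact h4
          · rw [← h3 i h5]
            exact rel_congr fun j hj => hup w j (by omega)
      rw [if_congr (and_congr (Iff.of_eq h1) h2) rfl rfl]
      by_cases h5 : S x
      · by_cases h6 : ∀ i ≤ s, rel t x i = y i
        · by_cases h7 : rel t (Function.update x (t + s + 1) w) (s + 1) = y (s + 1)
          · rw [if_pos ⟨h5, h6, h7⟩, if_pos ⟨h5, h6⟩, if_pos h7, mul_one]
          · rw [if_neg fun h => h7 h.2.2, if_neg h7, mul_zero]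
        · simp only [h5, h6, true_and, false_and, if_false, zero_mul]
      · simp only [h5, false_and, if_false, zero_mul]
    simp_rw [hsplit]
    rw [lintegral_const_mul _ Measurable.of_discrete]
    by_cases hc : S x ∧ ∀ i ≤ s, rel t x i = y i
    swap
    · simp [hc]
    rw [if_pos hc]
    congr 1
    have hxt := hS.eq x hc.1
    have hrel := hc.2 s le_rfl
    have := isProbabilityMeasure_stepLaw hlam (d (x (t + s))) (x (t + s))
    by_cases hall : ∀ i, t ≤ i → i ≤ t + s → x t <:+ x i
    · rw [rel, if_pos hall, hxt] at hrel
      have hsuf := hall (t + s) (by omega) le_rfl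
      rw [hxt] at hsuf
      obtain ⟨u, hu⟩ := hsuf
      rw [← hu, enc_append] at hrel
      rw [← hrel, List.tail_cons]
      have h3 : sub v d u = d (x (t + s)) := by rw [← hu]; rfl
      rw [h3, ← lintegral_enc lam _ 0 u v _ hv, hu]
      refine lintegral_congr fun w => ?_
      have h4 : rel t (Function.update x (t + s + 1) w) (s + 1) = enc v w := by
        by_cases hw : v <:+ w
        · rw [rel, if_pos]
          · rw [hup w t (by omega), hxt, ← add_assoc, Function.update_self]
          · intro i h5 h6
            rw [hup w t (by omega)]
            rcases Nat.lt_or_ge (t + s) i with h7 | h7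
            · obtain rfl : i = t + s + 1 := by omega
              rw [Function.update_self, hxt]; exact hw
            · rw [hup w i h7]; exact hall i h5 h7
        · rw [rel, if_neg, enc, if_neg hw]
          intro h5
          have := h5 (t + s + 1) (by omega) (by omega)
          rw [hup w t (by omega), Function.update_self, hxt] at this
          exact hw this
      rw [h4]
    -- The walk has already left the subtree: the relative path is absorbed at `[]`, in agreement
    -- with the first clause of `relStep`.
    · rw [rel, if_neg hall] at hrel
      rw [← hrel, List.tail_nil, relStep]
      have h4 : ∀ w, rel t (Function.update x (t + s + 1) w) (s + 1) = [] := by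
        intro w
        rw [rel, if_neg]
        intro h5
        refine hall fun i h6 h7 => ?_
        have := h5 i h6 (by omega)
        rwa [hup w t (by omega), hup w i h7] at this
      simp_rw [h4, eq_comm (a := ([] : Vertex))]
      simp

/-- The path up to time `t` is produced by the offspring numbers at its positions before time `t`
only. Resampling the last step reduces `t` by one, so the induction runs over all `f`. -/
lemma lintegral_quenched_congr {lam : ℝ} (hlam : 0 < lam) (d d' : Env) (t : ℕ)
    {f : (ℕ → Vertex) → ℝ≥0∞} (hf : Adapted t f)
    (hd : ∀ x, f x ≠ 0 → ∀ i < t, d (x i) = d' (x i)) :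
    ∫⁻ x, f x ∂(quenched lam hlam d) = ∫⁻ x, f x ∂(quenched lam hlam d') := by
  induction t generalizing f with
  | zero =>
    have h : ∀ d, ∫⁻ x, f x ∂(quenched lam hlam d) = f fun _ => [] := by
      intro d
      calc _ = ∫⁻ _x, f (fun _ => []) ∂(quenched lam hlam d) := by
            refine lintegral_congr_ae ?_
            filter_upwards [quenched_ae_start hlam d] with x hx
            refine hf _ _ fun i hi => ?_
            obtain rfl : i = 0 := by omega
            exact hx
        _ = _ := by simp
    rw [h, h]
  | succ t ih =>
    rw [lintegral_step hlam d t hf, lintegral_step hlam d' t hf]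
    have hz : ∀ x w, (∃ i < t + 1, d (x i) ≠ d' (x i)) → f (Function.update x (t + 1) w) = 0 := by
      rintro x w ⟨i, hi, hne⟩
      by_contra hc
      have := hd _ hc i hi
      rw [Function.update_of_ne (by omega)] at this
      exact hne this
    have hg : ∀ x, ∫⁻ w, f (Function.update x (t + 1) w) ∂(stepLaw lam (d' (x t)) (x t)) =
        ∫⁻ w, f (Function.update x (t + 1) w) ∂(stepLaw lam (d (x t)) (x t)) := by
      intro x
      by_cases h : d (x t) = d' (x t)
      · rw [h]
      · have : ∀ w, f (Function.update x (t + 1) w) = 0 := fun w => hz x w ⟨t, by omega, h⟩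
        simp [this]
    simp_rw [hg]
    refine ih ?_ ?_
    · intro x z h
      have h1 : ∀ w, f (Function.update x (t + 1) w) = f (Function.update z (t + 1) w) := by
        intro w
        refine hf _ _ fun i hi => ?_
        by_cases hit : i = t + 1
        · subst hit; simp
        · rw [Function.update_of_ne hit, Function.update_of_ne hit]
          exact h i (by omega)
      simp only [h1, h t le_rfl]
    · intro x hx i hi
      by_contra hc
      refine hx ?_
      have : ∀ w, f (Function.update x (t + 1) w) = 0 := fun w => hz x w ⟨i, by omega, hc⟩
      simp [this]

lemma quenched_congr {lam : ℝ} (hlam : 0 < lam) {t : ℕ} {v : Vertex} {S : (ℕ → Vertex) → Prop}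
    (hS : FreshAt t v S) (d d' : Env) (h : ∀ w, ¬ v <:+ w → d w = d' w) :
    quenched lam hlam d {x | S x} = quenched lam hlam d' {x | S x} := by
  classical
  have hm := hS.adapted.measurableSet
  rw [← lintegral_indicator_one hm, ← lintegral_indicator_one hm]
  refine lintegral_quenched_congr hlam d d' t ?_ ?_
  · intro x y hxy
    have := hS.adapted x y hxy
    simp [Set.indicator, this]
  · intro x hx i hi
    have : S x := by
      by_contra hc
      exact hx (by simp [Set.indicator, hc])
    exact h _ (hS.fresh x this i hi)

/-- The probability of a cylinder for the walk seen from a fresh vertex. -/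
def relCyl (p : PMF ℕ) (lam : ℝ) (y : ℕ → Vertex) (s : ℕ) : ℝ≥0∞ :=
  (if y 0 = [0] then 1 else 0) *
    ∫⁻ d, ∏ i ∈ Finset.range s, relStep lam (d (y i).tail) (y i) (y (i + 1)) ∂(gw p)

lemma measurableSet_rel_eq (t s : ℕ) (y : ℕ → Vertex) :
    MeasurableSet {x | ∀ i ≤ s, rel t x i = y i} := by
  refine Adapted.measurableSet (t := t + s) fun x z h => ?_
  simp only [eq_iff_iff]
  exact forall₂_congr fun i hi => by rw [rel_congr fun j hj => h j (by omega)]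

/-- The quenched probability of `S` depends on the tree outside the subtree at `v`, and that of the
relative cylinder on this subtree alone. The branching property makes the two factors independent.
-/
lemma pathLaw_inter_rel (p : PMF ℕ) {lam : ℝ} (hlam : 0 < lam) {t : ℕ} {v : Vertex} (hv : v ≠ [])
    {S : (ℕ → Vertex) → Prop} (hS : FreshAt t v S) (y : ℕ → Vertex) (s : ℕ) :
    pathLaw p lam hlam ({x | S x} ∩ {x | ∀ i ≤ s, rel t x i = y i}) =
      pathLaw p lam hlam {x | S x} * relCyl p lam y s := by
  rw [pathLaw_apply p hlam (hS.adapted.measurableSet.inter (measurableSet_rel_eq t s y)),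
    pathLaw_apply p hlam hS.adapted.measurableSet]
  have hB : Measurable fun d : Env => ∏ i ∈ Finset.range s,
      relStep lam (d (y i).tail) (y i) (y (i + 1)) :=
    Finset.measurable_prod _ fun i _ => (Measurable.of_discrete
      (f := fun k => relStep lam k (y i) (y (i + 1)))).comp (measurable_pi_apply (y i).tail)
  have hA : Measurable fun d => quenched lam hlam d {x | S x} :=
    (Measure.measurable_coe hS.adapted.measurableSet).comp (measurable_quenched lam hlam)
  have := lintegral_branching p v hA (hB.const_mul (if y 0 = [0] then 1 else 0))
    fun d d' h => quenched_congr hlam hS d d' h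
  rw [lintegral_const_mul _ hB] at this
  rw [relCyl, ← this]
  exact lintegral_congr fun d => quenched_inter_rel hlam d hv hS y s

lemma measurableSet_cyl (n : ℕ) (x : ℕ → Vertex) : MeasurableSet (cyl n x) := by
  simp only [cyl, Set.ofPred_forall]
  exact MeasurableSet.iInter fun i => MeasurableSet.iInter fun _ =>
    measurableSet_eq_fun (measurable_pi_apply i) measurable_const

lemma pi_eq_generateFrom_cyl : (MeasurableSpace.pi : MeasurableSpace (ℕ → Vertex)) =
    MeasurableSpace.generateFrom {s | ∃ n x, s = cyl n x} := by
  apply le_antisymm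
  · refine iSup_le fun i => ?_
    rintro _ ⟨s, -, rfl⟩
    have : (fun y : ℕ → Vertex => y i) ⁻¹' s =
        ⋃ f : {f : (j : Finset.Iic i) → Vertex // f ⟨i, Finset.mem_Iic.2 le_rfl⟩ ∈ s},
          cyl i (ofHist i f.1) := by
      ext y
      simp only [Set.mem_preimage, Set.mem_iUnion, cyl, Set.mem_ofPred_eq]
      constructor
      · intro hy
        exact ⟨⟨fun j => y j, hy⟩, fun j hj => by simp [ofHist, hj]⟩
      · rintro ⟨f, hf⟩
        rw [hf i le_rfl]
        simpa [ofHist] using f.2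
    rw [this]
    exact MeasurableSet.iUnion fun f => MeasurableSpace.measurableSet_generateFrom ⟨_, _, rfl⟩
  · refine MeasurableSpace.generateFrom_le ?_
    rintro _ ⟨n, x, rfl⟩
    exact measurableSet_cyl n x

lemma isPiSystem_cyl : IsPiSystem {s | ∃ n x, s = cyl n x} := by
  have key : ∀ n x m z, n ≤ m → (cyl n x ∩ cyl m z).Nonempty →
      cyl n x ∩ cyl m z = cyl m z := by
    rintro n x m z hnm ⟨y, hy1, hy2⟩
    refine Set.inter_eq_right.2 fun w hw i hi => ?_
    rw [hw i (hi.trans hnm), ← hy2 i (hi.trans hnm), hy1 i hi]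
  rintro _ ⟨n, x, rfl⟩ _ ⟨m, z, rfl⟩ hne
  rcases le_total n m with h | h
  · exact ⟨m, z, key n x m z h hne⟩
  · refine ⟨n, x, ?_⟩
    rw [Set.inter_comm] at hne ⊢
    exact key m z n x h hne

/-- `S` is decided at time `t`, and it implies that the walk visits the subtree at `x t`, which is
not the root, for the first time at time `t`. -/
structure Fresh (t : ℕ) (S : (ℕ → Vertex) → Prop) : Prop where
  adapted : Adapted t S
  ne_nil : ∀ x, S x → x t ≠ []
  fresh : ∀ x, S x → ∀ i < t, ¬ x t <:+ x i

lemma pathLaw_inter_rel_cyl (p : PMF ℕ) {lam : ℝ} (hlam : 0 < lam) {t : ℕ}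
    {S : (ℕ → Vertex) → Prop} (hS : Fresh t S) (y : ℕ → Vertex) (s : ℕ) :
    pathLaw p lam hlam ({x | S x} ∩ {x | ∀ i ≤ s, rel t x i = y i}) =
      pathLaw p lam hlam {x | S x} * relCyl p lam y s := by
  have hF : ∀ v, FreshAt t v fun x => S x ∧ x t = v := fun v =>
    ⟨fun x z h => by
      have := hS.adapted x z h
      simp only [this, h t le_rfl], fun x hx => hx.2, fun x hx => hx.2 ▸ hS.fresh x hx.1⟩
  have hv : ∀ v, pathLaw p lam hlam ({x | S x ∧ x t = v} ∩ {x | ∀ i ≤ s, rel t x i = y i}) =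
      pathLaw p lam hlam {x | S x ∧ x t = v} * relCyl p lam y s := by
    intro v
    by_cases h : v = []
    · have : {x | S x ∧ x t = v} = ∅ := by
        ext x
        simp only [Set.mem_ofPred_eq, Set.mem_empty_iff_false, iff_false]
        rintro ⟨h1, h2⟩
        exact hS.ne_nil x h1 (h2.trans h)
      simp [this]
    · exact pathLaw_inter_rel p hlam h (hF v) y s
  have hU : {x | S x} = ⋃ v, {x | S x ∧ x t = v} := by ext x; simp
  have hd : Pairwise (Function.onFun Disjoint fun v => {x | S x ∧ x t = v}) := by
    intro v w hvw
    refine Set.disjoint_left.2 fun x hx hx' => hvw ?_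
    exact hx.2.symm.trans hx'.2
  have hm : ∀ v, MeasurableSet {x | S x ∧ x t = v} := fun v => (hF v).adapted.measurableSet
  rw [hU, Set.iUnion_inter, measure_iUnion _ fun v => (hm v).inter (measurableSet_rel_eq t s y),
    measure_iUnion hd hm, ← ENNReal.tsum_mul_right]
  · exact tsum_congr hv
  · intro v w hvw
    exact (hd hvw).mono Set.inter_subset_left Set.inter_subset_left

/-- The law of the walk seen from a fresh vertex. -/
def freshLaw (p : PMF ℕ) (lam : ℝ) (hlam : 0 < lam) : Measure (ℕ → Vertex) :=
  (pathLaw p lam hlam).map (rel 1)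

instance instProbFreshLaw (p : PMF ℕ) (lam : ℝ) (hlam : 0 < lam) :
    IsProbabilityMeasure (freshLaw p lam hlam) :=
  Measure.isProbabilityMeasure_map (measurable_rel 1).aemeasurable

lemma IsPath.one {x : ℕ → Vertex} (h : IsPath x) : ∃ i, x 1 = [i] := by
  rcases h.2 0 with ⟨i, hi⟩ | ⟨i, hi⟩
  · exact ⟨i, by rw [hi, h.1]⟩
  · rw [h.1] at hi; simp at hi

/-- Time 1 is almost surely fresh, as the walk then stands at an offspring of the root. Hence `rel
1` realises the common law of all relative paths. -/
lemma freshLaw_cyl (p : PMF ℕ) (hp0 : p 0 = 0) {lam : ℝ} (hlam : 0 < lam) (y : ℕ → Vertex)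
    (s : ℕ) : freshLaw p lam hlam (cyl s y) = relCyl p lam y s := by
  have hS : Fresh 1 fun x => x 1 ≠ [] ∧ x 0 = [] :=
    ⟨fun x z h => by simp only [h 0 (by omega), h 1 le_rfl], fun x hx => hx.1, fun x hx i hi => by
      obtain rfl : i = 0 := by omega
      rw [hx.2]
      simpa using hx.1⟩
  have h := pathLaw_inter_rel_cyl p hlam hS y s
  have h1 : ∀ᵐ x ∂(pathLaw p lam hlam), x ∈ {x : ℕ → Vertex | x 1 ≠ [] ∧ x 0 = []} := by
    filter_upwards [ae_isPath p hp0 hlam] with x hx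
    obtain ⟨i, hi⟩ := hx.one
    exact ⟨by simp [hi], hx.1⟩
  rw [(mem_ae_iff_prob_eq_one hS.adapted.measurableSet).1 h1, one_mul] at h
  rw [← h, freshLaw, Measure.map_apply (measurable_rel 1) (measurableSet_cyl s y)]
  refine measure_congr ?_
  filter_upwards [h1] with x hx
  exact propext ⟨fun h => ⟨hx, h⟩, fun h => h.2⟩

/-- The walk after a fresh time is independent of its past. -/
lemma pathLaw_fresh (p : PMF ℕ) (hp0 : p 0 = 0) {lam : ℝ} (hlam : 0 < lam) {t : ℕ}
    {S : (ℕ → Vertex) → Prop} (hS : Fresh t S) {B : Set (ℕ → Vertex)} (hB : MeasurableSet B) :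
    pathLaw p lam hlam {x | S x ∧ rel t x ∈ B} =
      pathLaw p lam hlam {x | S x} * freshLaw p lam hlam B := by
  have h : ((pathLaw p lam hlam).restrict {x | S x}).map (rel t) =
      pathLaw p lam hlam {x | S x} • freshLaw p lam hlam := by
    refine ext_of_generate_finite _ pi_eq_generateFrom_cyl isPiSystem_cyl ?_ ?_
    · rintro _ ⟨s, y, rfl⟩
      rw [Measure.map_apply (measurable_rel t) (measurableSet_cyl s y),
        Measure.restrict_apply (measurable_rel t (measurableSet_cyl s y)), Set.inter_comm,
        Measure.smul_apply, smul_eq_mul, freshLaw_cyl p hp0, ← pathLaw_inter_rel_cyl p hlam hS]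
      rfl
    · rw [Measure.map_apply (measurable_rel t) MeasurableSet.univ]
      simp
  have h2 := congrArg (fun μ => μ B) h
  simp only [Measure.smul_apply, smul_eq_mul] at h2
  rw [← h2, Measure.map_apply (measurable_rel t) hB,
    Measure.restrict_apply (measurable_rel t hB), Set.inter_comm]
  rfl

lemma pathLaw_exists_fresh (p : PMF ℕ) (hp0 : p 0 = 0) {lam : ℝ} (hlam : 0 < lam)
    {S : ℕ → (ℕ → Vertex) → Prop} (hS : ∀ t, Fresh t (S t))
    (huniq : ∀ x s t, S s x → S t x → s = t) {B : Set (ℕ → Vertex)} (hB : MeasurableSet B) :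
    pathLaw p lam hlam {x | ∃ t, S t x ∧ rel t x ∈ B} =
      pathLaw p lam hlam {x | ∃ t, S t x} * freshLaw p lam hlam B := by
  have h1 : {x | ∃ t, S t x ∧ rel t x ∈ B} = ⋃ t, {x | S t x ∧ rel t x ∈ B} := by ext x; simp
  have h2 : {x | ∃ t, S t x} = ⋃ t, {x | S t x} := by ext x; simp
  have hd : Pairwise (Function.onFun Disjoint fun t => {x | S t x}) := by
    intro s t hst
    exact Set.disjoint_left.2 fun x hx hx' => hst (huniq x s t hx hx')
  have hm : ∀ t, MeasurableSet {x | S t x} := fun t => (hS t).adapted.measurableSet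
  have hmB : ∀ t, MeasurableSet {x | S t x ∧ rel t x ∈ B} := fun t =>
    (hm t).inter (measurable_rel t hB)
  have hdB : Pairwise (Function.onFun Disjoint fun t => {x | S t x ∧ rel t x ∈ B}) :=
    fun s t hst => (hd hst).mono (fun x hx => hx.1) (fun x hx => hx.1)
  rw [h1, h2, measure_iUnion hdB hmB, measure_iUnion hd hm, ← ENNReal.tsum_mul_right]
  exact tsum_congr fun t => pathLaw_fresh p hp0 hlam (hS t) hB

/-! ### Levels -/

/-- A nearest neighbour path can leave a subtree only through the parent of its top vertex, one
level lower. Conditions on subtrees thus become conditions on levels. -/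
lemma IsPath.suffix_iff {x : ℕ → Vertex} (h : IsPath x) (t n : ℕ) :
    (∀ i, t ≤ i → i ≤ t + n → x t <:+ x i) ↔
      ∀ i, t ≤ i → i ≤ t + n → (x t).length ≤ (x i).length := by
  refine ⟨fun h1 i h2 h3 => (h1 i h2 h3).length_le, fun h1 i h2 h3 => ?_⟩
  induction i, h2 using Nat.le_induction with
  | base => exact List.suffix_rfl
  | succ i hi ih =>
    have h4 := ih (by omega)
    rcases h.2 i with ⟨j, hj⟩ | ⟨j, hj⟩
    · rw [hj]; exact h4.trans (List.suffix_cons j _)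
    · rw [hj] at h4
      rcases List.suffix_cons_iff.1 h4 with h5 | h5
      · have := h1 (i + 1) (by omega) h3
        rw [h5] at this
        simp at this
      · exact h5

lemma IsPath.rel_ne_nil_iff {x : ℕ → Vertex} (h : IsPath x) (t n : ℕ) :
    rel t x n ≠ [] ↔ ∀ i, t ≤ i → i ≤ t + n → (x t).length ≤ (x i).length := by
  rw [← h.suffix_iff, rel]
  split_ifs with h1
  · refine ⟨fun _ => h1, fun _ => ?_⟩
    simp [enc, h1 (t + n) (by omega) le_rfl]
  · simp only [ne_eq, not_true_eq_false, false_iff]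
    exact h1

lemma length_rel {x : ℕ → Vertex} {t n : ℕ} (h : rel t x n ≠ []) :
    (rel t x n).length + (x t).length = (x (t + n)).length + 1 := by
  rw [rel] at h ⊢
  split_ifs at h ⊢ with h1
  · obtain ⟨u, hu⟩ := h1 (t + n) (by omega) le_rfl
    rw [← hu, enc_append]
    simp
    omega
  · exact absurd rfl h

/-- The paths that hit the root. -/
def dead : Set (ℕ → Vertex) := {y | ∃ n, y n = []}

lemma measurableSet_dead : MeasurableSet dead := by
  have : dead = ⋃ n, {y : ℕ → Vertex | y n = []} := by ext y; simp [dead]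
  rw [this]
  exact MeasurableSet.iUnion fun n => measurableSet_eq_fun (measurable_pi_apply n) measurable_const

lemma IsPath.rel_one_mem_dead_iff {x : ℕ → Vertex} (h : IsPath x) :
    rel 1 x ∈ deadᶜ ↔ NoReturn x := by
  obtain ⟨j, hj⟩ := h.one
  have hd : rel 1 x ∈ deadᶜ ↔ ∀ n, rel 1 x n ≠ [] := by simp [dead]
  rw [hd]
  simp only [h.rel_ne_nil_iff, hj, List.length_singleton, NoReturn, ← List.length_pos_iff]
  constructor
  · intro h1 u hu
    exact h1 u u hu (by omega)
  · intro h1 n i hi _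
    exact h1 i hi

lemma freshLaw_dead_compl (p : PMF ℕ) (hp0 : p 0 = 0) {lam : ℝ} (hlam : 0 < lam) :
    freshLaw p lam hlam deadᶜ = pathLaw p lam hlam {x | NoReturn x} := by
  rw [freshLaw, Measure.map_apply (measurable_rel 1) measurableSet_dead.compl]
  refine measure_congr ?_
  filter_upwards [ae_isPath p hp0 hlam] with x hx
  exact propext hx.rel_one_mem_dead_iff

/-! ### The number of vertices visited at a given level -/

/-- At time `t`, a vertex at level `l` is visited for the first time. -/
def NewAt (l : ℕ) (x : ℕ → Vertex) (t : ℕ) : Prop :=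
  (x t).length = l ∧ ∀ i < t, ¬ x t <:+ x i

open Classical in
/-- The number of vertices at level `l` visited before time `t`. -/
def levelCount (l : ℕ) (x : ℕ → Vertex) (t : ℕ) : ℕ :=
  ((Finset.range t).filter (NewAt l x)).card

lemma levelCount_succ (l : ℕ) (x : ℕ → Vertex) (t : ℕ) [Decidable (NewAt l x t)] :
    levelCount l x (t + 1) = levelCount l x t + if NewAt l x t then 1 else 0 := by
  classical
  unfold levelCount
  rw [Finset.range_add_one, Finset.filter_insert]
  split_ifs with h
  · rw [Finset.card_insert_of_notMem (by simp)]
  · rfl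

lemma levelCount_mono (l : ℕ) (x : ℕ → Vertex) : Monotone (levelCount l x) := by
  classical
  refine monotone_nat_of_le_succ fun t => ?_
  rw [levelCount_succ]; omega

lemma adapted_newAt (l t : ℕ) : Adapted t fun x => NewAt l x t := by
  intro x y h
  simp only [NewAt, eq_iff_iff, h t le_rfl]
  exact and_congr_right fun _ => forall₂_congr fun i hi => by rw [h i (by omega)]

lemma adapted_levelCount (l t : ℕ) : Adapted t fun x => levelCount l x t := by
  classical
  intro x y h
  simp only [levelCount]
  congr 1
  refine Finset.filter_congr fun s hs => ?_
  have := adapted_newAt l s x y fun i hi => h i (by have := Finset.mem_range.1 hs; omega)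
  exact Iff.of_eq this

lemma exists_newAt_of_lt (l r : ℕ) (x : ℕ → Vertex) (t : ℕ) (h : r < levelCount l x t) :
    ∃ s < t, NewAt l x s ∧ levelCount l x s = r := by
  classical
  induction t with
  | zero => simp [levelCount] at h
  | succ t ih =>
    by_cases h1 : r < levelCount l x t
    · obtain ⟨s, hs, h2⟩ := ih h1
      exact ⟨s, by omega, h2⟩
    · rw [levelCount_succ] at h
      split_ifs at h with h2
      · exact ⟨t, by omega, h2, by omega⟩
      · omega

/-- To discover another vertex at the same level, the walk must leave the fresh subtree at the
previously discovered one. Each discovery after the first costs a factor `freshLaw dead`. -/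
lemma pathLaw_newAt_le (p : PMF ℕ) (hp0 : p 0 = 0) {lam : ℝ} (hlam : 0 < lam) {l : ℕ}
    (hl : l ≠ 0) (r : ℕ) :
    pathLaw p lam hlam {x | ∃ t, NewAt l x t ∧ levelCount l x t = r} ≤
      freshLaw p lam hlam dead ^ r := by
  classical
  induction r with
  | zero => rw [pow_zero]; exact prob_le_one
  | succ r ih =>
    have hS : ∀ t, Fresh t fun x => NewAt l x t ∧ levelCount l x t = r := fun t =>
      ⟨fun x y h => by
        have h1 := adapted_newAt l t x y h
        have h2 := adapted_levelCount l t x y h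
        simp only at h1 h2
        simp only [h1, h2], fun x hx h0 => by
        have := hx.1.1
        rw [h0] at this
        exact hl this.symm, fun x hx => hx.1.2⟩
    have huniq : ∀ x s t, (NewAt l x s ∧ levelCount l x s = r) →
        (NewAt l x t ∧ levelCount l x t = r) → s = t := by
      have key : ∀ x s t, (NewAt l x s ∧ levelCount l x s = r) →
          (NewAt l x t ∧ levelCount l x t = r) → ¬ s < t := by
        intro x s t h1 h2 hst
        have h3 := levelCount_mono l x (show s + 1 ≤ t by omega)
        rw [levelCount_succ, if_pos h1.1] at h3
        omega
      intro x s t h1 h2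
      have := key x s t h1 h2
      have := key x t s h2 h1
      omega
    rw [pow_succ]
    calc _ ≤ pathLaw p lam hlam {x | ∃ t, (NewAt l x t ∧ levelCount l x t = r) ∧
          rel t x ∈ dead} := by
          refine measure_mono_ae ?_
          filter_upwards [ae_isPath p hp0 hlam] with x hx
          rintro ⟨t, h1, h2⟩
          obtain ⟨s, hs, h3⟩ := exists_newAt_of_lt l r x t (by omega)
          refine ⟨s, h3, t - s, ?_⟩
          by_contra hne
          rw [← ne_eq, hx.rel_ne_nil_iff, ← hx.suffix_iff] at hne
          have h4 := hne t hs.le (by omega)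
          have h5 := h4.eq_of_length (by rw [h3.1.1, h1.1])
          exact h1.2 s hs (by rw [h5])
      _ = _ := pathLaw_exists_fresh p hp0 hlam hS huniq measurableSet_dead
      _ ≤ _ := by gcongr

lemma IsPath.first_visit {x : ℕ → Vertex} (h : IsPath x) {v : Vertex} {t : ℕ} (ht : v <:+ x t) :
    ∃ s ≤ t, x s = v ∧ ∀ i < s, ¬ v <:+ x i := by
  classical
  have hex : ∃ s, v <:+ x s := ⟨t, ht⟩
  refine ⟨Nat.find hex, Nat.find_min' hex ht, ?_, fun i hi => Nat.find_min hex hi⟩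
  have h1 := Nat.find_spec hex
  rcases hs : Nat.find hex with _ | s
  · rw [hs, h.1] at h1
    rw [h.1, List.suffix_nil.1 h1]
  · rw [hs] at h1
    have h2 : ¬ v <:+ x s := Nat.find_min hex (by omega)
    rcases h.2 s with ⟨j, hj⟩ | ⟨j, hj⟩
    · rw [hj] at h1 ⊢
      rcases List.suffix_cons_iff.1 h1 with h3 | h3
      · exact h3.symm
      · exact absurd h3 h2
    · exact absurd (by rw [hj]; exact h1.trans (List.suffix_cons j _)) h2

open Classical in
lemma IsPath.card_level_le {x : ℕ → Vertex} (h : IsPath x) (l t : ℕ) :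
    (((Finset.range t).image x).filter fun v => v.length = l).card ≤ levelCount l x t := by
  have hsub : (((Finset.range t).image x).filter fun v => v.length = l) ⊆
      ((Finset.range t).filter (NewAt l x)).image x := by
    intro v hv
    simp only [Finset.mem_filter, Finset.mem_image, Finset.mem_range] at hv ⊢
    obtain ⟨⟨s, hs, rfl⟩, hl⟩ := hv
    obtain ⟨u, hu, h1, h2⟩ := h.first_visit (List.suffix_refl (x s))
    exact ⟨u, ⟨by omega, by rw [h1]; exact hl, by rw [h1]; exact h2⟩, h1⟩
  exact (Finset.card_le_card hsub).trans Finset.card_image_le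

/-! ### Regeneration levels -/

/-- At time `t`, the level `l` is reached for the first time. -/
def LevelHit (l t : ℕ) (x : ℕ → Vertex) : Prop :=
  (x t).length = l ∧ ∀ s < t, (x s).length < l

lemma adapted_levelHit (l t : ℕ) : Adapted t (LevelHit l t) := by
  intro x y h
  simp only [LevelHit, eq_iff_iff, h t le_rfl]
  exact and_congr_right fun _ => forall₂_congr fun i hi => by rw [h i (by omega)]

lemma LevelHit.unique {l s t : ℕ} {x : ℕ → Vertex} (h1 : LevelHit l s x) (h2 : LevelHit l t x) :
    s = t := by
  rcases lt_trichotomy s t with h | h | h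
  · exact absurd h1.1 (h2.2 s h).ne
  · exact h
  · exact absurd h2.1 (h1.2 t h).ne

lemma LevelHit.not_suffix {l t : ℕ} {x : ℕ → Vertex} (h : LevelHit l t x) :
    ∀ i < t, ¬ x t <:+ x i := fun i hi hs => by
  have h1 := hs.length_le
  have h2 := h.2 i hi
  rw [h.1] at h1
  omega

lemma LevelHit.ne_nil {l t : ℕ} {x : ℕ → Vertex} (h : LevelHit l t x) (hl : l ≠ 0) :
    x t ≠ [] := fun h0 => by
  have := h.1
  rw [h0] at this
  exact hl this.symm

lemma IsPath.length_succ_le {x : ℕ → Vertex} (h : IsPath x) (t : ℕ) :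
    (x (t + 1)).length ≤ (x t).length + 1 := by
  rcases h.2 t with ⟨j, hj⟩ | ⟨j, hj⟩
  · simp [hj]
  · rw [hj]; simp; omega

lemma IsPath.exists_levelHit {x : ℕ → Vertex} (h : IsPath x) {l t : ℕ} (ht : l ≤ (x t).length) :
    ∃ s ≤ t, LevelHit l s x := by
  classical
  have hex : ∃ s, l ≤ (x s).length := ⟨t, ht⟩
  have hmin : ∀ s < Nat.find hex, (x s).length < l := fun s hs =>
    not_le.1 (Nat.find_min hex hs)
  refine ⟨Nat.find hex, Nat.find_min' hex ht, ?_, hmin⟩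
  have h1 := Nat.find_spec hex
  rcases hs : Nat.find hex with _ | s
  · rw [hs, h.1] at h1
    rw [h.1]
    simp at h1
    simp [h1]
  · rw [hs] at h1
    have h2 := hmin s (by omega)
    have h3 := h.length_succ_le s
    omega

lemma rel_mem_dead_of_lt {x : ℕ → Vertex} (h : IsPath x) {t u : ℕ} (htu : t ≤ u)
    (hu : (x u).length < (x t).length) : rel t x (u - t) = [] := by
  by_contra hne
  rw [← ne_eq, h.rel_ne_nil_iff] at hne
  have := hne u htu (by omega)
  omega

lemma exists_lt_of_rel_eq_nil {x : ℕ → Vertex} (h : IsPath x) {t n : ℕ} (hn : rel t x n = []) :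
    ∃ u, t ≤ u ∧ u ≤ t + n ∧ (x u).length < (x t).length := by
  by_contra hc
  push Not at hc
  exact (h.rel_ne_nil_iff t n).2 hc hn

/-- After hitting the level `lo`, and before hitting the level `hi`, the walk drops below `lo`. -/
def Drop (lo hi t : ℕ) (x : ℕ → Vertex) : Prop :=
  ∃ u ≤ t, (x u).length < lo ∧ (∃ s < u, (x s).length = lo) ∧ ∀ s < u, (x s).length < hi

lemma adapted_drop (lo hi t : ℕ) : Adapted t (Drop lo hi t) := by
  intro x y h
  simp only [Drop, eq_iff_iff]
  refine exists_congr fun u => and_congr_right fun hu => ?_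
  rw [h u hu]
  refine and_congr_right fun _ => and_congr ?_ ?_
  · exact exists_congr fun s => and_congr_right fun hs => by rw [h s (by omega)]
  · exact forall₂_congr fun s hs => by rw [h s (by omega)]

/-- A drop below one checkpoint is decided before the next checkpoint is hit. At the first hit of a
checkpoint all earlier drops are therefore in the past, and the drop there has conditional
probability at most `freshLaw dead`. -/
lemma pathLaw_forall_drop_le (p : PMF ℕ) (hp0 : p 0 = 0) {lam : ℝ} (hlam : 0 < lam) (b : ℕ) {h : ℕ}
    (hh : 1 ≤ h) (K : ℕ) :
    pathLaw p lam hlam {x | ∀ i, 1 ≤ i → i ≤ K → ∃ t, Drop (b + i * h) (b + (i + 1) * h) t x} ≤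
      freshLaw p lam hlam dead ^ K := by
  induction K with
  | zero => rw [pow_zero]; exact prob_le_one
  | succ K ih =>
    set S : ℕ → (ℕ → Vertex) → Prop := fun t x => LevelHit (b + (K + 1) * h) t x ∧
      ∀ i, 1 ≤ i → i ≤ K → Drop (b + i * h) (b + (i + 1) * h) t x
    have hpos : b + (K + 1) * h ≠ 0 := by
      have : 1 ≤ (K + 1) * h := Nat.one_le_iff_ne_zero.2 (by positivity)
      omega
    have hS : ∀ t, Fresh t (S t) := fun t =>
      ⟨fun x y hxy => by
        simp only [S, adapted_levelHit _ t x y hxy, adapted_drop _ _ t x y hxy],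
        fun x hx => hx.1.ne_nil hpos, fun x hx => hx.1.not_suffix⟩
    rw [pow_succ]
    calc _ ≤ pathLaw p lam hlam {x | ∃ t, S t x ∧ rel t x ∈ dead} := by
          refine measure_mono_ae ?_
          filter_upwards [ae_isPath p hp0 hlam] with x hx
          intro (hD : ∀ i, 1 ≤ i → i ≤ K + 1 → ∃ t, Drop (b + i * h) (b + (i + 1) * h) t x)
          obtain ⟨_, u, -, hu1, ⟨s, hs1, hs2⟩, -⟩ := hD (K + 1) (by omega) le_rfl
          obtain ⟨t, hts, ht⟩ := hx.exists_levelHit (l := b + (K + 1) * h) (t := s) hs2.ge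
          refine ⟨t, ⟨ht, fun i hi1 hi2 => ?_⟩, u - t, rel_mem_dead_of_lt hx (by omega)
            (by rw [ht.1]; exact hu1)⟩
          obtain ⟨_, u', -, h1, h2, h3⟩ := hD i hi1 (by omega)
          -- The earlier drop happens no later than `t`, since until then the walk has stayed below
          -- a level that is at most the one occupied at time `t`.
          refine ⟨u', ?_, h1, h2, h3⟩
          by_contra hc
          have h4 := h3 t (by omega)
          rw [ht.1] at h4
          have h5 : (i + 1) * h ≤ (K + 1) * h := Nat.mul_le_mul_right h (by omega)
          omega
      _ = pathLaw p lam hlam {x | ∃ t, S t x} * freshLaw p lam hlam dead :=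
          pathLaw_exists_fresh p hp0 hlam hS (fun x s t h1 h2 => h1.1.unique h2.1)
            measurableSet_dead
      _ ≤ _ := by
          gcongr
          refine (measure_mono ?_).trans ih
          rintro x ⟨t, -, ht⟩ i hi1 hi2
          exact ⟨t, ht i hi1 hi2⟩

/-- The paths that reach the level `n` and hit the root afterwards. -/
def reachDead (n : ℕ) : Set (ℕ → Vertex) := {y | ∃ a c, a < c ∧ (y a).length = n ∧ y c = []}

lemma measurableSet_reachDead (n : ℕ) : MeasurableSet (reachDead n) := by
  have : reachDead n = ⋃ a, ⋃ c, {y : ℕ → Vertex | a < c ∧ (y a).length = n ∧ y c = []} := by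
    ext y; simp [reachDead]
  rw [this]
  refine MeasurableSet.iUnion fun a => MeasurableSet.iUnion fun c =>
    Adapted.measurableSet (t := a + c) fun x z hxz => ?_
  simp only [hxz a (by omega), hxz c (by omega)]

lemma freshLaw_reachDead_le (p : PMF ℕ) (hp0 : p 0 = 0) {lam : ℝ} (hlam : 0 < lam) {n : ℕ}
    (hn : n ≠ 0) : freshLaw p lam hlam (reachDead n) ≤
      pathLaw p lam hlam {x | ∃ t, ReachReturn n t x} := by
  rw [freshLaw, Measure.map_apply (measurable_rel 1) (measurableSet_reachDead n)]
  refine measure_mono_ae ?_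
  filter_upwards [ae_isPath p hp0 hlam] with x hx
  rintro ⟨a, c, hac, h1, h2⟩
  obtain ⟨j, hj⟩ := hx.one
  have hane : rel 1 x a ≠ [] := fun h0 => by rw [h0] at h1; exact hn h1.symm
  have h3 := length_rel hane
  have h4 := (hx.rel_ne_nil_iff 1 a).1 hane
  obtain ⟨u, hu1, hu2, hu3⟩ := exists_lt_of_rel_eq_nil hx h2
  rw [hj] at h3 hu3 h4
  simp only [List.length_singleton] at h3 hu3 h4
  refine ⟨u, 1 + a, u, ?_, le_rfl, by omega, List.length_eq_zero_iff.1 (by omega)⟩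
  by_contra hc
  have := h4 u hu1 (by omega)
  omega

/-- A checkpoint fails to be a regeneration level only if the walk falls below it later. If at some
checkpoint this happens after a climb of `h` levels, the return estimate applies in the fresh
subtree; if at every checkpoint it happens before such a climb, the drops multiply. -/
lemma pathLaw_no_regeneration_le (p : PMF ℕ) (hp0 : p 0 = 0) {lam : ℝ} (hlam : 0 < lam) (b : ℕ)
    {h : ℕ} (hh : 1 ≤ h) (K : ℕ) :
    pathLaw p lam hlam {x | ∃ T, (x T).length = b + (K + 1) * h ∧ ∀ t ≤ T,
      (∃ i, 1 ≤ i ∧ i ≤ K ∧ (x t).length = b + i * h) → ¬ IsRegenerationTime x t} ≤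
      K * pathLaw p lam hlam {x | ∃ t, ReachReturn (h + 1) t x} + freshLaw p lam hlam dead ^ K := by
  set E : ℕ → Set (ℕ → Vertex) := fun i =>
    {x | ∃ t, LevelHit (b + i * h) t x ∧ rel t x ∈ reachDead (h + 1)}
  have hE : ∀ i ∈ Finset.Icc 1 K, pathLaw p lam hlam (E i) ≤
      pathLaw p lam hlam {x | ∃ t, ReachReturn (h + 1) t x} := by
    intro i hi
    have hi1 := (Finset.mem_Icc.1 hi).1
    have hpos : b + i * h ≠ 0 := by
      have : 1 ≤ i * h := Nat.one_le_iff_ne_zero.2 (by positivity)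
      omega
    have hS : ∀ t, Fresh t (LevelHit (b + i * h) t) := fun t =>
      ⟨adapted_levelHit _ t, fun x hx => hx.ne_nil hpos, fun x hx => hx.not_suffix⟩
    rw [pathLaw_exists_fresh p hp0 hlam hS (fun x s t h1 h2 => h1.unique h2)
      (measurableSet_reachDead _)]
    calc _ ≤ 1 * freshLaw p lam hlam (reachDead (h + 1)) := by
          gcongr; exact prob_le_one
      _ ≤ _ := by rw [one_mul]; exact freshLaw_reachDead_le p hp0 hlam (by omega)
  calc _ ≤ pathLaw p lam hlam ((⋃ i ∈ Finset.Icc 1 K, E i) ∪ {x | ∀ i, 1 ≤ i → i ≤ K →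
        ∃ t, Drop (b + i * h) (b + (i + 1) * h) t x}) := by
        refine measure_mono_ae ?_
        filter_upwards [ae_isPath p hp0 hlam] with x hx
        rintro ⟨T, hT, hreg⟩
        by_contra hc
        refine hc (Or.inr fun i hi1 hi2 => ?_)
        have hle : (i + 1) * h ≤ (K + 1) * h := Nat.mul_le_mul_right h (by omega)
        have hsucc : (i + 1) * h = i * h + h := by ring
        obtain ⟨t, htT, ht⟩ := hx.exists_levelHit (l := b + i * h) (t := T) (by omega)
        have hnr := hreg t htT ⟨i, hi1, hi2, ht.1⟩
        have hdrop : ∃ u, t ≤ u ∧ (x u).length < b + i * h := by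
          by_contra hno
          push Not at hno
          exact hnr ⟨fun s hs => by rw [ht.1]; exact ht.2 s hs, fun u hu => by
            rw [ht.1]; exact hno u hu⟩
        classical
        set u := Nat.find hdrop
        obtain ⟨hu1, hu2⟩ : t ≤ u ∧ (x u).length < b + i * h := Nat.find_spec hdrop
        have hmin : ∀ s, t ≤ s → s < u → b + i * h ≤ (x s).length := fun s h1 h2 => by
          have := Nat.find_min hdrop h2
          push Not at this
          exact this h1
        have htu : t < u := by
          rcases hu1.lt_or_eq with h1 | h1
          · exact h1
          · rw [← h1, ht.1] at hu2; omega
        by_contra hnd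
        have hreach : ∃ s < u, b + (i + 1) * h ≤ (x s).length := by
          by_contra hno
          push Not at hno
          exact hnd ⟨u, u, le_rfl, hu2, ⟨t, htu, ht.1⟩, hno⟩
        obtain ⟨s, hs1, hs2⟩ := hreach
        obtain ⟨s', hs', hs''⟩ := hx.exists_levelHit hs2
        have hts' : t ≤ s' := by
          by_contra hlt
          have := ht.2 s' (by omega)
          rw [hs''.1] at this
          omega
        refine hc (Or.inl (Set.mem_biUnion (Finset.mem_coe.2 (Finset.mem_Icc.2 ⟨hi1, hi2⟩))
          ⟨t, ht, s' - t, u - t, by omega, ?_, rel_mem_dead_of_lt hx hu1 (by rw [ht.1]; exact hu2)⟩))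
        have hne : rel t x (s' - t) ≠ [] := by
          rw [hx.rel_ne_nil_iff]
          intro j hj1 hj2
          rw [ht.1]
          exact hmin j hj1 (by omega)
        -- Relative positions carry a leading 0, so a climb of `h` levels appears as relative level
        -- `h + 1`.
        have hlen := length_rel hne
        rw [show t + (s' - t) = s' by omega, hs''.1, ht.1] at hlen
        omega
    _ ≤ _ := by
        refine (measure_union_le _ _).trans (add_le_add ?_ (pathLaw_forall_drop_le p hp0 hlam b hh K))
        refine (measure_biUnion_finset_le _ _).trans ((Finset.sum_le_sum hE).trans ?_)
        simp

/-! ### The time spent without discovering new vertices -/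

/-- The vertices other than the root visited up to time `t`. -/
def visited (t : ℕ) (x : ℕ → Vertex) : Finset Vertex := ((Finset.range (t + 1)).image x).erase []

/-- A set of vertices that contains all ancestors of its elements, except for the root. -/
def AncClosed (S : Finset Vertex) : Prop := [] ∉ S ∧ ∀ i v, i :: v ∈ S → v ≠ [] → v ∈ S

lemma AncClosed.mem_of_suffix {S : Finset Vertex} (h : AncClosed S) {u v : Vertex} (hv : v ∈ S)
    (hu : u ≠ []) (huv : u <:+ v) : u ∈ S := by
  induction v with
  | nil => exact absurd hv h.1
  | cons i v ih =>
    rcases List.suffix_cons_iff.1 huv with rfl | h1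
    · exact hv
    · have hne : v ≠ [] := fun h0 => hu (List.suffix_nil.1 (h0 ▸ h1))
      exact ih (h.2 i v hv hne) h1

lemma AncClosed.insert_child {S : Finset Vertex} (h : AncClosed S) {v : Vertex} (hv : v ∈ S)
    (i : ℕ) : AncClosed (insert (i :: v) S) := by
  refine ⟨by simpa using h.1, fun j w hw hne => ?_⟩
  rcases Finset.mem_insert.1 hw with h1 | h1
  · rw [(List.cons_eq_cons.1 h1).2]
    exact Finset.mem_insert_of_mem hv
  · exact Finset.mem_insert_of_mem (h.2 j w h1 hne)

lemma AncClosed.length_le_card {S : Finset Vertex} (h : AncClosed S) {v : Vertex} (hv : v ∈ S) :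
    v.length ≤ S.card := by
  have hinj : Set.InjOn (fun k => v.drop k) (Finset.range v.length : Finset ℕ) := by
    intro a ha b hb hab
    have hb' := Finset.mem_range.1 (Finset.mem_coe.1 hb)
    have := congrArg List.length hab
    simp only [List.length_drop] at this
    omega
  calc v.length = ((Finset.range v.length).image fun k => v.drop k).card := by
        rw [Finset.card_image_of_injOn hinj, Finset.card_range]
    _ ≤ S.card := by
        refine Finset.card_le_card fun w hw => ?_
        obtain ⟨k, hk, rfl⟩ := Finset.mem_image.1 hw
        have hk' := Finset.mem_range.1 hk
        refine h.mem_of_suffix hv ?_ (List.drop_suffix k v)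
        rw [ne_eq, List.drop_eq_nil_iff]
        omega

lemma IsPath.ancClosed_visited {x : ℕ → Vertex} (h : IsPath x) (t : ℕ) :
    AncClosed (visited t x) := by
  refine ⟨by simp [visited], fun i v hv hne => ?_⟩
  simp only [visited, Finset.mem_erase, Finset.mem_image, Finset.mem_range] at hv ⊢
  obtain ⟨_, s, hs, hxs⟩ := hv
  obtain ⟨s', hs', h1, -⟩ := h.first_visit (v := v) (t := s) (by rw [hxs]; exact List.suffix_cons i v)
  exact ⟨hne, s', by omega, h1⟩

lemma visited_congr {t : ℕ} {x y : ℕ → Vertex} (h : ∀ i ≤ t, x i = y i) :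
    visited t x = visited t y := by
  unfold visited
  congr 1
  exact Finset.image_congr fun i hi => h i (by
    have := Finset.mem_range.1 (Finset.mem_coe.1 hi); omega)

lemma visited_update (t : ℕ) (x : ℕ → Vertex) {y : Vertex} (hy : y ≠ []) :
    visited (t + 1) (Function.update x (t + 1) y) = insert y (visited t x) := by
  unfold visited
  rw [Finset.range_add_one, Finset.image_insert, Function.update_self,
    Finset.erase_insert_of_ne hy]
  congr 2
  exact Finset.image_congr fun i hi => Function.update_of_ne (by
    have := Finset.mem_range.1 (Finset.mem_coe.1 hi); omega) _ _

/-- The walk does not return to the root up to time `t`, and it visits at most `N` vertices other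
than the root. -/
def Slow (N t : ℕ) (x : ℕ → Vertex) : Prop :=
  (∀ i, 1 ≤ i → i ≤ t → x i ≠ []) ∧ (visited t x).card ≤ N

lemma adapted_slow (N t : ℕ) : Adapted t (Slow N t) := by
  intro x y h
  simp only [Slow, eq_iff_iff, visited_congr h]
  exact and_congr_left fun _ => forall₃_congr fun i _ hi => by rw [h i hi]

/-! ### Lyapunov functions and the survival of a slow walk -/

/-- A Lyapunov function for the walk on `S`, killed at the root and when it leaves `S`. -/
structure IsLyapunov (lam : ℝ) (N : ℕ) (K : ℝ) (g : Finset Vertex → Vertex → ℝ) : Prop where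
  one_le : ∀ S, AncClosed S → S.card ≤ N → ∀ v ∈ S, 1 ≤ g S v
  le_bound : ∀ S, AncClosed S → S.card ≤ N → ∀ v ∈ S, g S v ≤ K
  root_nonneg : ∀ S, 0 ≤ g S []
  step : ∀ S, AncClosed S → S.card ≤ N → ∀ j u, j :: u ∈ S → ∀ n : ℕ, 1 ≤ n →
    lam * g S u + ∑ i ∈ Finset.range n, (if i :: j :: u ∈ S then g S (i :: j :: u) else 0) ≤
      (lam + n) * (g S (j :: u) - 1)

/-- Within a fixed set of visited vertices, `g` loses at least 1 per step in mean. Each new vertex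
may reset `g` up to `K`, and a reserve of `K` per vertex still to be discovered pays for this. The
total lies in `[1, (N + 1) * K]`, so the loss of 1 is a relative loss. -/
lemma quenched_slow_le {lam : ℝ} (hlam : 0 < lam) {d : Env} (hd : ∀ v, 1 ≤ d v) {N : ℕ} {K : ℝ}
    (hK : 1 ≤ K) {g : Finset Vertex → Vertex → ℝ} (hg : IsLyapunov lam N K g) (n : ℕ) :
    quenched lam hlam d {x | Slow N (1 + n) x} ≤
      ENNReal.ofReal (1 - 1 / ((N + 1) * K)) ^ n * ENNReal.ofReal ((N + 1) * K) := by
  classical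
  set M : ℝ := (N + 1) * K with hM
  have hM1 : 1 ≤ M := by
    rw [hM]; nlinarith [(Nat.cast_nonneg N : (0 : ℝ) ≤ N)]
  set Φ : ℕ → (ℕ → Vertex) → ℝ≥0∞ := fun t x => if Slow N t x then
    ENNReal.ofReal ((N - (visited t x).card) * K + g (visited t x) (x t)) else 0 with hΦdef
  have hΦ : ∀ t, Adapted t (Φ t) := by
    intro t x y hxy
    simp only [hΦdef, adapted_slow N t x y hxy, visited_congr hxy, hxy t le_rfl]
  have hmem : ∀ t x, 1 ≤ t → Slow N t x → x t ∈ visited t x := by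
    intro t x ht hs
    simp only [visited, Finset.mem_erase, Finset.mem_image, Finset.mem_range]
    exact ⟨hs.1 t ht le_rfl, t, by omega, rfl⟩
  have hbd : ∀ t x, 1 ≤ t → IsWalk d x → Slow N t x →
      1 ≤ (N - (visited t x).card : ℝ) * K + g (visited t x) (x t) ∧
      (N - (visited t x).card : ℝ) * K + g (visited t x) (x t) ≤ M := by
    intro t x ht hx hs
    have hc := hx.isPath.ancClosed_visited t
    have h1 := hg.one_le _ hc hs.2 _ (hmem t x ht hs)
    have h2 := hg.le_bound _ hc hs.2 _ (hmem t x ht hs)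
    have h3 : ((visited t x).card : ℝ) ≤ N := by exact_mod_cast hs.2
    have h4 : (0 : ℝ) ≤ (visited t x).card := Nat.cast_nonneg _
    constructor
    · nlinarith [mul_nonneg (sub_nonneg.2 h3) (zero_le_one.trans hK)]
    · rw [hM]; nlinarith [mul_nonneg h4 (zero_le_one.trans hK)]
  have hstep : ∀ t x, 1 ≤ t → IsWalk d x →
      ∫⁻ y, Φ (t + 1) (Function.update x (t + 1) y) ∂(stepLaw lam (d (x t)) (x t)) ≤
        ENNReal.ofReal (1 - 1 / M) * Φ t x := by
    intro t x ht hx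
    have hup : ∀ y, ∀ i ≤ t, Function.update x (t + 1) y i = x i := fun y i hi =>
      Function.update_of_ne (by omega) _ _
    by_cases hs : Slow N t x
    swap
    · have h0 : ∀ y, Φ (t + 1) (Function.update x (t + 1) y) = 0 := by
        intro y
        have : ¬ Slow N (t + 1) (Function.update x (t + 1) y) := by
          rintro ⟨h1, h2⟩
          refine hs ⟨fun i hi1 hi2 => ?_, ?_⟩
          · have := h1 i hi1 (by omega)
            rwa [hup y i hi2] at this
          · refine (Finset.card_le_card ?_).trans h2
            rw [visited_congr fun i hi => (hup y i hi).symm]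
            exact Finset.erase_subset_erase _ (Finset.image_subset_image
              (Finset.range_subset_range.2 (by omega)))
        simp [hΦdef, this]
      simp [h0]
    have hc := hx.isPath.ancClosed_visited t
    have hv := hmem t x ht hs
    obtain ⟨j, u, hju⟩ := List.exists_cons_of_ne_nil (hs.1 t ht le_rfl)
    set S := visited t x with hS
    set A : ℝ := (N - S.card) * K with hA
    have hSN : (S.card : ℝ) ≤ N := by exact_mod_cast hs.2
    have hA0 : 0 ≤ A := mul_nonneg (sub_nonneg.2 hSN) (zero_le_one.trans hK)
    have hΦt : Φ t x = ENNReal.ofReal (A + g S (x t)) := by simp [hΦdef, hs, hA, hS]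
    have hpos : (0 : ℝ) < lam + d (x t) := by positivity
    have hgu : 0 ≤ g S u := by
      by_cases hu : u = []
      · rw [hu]; exact hg.root_nonneg S
      · rw [hju] at hv
        exact zero_le_one.trans (hg.one_le S hc hs.2 u (hc.2 j u hv hu))
    have hpar : Φ (t + 1) (Function.update x (t + 1) u) ≤ ENNReal.ofReal (A + g S u) := by
      by_cases hu : u = []
      · have : ¬ Slow N (t + 1) (Function.update x (t + 1) u) := fun h =>
          h.1 (t + 1) (by omega) le_rfl (by rw [Function.update_self, hu])
        simp [hΦdef, this]
      · rw [hju] at hv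
        have hvis : visited (t + 1) (Function.update x (t + 1) u) = S := by
          rw [visited_update t x hu, Finset.insert_eq_of_mem (hc.2 j u hv hu)]
        simp only [hΦdef, hvis, Function.update_self]
        split_ifs
        · exact le_rfl
        · exact bot_le
    -- For a new vertex the reserve drops by `K`, which covers the value of `g` on the enlarged set.
    -- In the drift condition a step out of `S` therefore counts as 0.
    have hchild : ∀ i, Φ (t + 1) (Function.update x (t + 1) (i :: j :: u)) ≤
        ENNReal.ofReal (A + if i :: j :: u ∈ S then g S (i :: j :: u) else 0) := by
      intro i
      have hvis := visited_update t x (List.cons_ne_nil i (j :: u))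
      rw [← hS] at hvis
      simp only [hΦdef, hvis, Function.update_self]
      split_ifs with h1 h2
      · rw [Finset.insert_eq_of_mem h2]
      · have h3 := h1.2
        rw [hvis] at h3
        have h4 := hg.le_bound _ (hc.insert_child (hju ▸ hv) i) h3 (i :: j :: u)
          (Finset.mem_insert_self _ _)
        rw [Finset.card_insert_of_notMem h2] at h3 ⊢
        refine ENNReal.ofReal_le_ofReal ?_
        rw [hA]
        push_cast
        nlinarith
      · exact bot_le
      · exact bot_le
    have hmain := hg.step S hc hs.2 j u (hju ▸ hv) (d (x t)) (hd _)
    obtain ⟨hb1, hb2⟩ := hbd t x ht hx hs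
    rw [← hS, ← hA, hju] at hb1 hb2
    have hite : ∀ i, 0 ≤ (if i :: j :: u ∈ S then g S (i :: j :: u) else 0) := by
      intro i
      split_ifs with h1
      · exact zero_le_one.trans (hg.one_le S hc hs.2 _ h1)
      · exact le_rfl
    rw [hΦt, hju, ← ENNReal.ofReal_mul (by rw [sub_nonneg, div_le_one (by linarith)]; exact hM1)]
    rw [lintegral_stepLaw_cons]
    rw [hju] at hmain hpos
    set k := d (j :: u)
    calc _ ≤ ENNReal.ofReal (lam / (lam + k)) * ENNReal.ofReal (A + g S u) +
          ∑ i ∈ Finset.range k, ENNReal.ofReal (1 / (lam + k)) *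
            ENNReal.ofReal (A + if i :: j :: u ∈ S then g S (i :: j :: u) else 0) := by
          gcongr with i _
          exact hchild i
      _ = ENNReal.ofReal (lam / (lam + k) * (A + g S u) + ∑ i ∈ Finset.range k, 1 / (lam + k) *
            (A + if i :: j :: u ∈ S then g S (i :: j :: u) else 0)) := by
          rw [ENNReal.ofReal_add (by positivity) (Finset.sum_nonneg fun i _ =>
              mul_nonneg (by positivity) (add_nonneg hA0 (hite i))),
            ENNReal.ofReal_mul (by positivity), ENNReal.ofReal_sum_of_nonneg fun i _ =>
              mul_nonneg (by positivity) (add_nonneg hA0 (hite i))]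
          congr 1
          exact Finset.sum_congr rfl fun i _ => by rw [ENNReal.ofReal_mul (by positivity)]
      _ ≤ ENNReal.ofReal (A + g S (j :: u) - 1) := by
          refine ENNReal.ofReal_le_ofReal ?_
          rw [← Finset.mul_sum, Finset.sum_add_distrib, Finset.sum_const, Finset.card_range,
            nsmul_eq_mul]
          have : lam / (lam + k) * (A + g S u) + 1 / (lam + k) * (k * A +
              ∑ i ∈ Finset.range k, if i :: j :: u ∈ S then g S (i :: j :: u) else 0) =
              A + (lam * g S u + ∑ i ∈ Finset.range k,
                if i :: j :: u ∈ S then g S (i :: j :: u) else 0) / (lam + k) := by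
            field_simp
            ring
          rw [this, add_sub_assoc]
          gcongr
          rw [div_le_iff₀ hpos]
          linarith
      _ ≤ _ := by
          refine ENNReal.ofReal_le_ofReal ?_
          rw [one_sub_mul]
          gcongr
          rw [one_div, inv_mul_le_iff₀ (by linarith), mul_one]
          exact hb2
  have h1 := lintegral_le_geom hlam d hd (ENNReal.ofReal (1 - 1 / M)) 1 hΦ hstep n
  have h0 : ∫⁻ x, Φ 1 x ∂(quenched lam hlam d) ≤ ENNReal.ofReal M := by
    calc _ ≤ ∫⁻ _x, ENNReal.ofReal M ∂(quenched lam hlam d) := by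
          refine lintegral_mono_ae ?_
          filter_upwards [ae_isWalk hlam d hd] with x hx
          simp only [hΦdef]
          split_ifs with h
          · exact ENNReal.ofReal_le_ofReal (hbd 1 x le_rfl hx h).2
          · exact bot_le
      _ = _ := by simp
  refine le_trans ?_ (h1.trans (by gcongr))
  rw [← lintegral_indicator_one (adapted_slow N (1 + n)).measurableSet]
  refine lintegral_mono_ae ?_
  filter_upwards [ae_isWalk hlam d hd] with x hx
  by_cases hs : Slow N (1 + n) x
  · have := (hbd (1 + n) x (by omega) hx hs).1
    simp only [Set.indicator, Set.mem_ofPred_eq, hs, if_true, hΦdef, Pi.one_apply]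
    rw [← ENNReal.ofReal_one]
    exact ENNReal.ofReal_le_ofReal this
  · simp [Set.indicator, hs]

/-- As every vertex has an offspring and `lam < 1`, the level has mean drift at least `(1 - lam) /
(1 + lam)` upwards, and levels in `S` are at most `N`. The constant in front normalises the drift to
1. -/
lemma isLyapunov_of_lt_one {lam : ℝ} (hlam : 0 < lam) (h1 : lam < 1) (N : ℕ) :
    IsLyapunov lam N ((1 + lam) / (1 - lam) * (N + 1))
      fun _ v => (1 + lam) / (1 - lam) * max ((N : ℝ) + 1 - v.length) 0 := by
  have hpos : 0 < 1 - lam := by linarith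
  set C := (1 + lam) / (1 - lam) with hC
  have hC1 : 1 ≤ C := by rw [hC, one_le_div hpos]; linarith
  have hlen : ∀ S, AncClosed S → S.card ≤ N → ∀ v ∈ S, (v.length : ℝ) ≤ N := fun S hS hN v hv => by
    exact_mod_cast (hS.length_le_card hv).trans hN
  refine ⟨fun S hS hN v hv => ?_, fun S hS hN v hv => ?_, fun S => by positivity,
    fun S hS hN j u hv n hn => ?_⟩
  · have := hlen S hS hN v hv
    have h2 : (1 : ℝ) ≤ max ((N : ℝ) + 1 - v.length) 0 := le_max_of_le_left (by linarith)
    nlinarith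
  · gcongr
    refine max_le ?_ (by positivity)
    linarith
  · have h2 := hlen S hS hN _ hv
    rw [List.length_cons] at h2 ⊢
    push_cast at h2 ⊢
    have hsum : ∑ i ∈ Finset.range n, (if i :: j :: u ∈ S then
        C * max ((N : ℝ) + 1 - (i :: j :: u).length) 0 else 0) ≤
        n * (C * (N - 1 - u.length)) := by
      rw [← nsmul_eq_mul]
      have := Finset.sum_le_card_nsmul (Finset.range n) (fun i => if i :: j :: u ∈ S then
        C * max ((N : ℝ) + 1 - (i :: j :: u).length) 0 else 0) (C * (N - 1 - u.length)) ?_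
      · simpa using this
      · intro i _
        have h3 : 0 ≤ C * ((N : ℝ) - 1 - u.length) := mul_nonneg (by linarith) (by linarith)
        split_ifs
        · gcongr
          refine max_le ?_ (by linarith)
          simp only [List.length_cons]
          push_cast
          linarith
        · exact h3
    have e1 : max ((N : ℝ) + 1 - u.length) 0 = N + 1 - u.length := max_eq_left (by linarith)
    have e2 : max ((N : ℝ) + 1 - (u.length + 1)) 0 = N + 1 - (u.length + 1) :=
      max_eq_left (by linarith)
    rw [e1, e2]
    have hn' : (1 : ℝ) ≤ n := by exact_mod_cast hn
    have hkey : lam + n ≤ C * (n - lam) := by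
      rw [hC, div_mul_eq_mul_div, le_div_iff₀ hpos]
      nlinarith
    nlinarith

open Classical in
/-- The number of elements of `S` in the subtree at `v`. -/
def subCard (S : Finset Vertex) (v : Vertex) : ℕ := (S.filter fun z => v <:+ z).card

/-- The sum of `2 * subCard S u - 1` over the ancestors `u ≠ []` of `v`, including `v`. -/
def pathSum (S : Finset Vertex) : Vertex → ℝ
  | [] => 0
  | i :: v => pathSum S v + (2 * subCard S (i :: v) - 1)

lemma one_le_subCard {S : Finset Vertex} {v : Vertex} (hv : v ∈ S) : 1 ≤ subCard S v := by
  classical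
  exact Finset.card_pos.2 ⟨v, Finset.mem_filter.2 ⟨hv, List.suffix_rfl⟩⟩

/-- The subtrees at the offspring of `v` are disjoint and do not contain `v` itself. -/
lemma sum_subCard_le {S : Finset Vertex} {v : Vertex} (hv : v ∈ S) (n : ℕ) :
    ∑ i ∈ Finset.range n, subCard S (i :: v) + 1 ≤ subCard S v := by
  classical
  have hdis : ∀ i ∈ Finset.range n, ∀ j ∈ Finset.range n, i ≠ j →
      Disjoint (S.filter fun z => (i :: v) <:+ z) (S.filter fun z => (j :: v) <:+ z) := by
    intro i _ j _ hij
    refine Finset.disjoint_left.2 fun z hz hz' => hij ?_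
    have h1 := (Finset.mem_filter.1 hz).2
    have h2 := (Finset.mem_filter.1 hz').2
    have h3 := List.suffix_of_suffix_length_le h1 h2 (by simp)
    exact (List.cons_eq_cons.1 (h3.eq_of_length (by simp))).1
  have h : ((Finset.range n).biUnion fun i => S.filter fun z => (i :: v) <:+ z) ⊆
      (S.filter fun z => v <:+ z).erase v := by
    intro z hz
    obtain ⟨i, -, hi⟩ := Finset.mem_biUnion.1 hz
    obtain ⟨h1, h2⟩ := Finset.mem_filter.1 hi
    refine Finset.mem_erase.2 ⟨?_, Finset.mem_filter.2 ⟨h1, (List.suffix_cons i v).trans h2⟩⟩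
    rintro rfl
    have := h2.length_le
    simp at this
  have h2 := Finset.card_le_card h
  rw [Finset.card_biUnion hdis, Finset.card_erase_of_mem
    (Finset.mem_filter.2 ⟨hv, List.suffix_rfl⟩)] at h2
  have h3 := one_le_subCard hv
  have h4 : ∑ i ∈ Finset.range n, subCard S (i :: v) ≤ subCard S v - 1 := by
    convert! h2
  omega

/-- `pathSum` is the mean time for simple random walk on the finite tree `S` to reach the root, the
term of an ancestor being the mean time to cross the edge above it. A stronger bias to the root and
the killing outside `S` only help. -/
lemma isLyapunov_of_one_le {lam : ℝ} (h1 : 1 ≤ lam) (N : ℕ) :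
    IsLyapunov lam N (2 * (N + 1) ^ 2) pathSum := by
  have hnn : ∀ S, AncClosed S → ∀ v, v ∈ S ∨ v = [] → 0 ≤ pathSum S v := by
    intro S hS v hv
    induction v with
    | nil => exact le_rfl
    | cons i v ih =>
      have hv' : i :: v ∈ S := hv.resolve_right (by simp)
      have h2 : (1 : ℝ) ≤ subCard S (i :: v) := by exact_mod_cast one_le_subCard hv'
      have h3 := ih (by
        by_cases h : v = []
        · exact Or.inr h
        · exact Or.inl (hS.2 i v hv' h))
      rw [pathSum]
      linarith
  have hle : ∀ (S : Finset Vertex) v, pathSum S v ≤ v.length * (2 * S.card) := by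
    classical
    intro S v
    induction v with
    | nil => simp [pathSum]
    | cons i v ih =>
      have h2 : (subCard S (i :: v) : ℝ) ≤ S.card := by
        exact_mod_cast Finset.card_filter_le _ _
      rw [pathSum, List.length_cons]
      push_cast
      linarith
  have hone : ∀ S, AncClosed S → ∀ v ∈ S, 1 ≤ pathSum S v := by
    intro S hS v hv
    cases v with
    | nil => exact absurd hv hS.1
    | cons i v =>
      have h2 : (1 : ℝ) ≤ subCard S (i :: v) := by exact_mod_cast one_le_subCard hv
      have h3 := hnn S hS v (by
        by_cases h : v = []
        · exact Or.inr h
        · exact Or.inl (hS.2 i v hv h))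
      rw [pathSum]
      linarith
  refine ⟨fun S hS _ v hv => hone S hS v hv, fun S hS hN v hv => ?_, fun S => le_rfl,
    fun S hS hN j u hv n hn => ?_⟩
  · have h2 : (v.length : ℝ) ≤ N := by exact_mod_cast (hS.length_le_card hv).trans hN
    calc pathSum S v ≤ v.length * (2 * S.card) := hle S v
      _ ≤ N * (2 * N) := by gcongr
      _ ≤ 2 * (N + 1) ^ 2 := by nlinarith [(Nat.cast_nonneg N : (0 : ℝ) ≤ N)]
  · have hs : ∑ i ∈ Finset.range n, (subCard S (i :: j :: u) : ℝ) + 1 ≤ subCard S (j :: u) := by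
      exact_mod_cast sum_subCard_le hv n
    set s : ℝ := (subCard S (j :: u) : ℝ) with hsdef
    have hs1 : 1 ≤ s := by rw [hsdef]; exact_mod_cast one_le_subCard hv
    set G := pathSum S (j :: u) with hG
    have hG1 : 1 ≤ G := hone S hS _ hv
    have hGu : pathSum S u = G - (2 * s - 1) := by rw [hG, pathSum]; ring
    have hsum : ∑ i ∈ Finset.range n,
        (if i :: j :: u ∈ S then pathSum S (i :: j :: u) else 0) ≤
        n * (G - 1) + ∑ i ∈ Finset.range n, 2 * (subCard S (i :: j :: u) : ℝ) := by
      rw [← nsmul_eq_mul]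
      calc _ ≤ ∑ i ∈ Finset.range n, ((G - 1) + 2 * (subCard S (i :: j :: u) : ℝ)) := by
            refine Finset.sum_le_sum fun i _ => ?_
            split_ifs
            · rw [pathSum, ← hG]; linarith
            · have : (0 : ℝ) ≤ subCard S (i :: j :: u) := Nat.cast_nonneg _
              linarith
        _ = _ := by rw [Finset.sum_add_distrib, Finset.sum_const, Finset.card_range]
    rw [← Finset.mul_sum] at hsum
    rw [hGu]
    -- What is left is that twice the sum of the subtree sizes of the offspring is at most `lam * (2
    -- * s - 2)`; this follows from `hs` and `1 ≤ lam`.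
    nlinarith [mul_nonneg (sub_nonneg.2 h1) (sub_nonneg.2 hs1)]

lemma exists_quenched_slow_le {lam : ℝ} (hlam : 0 < lam) : ∃ C : ℝ, 1 ≤ C ∧
    ∀ d : Env, (∀ v, 1 ≤ d v) → ∀ N n : ℕ, quenched lam hlam d {x | Slow N (1 + n) x} ≤
      ENNReal.ofReal (1 - 1 / (C * (N + 1) ^ 3)) ^ n * ENNReal.ofReal (C * (N + 1) ^ 3) := by
  rcases lt_or_ge lam 1 with h1 | h1
  · have hpos : 0 < 1 - lam := by linarith
    have hC1 : 1 ≤ (1 + lam) / (1 - lam) := by rw [one_le_div hpos]; linarith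
    refine ⟨(1 + lam) / (1 - lam), hC1, fun d hd N n => ?_⟩
    have hN : (1 : ℝ) ≤ (N : ℝ) + 1 := by linarith [(Nat.cast_nonneg N : (0 : ℝ) ≤ N)]
    have hg := isLyapunov_of_lt_one hlam h1 N
    set C := (1 + lam) / (1 - lam)
    -- The linear bound is weakened to a quadratic one, to have the same cubic form as in the case
    -- `1 ≤ lam`.
    have hK : C * ((N : ℝ) + 1) ≤ C * (N + 1) ^ 2 := by
      gcongr; nlinarith
    have hg' : IsLyapunov lam N (C * (N + 1) ^ 2) fun _ v =>
        C * max ((N : ℝ) + 1 - v.length) 0 :=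
      ⟨hg.one_le, fun S hS hN v hv => (hg.le_bound S hS hN v hv).trans hK, hg.root_nonneg, hg.step⟩
    have := quenched_slow_le hlam hd (K := C * (N + 1) ^ 2) (by nlinarith) hg' n
    rwa [show ((N : ℝ) + 1) * (C * (N + 1) ^ 2) = C * (N + 1) ^ 3 by ring] at this
  · refine ⟨2, by norm_num, fun d hd N n => ?_⟩
    have hN : (1 : ℝ) ≤ (N : ℝ) + 1 := by linarith [(Nat.cast_nonneg N : (0 : ℝ) ≤ N)]
    have := quenched_slow_le hlam hd (K := 2 * ((N : ℝ) + 1) ^ 2) (by nlinarith)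
      (isLyapunov_of_one_le h1 N) n
    rwa [show ((N : ℝ) + 1) * (2 * (N + 1) ^ 2) = 2 * (N + 1) ^ 3 by ring] at this

/-! ### Late regeneration of the walk seen from a fresh vertex -/

/-- The paths that do not hit the root and have no regeneration time in `[1, n]`. -/
def lateRegen (n : ℕ) : Set (ℕ → Vertex) :=
  {y | y ∈ deadᶜ ∧ ∀ s, 1 ≤ s → s ≤ n → ¬ IsRegenerationTime y s}

lemma measurableSet_isRegenerationTime (s : ℕ) :
    MeasurableSet {y | IsRegenerationTime y s} := by
  have : {y | IsRegenerationTime y s} =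
      {y : ℕ → Vertex | ∀ r < s, (y r).length < (y s).length} ∩
        ⋂ u, {y : ℕ → Vertex | s ≤ u → (y s).length ≤ (y u).length} := by
    ext y; simp [IsRegenerationTime]
  rw [this]
  refine MeasurableSet.inter (Adapted.measurableSet (t := s) fun x z h => ?_)
    (MeasurableSet.iInter fun u => Adapted.measurableSet (t := s + u) fun x z h => ?_)
  · simp only [eq_iff_iff]
    exact forall₂_congr fun r hr => by rw [h r (by omega), h s le_rfl]
  · simp only [h s (by omega), h u (by omega)]

lemma measurableSet_lateRegen (n : ℕ) : MeasurableSet (lateRegen n) := by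
  have : lateRegen n = deadᶜ ∩ ⋂ s, {y | 1 ≤ s → s ≤ n → ¬ IsRegenerationTime y s} := by
    ext y; simp [lateRegen]
  rw [this]
  refine measurableSet_dead.compl.inter (MeasurableSet.iInter fun s => ?_)
  by_cases h : 1 ≤ s ∧ s ≤ n
  · simp only [h.1, h.2, true_implies]
    exact (measurableSet_isRegenerationTime s).compl
  · have : {y | 1 ≤ s → s ≤ n → ¬ IsRegenerationTime y s} = Set.univ :=
      Set.eq_univ_of_forall fun y h1 h2 => absurd ⟨h1, h2⟩ h
    rw [this]
    exact MeasurableSet.univ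

lemma ne_nil_of_mem_dead_compl {y : ℕ → Vertex} (h : y ∈ deadᶜ) (n : ℕ) : y n ≠ [] :=
  fun h0 => h ⟨n, h0⟩

lemma IsPath.length_le {x : ℕ → Vertex} (h : IsPath x) (t : ℕ) : (x t).length ≤ t := by
  induction t with
  | zero => simp [h.1]
  | succ t ih => have := h.length_succ_le t; omega

lemma card_visited_le {x : ℕ → Vertex} (h : IsPath x) {L r t : ℕ}
    (hL : ∀ s ≤ t, (x s).length ≤ L)
    (hr : ∀ l ∈ Finset.Icc 1 L, levelCount l x (t + 1) ≤ r) : (visited t x).card ≤ L * r := by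
  classical
  have hsub : visited t x ⊆ (Finset.Icc 1 L).biUnion fun l =>
      ((Finset.range (t + 1)).image x).filter fun v => v.length = l := by
    intro v hv
    simp only [visited, Finset.mem_erase] at hv
    refine Finset.mem_biUnion.2 ⟨v.length, Finset.mem_Icc.2 ⟨?_, ?_⟩,
      Finset.mem_filter.2 ⟨hv.2, rfl⟩⟩
    · exact List.length_pos_iff.2 hv.1
    · obtain ⟨s, hs, rfl⟩ := Finset.mem_image.1 hv.2
      exact hL s (by have := Finset.mem_range.1 hs; omega)
  calc _ ≤ _ := Finset.card_le_card hsub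
    _ ≤ _ := Finset.card_biUnion_le
    _ ≤ ∑ l ∈ Finset.Icc 1 L, r :=
        Finset.sum_le_sum fun l hl => (h.card_level_le l (t + 1)).trans (hr l hl)
    _ = L * r := by simp

/-- Three ways to fail: some level up to `(h + 1) * h` has more than `h` visited vertices; few
vertices are seen in a long time without return; or the walk passes level `(h + 1) * h` in time, but
no checkpoint is a regeneration level. If the first two are excluded, the walk is high enough for
the third. -/
lemma freshLaw_lateRegen_le (p : PMF ℕ) (hp0 : p 0 = 0) {lam : ℝ} (hlam : 0 < lam) {h : ℕ}
    (hh : 2 ≤ h) (n : ℕ) :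
    freshLaw p lam hlam (lateRegen n) ≤ ((h + 1) * h : ℕ) * freshLaw p lam hlam dead ^ h +
      pathLaw p lam hlam {x | Slow ((h + 1) * h * h) (1 + n) x} +
      (h * pathLaw p lam hlam {x | ∃ t, ReachReturn (h + 1) t x} +
        freshLaw p lam hlam dead ^ h) := by
  set L := (h + 1) * h with hL
  rw [freshLaw, Measure.map_apply (measurable_rel 1) (measurableSet_lateRegen n), ← freshLaw]
  calc _ ≤ pathLaw p lam hlam (((⋃ l ∈ Finset.Icc 1 L,
        {x | ∃ t, NewAt l x t ∧ levelCount l x t = h}) ∪ {x | Slow (L * h) (1 + n) x}) ∪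
        {x | ∃ T, (x T).length = 0 + (h + 1) * h ∧ ∀ t ≤ T,
          (∃ i, 1 ≤ i ∧ i ≤ h ∧ (x t).length = 0 + i * h) → ¬ IsRegenerationTime x t}) := by
        refine measure_mono_ae ?_
        filter_upwards [ae_isPath p hp0 hlam] with x hx
        rintro ⟨halive, hreg⟩
        by_contra hc
        have hc1 : ∀ l ∈ Finset.Icc 1 L, ¬ ∃ t, NewAt l x t ∧ levelCount l x t = h :=
          fun l hl h1 => hc (Or.inl (Or.inl (Set.mem_biUnion hl h1)))
        have hc2 : ¬ Slow (L * h) (1 + n) x := fun h1 => hc (Or.inl (Or.inr h1))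
        refine hc (Or.inr ?_)
        have hnr := hx.rel_one_mem_dead_iff.1 halive
        obtain ⟨j, hj⟩ := hx.one
        have hlen : ∀ s, (rel 1 x s).length = (x (1 + s)).length := by
          intro s
          have := length_rel (ne_nil_of_mem_dead_compl halive s)
          rw [hj] at this
          simpa using this
        have hfar : ∃ s ≤ 1 + n, L < (x s).length := by
          by_contra hno
          push Not at hno
          refine hc2 ⟨fun i hi _ => hnr i hi, card_visited_le hx hno fun l hl => ?_⟩
          by_contra hlt
          obtain ⟨s, -, h1⟩ := exists_newAt_of_lt l h x _ (not_le.1 hlt)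
          exact hc1 l hl ⟨s, h1⟩
        obtain ⟨s, hs, hsL⟩ := hfar
        obtain ⟨T, hTs, hT⟩ := hx.exists_levelHit (l := L) (t := s) hsL.le
        refine ⟨T, by rw [hT.1, zero_add], ?_⟩
        rintro t htT ⟨i, hi1, hi2, hlt⟩ hregt
        -- Time `t` of the walk is time `t - 1` of the relative path, which must be at least 1. This
        -- is why the spacing `h` is at least 2.
        have h2 : 2 ≤ (x t).length := by
          rw [hlt, zero_add]; nlinarith
        have ht2 := hx.length_le t
        refine hreg (t - 1) (by omega) (by omega) ⟨fun r hr => ?_, fun u hu => ?_⟩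
        · rw [hlen, hlen, show 1 + (t - 1) = t by omega]
          exact hregt.1 (1 + r) (by omega)
        · rw [hlen, hlen, show 1 + (t - 1) = t by omega]
          exact hregt.2 (1 + u) (by omega)
    _ ≤ _ := by
        refine (measure_union_le _ _).trans (add_le_add ((measure_union_le _ _).trans
          (add_le_add ?_ le_rfl)) (pathLaw_no_regeneration_le p hp0 hlam 0 (by omega) h))
        refine (measure_biUnion_finset_le _ _).trans ((Finset.sum_le_sum fun l hl =>
          pathLaw_newAt_le p hp0 hlam (by have := (Finset.mem_Icc.1 hl).1; omega) h).trans ?_)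
        simp

/-! ### The walk is unbounded -/

/-- The exponential `(1 + lam) ^ level` has a uniformly positive drift on every tree without leaves,
whatever the bias. Below level `L` it is bounded, so survival there decays geometrically. -/
lemma quenched_bounded_eq_zero {lam : ℝ} (hlam : 0 < lam) {d : Env} (hd : ∀ v, 1 ≤ d v) (L : ℕ) :
    quenched lam hlam d {x | ∀ t, (x t).length < L} = 0 := by
  classical
  set b : ℝ := 1 + lam with hb
  -- The exact drift at level one when every vertex has a single offspring, which is the worst case:
  -- `(lam + b ^ 2) / (lam + 1) = b + c`.
  set c : ℝ := lam / (1 + lam) with hc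
  have hb1 : 1 ≤ b := by rw [hb]; linarith
  have hcpos : 0 < c := by positivity
  have hcb : c * (1 + lam) = lam := by rw [hc]; field_simp
  have hclt : c ≤ lam := by nlinarith
  set a : ℝ := b ^ L with ha
  -- The extra `c` keeps the potential at least `c` as long as the walk stays below level `L`.
  set M : ℝ := a + c with hM
  have hMpos : 0 < M := by positivity
  set Φ : ℕ → (ℕ → Vertex) → ℝ≥0∞ := fun t x =>
    if ∀ s ≤ t, (x s).length < L then ENNReal.ofReal (M - b ^ (x t).length) else 0 with hΦdef
  have hle : ∀ k, k < L → b ^ k ≤ a := fun k hk => pow_le_pow_right₀ hb1 hk.le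
  have hΦ : ∀ t, Adapted t (Φ t) := by
    intro t x y hxy
    have : (∀ s ≤ t, (x s).length < L) ↔ ∀ s ≤ t, (y s).length < L :=
      forall₂_congr fun s hs => by rw [hxy s hs]
    simp only [hΦdef, this, hxy t le_rfl]
  have hstep : ∀ t x, 0 ≤ t → IsWalk d x →
      ∫⁻ y, Φ (t + 1) (Function.update x (t + 1) y) ∂(stepLaw lam (d (x t)) (x t)) ≤
        ENNReal.ofReal (1 - c / M) * Φ t x := by
    intro t x _ hx
    have hup : ∀ y, ∀ i ≤ t, Function.update x (t + 1) y i = x i := fun y i hi =>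
      Function.update_of_ne (by omega) _ _
    by_cases hs : ∀ s ≤ t, (x s).length < L
    swap
    · have h0 : ∀ y, Φ (t + 1) (Function.update x (t + 1) y) = 0 := by
        intro y
        rw [hΦdef]
        refine if_neg fun h => hs fun s hst => ?_
        have := h s (by omega)
        rwa [hup y s hst] at this
      simp [h0]
    have hxa := hle _ (hs t le_rfl)
    have hbpos : 1 ≤ b ^ (x t).length := one_le_pow₀ hb1
    have hΦt : Φ t x = ENNReal.ofReal (M - b ^ (x t).length) := by rw [hΦdef]; exact if_pos hs
    have hnext : ∀ y : Vertex, y.length ≤ L → Φ (t + 1) (Function.update x (t + 1) y) ≤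
        ENNReal.ofReal (M - b ^ y.length) := by
      intro y _
      simp only [hΦdef, Function.update_self]
      split_ifs
      · exact le_rfl
      · exact bot_le
    have hbig : ∀ k, k ≤ L → 0 ≤ M - b ^ k := fun k hk => by
      have : b ^ k ≤ a := pow_le_pow_right₀ hb1 hk
      linarith
    have hfin : ENNReal.ofReal (M - b ^ (x t).length - c) ≤
        ENNReal.ofReal (1 - c / M) * Φ t x := by
      rw [hΦt, ← ENNReal.ofReal_mul (by rw [sub_nonneg, div_le_one hMpos]; linarith)]
      refine ENNReal.ofReal_le_ofReal ?_
      have : c / M * (M - b ^ (x t).length) ≤ c := by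
        rw [div_mul_eq_mul_div, div_le_iff₀ hMpos]
        nlinarith
      linarith
    refine le_trans ?_ hfin
    have hn : (1 : ℝ) ≤ d (x t) := by exact_mod_cast hd (x t)
    cases hxt : x t with
    | nil =>
      have hL : 0 < L := by have := hs t le_rfl; rw [hxt] at this; exact this
      have hd0 : d [] ≠ 0 := by have := hd []; omega
      rw [lintegral_stepLaw_nil lam hd0]
      calc _ ≤ ∑ i ∈ Finset.range (d []), ENNReal.ofReal (1 / d []) *
            ENNReal.ofReal (M - b ^ 1) := by
            gcongr with i _
            exact hnext [i] hL
        _ = ENNReal.ofReal (M - b) := by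
            have hdpos : (0 : ℝ) < d [] := by exact_mod_cast Nat.pos_of_ne_zero hd0
            rw [Finset.sum_const, Finset.card_range, nsmul_eq_mul, ← mul_assoc,
              ← ENNReal.ofReal_natCast, ← ENNReal.ofReal_mul hdpos.le,
              mul_one_div_cancel hdpos.ne', ENNReal.ofReal_one, one_mul, pow_one]
        _ ≤ _ := by
            refine ENNReal.ofReal_le_ofReal ?_
            simp only [List.length_nil, pow_zero]
            linarith
    | cons j u =>
      rw [hxt] at hn
      have hlt : u.length + 1 < L := by
        have := hs t le_rfl; rw [hxt] at this; simpa using this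
      set n := d (j :: u)
      have hpos : (0 : ℝ) < lam + n := by positivity
      set B : ℝ := b ^ u.length with hB
      have hB1 : 1 ≤ B := one_le_pow₀ hb1
      rw [lintegral_stepLaw_cons]
      calc _ ≤ ENNReal.ofReal (lam / (lam + n)) * ENNReal.ofReal (M - B) +
            ∑ i ∈ Finset.range n, ENNReal.ofReal (1 / (lam + n)) *
              ENNReal.ofReal (M - b ^ (u.length + 2)) := by
            gcongr with i _
            · exact hnext u (by omega)
            · exact hnext (i :: j :: u) (by simp; omega)
        _ = ENNReal.ofReal (lam / (lam + n) * (M - B) +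
              n * (1 / (lam + n) * (M - b ^ (u.length + 2)))) := by
            have h1 := hbig u.length (by omega)
            have h2 := hbig (u.length + 2) (by omega)
            rw [ENNReal.ofReal_add (mul_nonneg (by positivity) h1)
              (mul_nonneg (by positivity) (mul_nonneg (by positivity) h2)),
              ENNReal.ofReal_mul (by positivity), ENNReal.ofReal_mul (by positivity),
              ENNReal.ofReal_mul (by positivity), Finset.sum_const, Finset.card_range,
              nsmul_eq_mul, ENNReal.ofReal_natCast]
        _ ≤ _ := by
            refine ENNReal.ofReal_le_ofReal ?_
            rw [List.length_cons, show b ^ (u.length + 2) = B * b ^ 2 from pow_add _ _ _,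
              show b ^ (u.length + 1) = B * b from pow_succ _ _]
            have e : lam / (lam + n) * (M - B) + n * (1 / (lam + n) * (M - B * b ^ 2)) =
                M - (lam + n * b ^ 2) / (lam + n) * B := by
              field_simp
              ring
            have hkey : b + c ≤ (lam + n * b ^ 2) / (lam + n) := by
              rw [le_div_iff₀ hpos, hb]
              nlinarith [mul_nonneg (sub_nonneg.2 hn) hlam.le, mul_nonneg hcpos.le hlam.le,
                mul_nonneg (mul_nonneg (sub_nonneg.2 hn) hlam.le) hlam.le,
                mul_nonneg (mul_nonneg (sub_nonneg.2 hn) hlam.le) hcpos.le]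
            rw [e]
            nlinarith [mul_le_mul_of_nonneg_right hkey (zero_le_one.trans hB1)]
  have hmain : ∀ t, quenched lam hlam d {x | ∀ t, (x t).length < L} * ENNReal.ofReal c ≤
      ENNReal.ofReal (1 - c / M) ^ t * ENNReal.ofReal M := by
    intro t
    have h1 := lintegral_le_geom hlam d hd (ENNReal.ofReal (1 - c / M)) 0 hΦ hstep t
    rw [zero_add] at h1
    have h0 : ∫⁻ x, Φ 0 x ∂(quenched lam hlam d) ≤ ENNReal.ofReal M := by
      calc _ ≤ ∫⁻ _x, ENNReal.ofReal M ∂(quenched lam hlam d) := by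
            refine lintegral_mono fun x => ?_
            simp only [hΦdef]
            split_ifs with h
            · refine ENNReal.ofReal_le_ofReal ?_
              have : 0 ≤ b ^ (x 0).length := by positivity
              linarith
            · exact bot_le
        _ = _ := by simp
    refine le_trans ?_ (h1.trans (by gcongr))
    have hmeas : MeasurableSet {x : ℕ → Vertex | ∀ s ≤ t, (x s).length < L} :=
      Adapted.measurableSet (t := t) fun x y hxy => by
        simp only [eq_iff_iff]
        exact forall₂_congr fun s hs => by rw [hxy s hs]
    calc _ ≤ quenched lam hlam d {x : ℕ → Vertex | ∀ s ≤ t, (x s).length < L} *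
          ENNReal.ofReal c := by
          exact mul_le_mul' (measure_mono fun x hx s _ => hx s) le_rfl
      _ = ∫⁻ x, ({x : ℕ → Vertex | ∀ s ≤ t, (x s).length < L}.indicator
            (fun _ => ENNReal.ofReal c)) x ∂(quenched lam hlam d) := by
          rw [lintegral_indicator_const hmeas, mul_comm]
      _ ≤ _ := by
          refine lintegral_mono fun x => ?_
          by_cases hs : ∀ s ≤ t, (x s).length < L
          · simp only [Set.indicator, Set.mem_ofPred_eq, hΦdef]
            rw [if_pos hs, if_pos hs]
            refine ENNReal.ofReal_le_ofReal ?_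
            have := hle _ (hs t le_rfl)
            linarith
          · simp only [Set.indicator, Set.mem_ofPred_eq]
            rw [if_neg hs]
            exact bot_le
  have hlim : Filter.Tendsto (fun t : ℕ => ENNReal.ofReal (1 - c / M) ^ t * ENNReal.ofReal M)
      Filter.atTop (nhds (0 * ENNReal.ofReal M)) := by
    refine ENNReal.Tendsto.mul_const (ENNReal.tendsto_pow_atTop_nhds_zero_of_lt_one ?_)
      (Or.inr ENNReal.ofReal_ne_top)
    rw [← ENNReal.ofReal_one, ENNReal.ofReal_lt_ofReal_iff zero_lt_one]
    have : 0 < c / M := by positivity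
    linarith
  rw [zero_mul] at hlim
  have h0 := le_antisymm (ge_of_tendsto' hlim hmain) bot_le
  rcases mul_eq_zero.1 h0 with h | h
  · exact h
  · rw [ENNReal.ofReal_eq_zero] at h
    exact absurd hcpos (not_lt.2 h)

lemma ae_unbounded (p : PMF ℕ) (hp0 : p 0 = 0) {lam : ℝ} (hlam : 0 < lam) :
    ∀ᵐ x ∂(pathLaw p lam hlam), ∀ L, ∃ t, L ≤ (x t).length := by
  rw [ae_all_iff]
  intro L
  have hm : MeasurableSet {x : ℕ → Vertex | ∀ t, (x t).length < L} := by
    have : {x : ℕ → Vertex | ∀ t, (x t).length < L} =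
        ⋂ t, {x : ℕ → Vertex | (x t).length < L} := by ext x; simp
    rw [this]
    exact MeasurableSet.iInter fun t => Adapted.measurableSet (t := t) fun x y h => by
      simp only [h t le_rfl]
  have h0 : pathLaw p lam hlam {x | ∀ t, (x t).length < L} = 0 := by
    rw [pathLaw_apply p hlam hm, lintegral_eq_zero_iff
      (f := fun d => quenched lam hlam d {x | ∀ t, (x t).length < L})
      ((Measure.measurable_coe hm).comp (measurable_quenched lam hlam))]
    filter_upwards [ae_pos p hp0] with d hd using quenched_bounded_eq_zero hlam hd L
  rw [ae_iff]
  refine measure_mono_null (fun x hx => ?_) h0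
  simpa using hx

/-! ### Regeneration times -/

lemma regenTime_succ_eq {x : ℕ → Vertex} {i s : ℕ} (hs : regenTime x i = s)
    (h : ∃ t, s < t ∧ IsRegenerationTime x t) :
    ∃ t : ℕ, regenTime x (i + 1) = t ∧ s < t ∧ IsRegenerationTime x t ∧
      ∀ r, s < r → r < t → ¬ IsRegenerationTime x r := by
  classical
  have hmin : ∀ r, s < r → r < Nat.find h → ¬ IsRegenerationTime x r := fun r h1 h2 h3 =>
    Nat.find_min h h2 ⟨h1, h3⟩
  obtain ⟨h1, h2⟩ := Nat.find_spec h
  refine ⟨Nat.find h, ?_, h1, h2, hmin⟩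
  rw [regenTime]
  refine le_antisymm (iInf_le_of_le ⟨Nat.find h, by rw [hs]; exact_mod_cast h1, h2⟩ le_rfl)
    (le_iInf ?_)
  rintro ⟨r, h3, h4⟩
  rw [hs] at h3
  have h3 : s < r := by exact_mod_cast h3
  by_contra hlt
  rw [not_le] at hlt
  exact hmin r h3 (by exact_mod_cast hlt) h4

/-- `t` is a positive record time of the path, and no earlier positive record time is still a
candidate for being a regeneration time. -/
def FirstCandidate (t : ℕ) (x : ℕ → Vertex) : Prop :=
  0 < t ∧ (∀ s < t, (x s).length < (x t).length) ∧
    ∀ s < t, 0 < s → (∀ r < s, (x r).length < (x s).length) →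
      ∃ u ≤ t, s ≤ u ∧ (x u).length < (x s).length

lemma fresh_firstCandidate (t : ℕ) : Fresh t (FirstCandidate t) where
  adapted := fun x y h => by
    have h1 : (∀ s < t, (x s).length < (x t).length) ↔ ∀ s < t, (y s).length < (y t).length :=
      forall₂_congr fun s hs => by rw [h s hs.le, h t le_rfl]
    have h2 : (∀ s < t, 0 < s → (∀ r < s, (x r).length < (x s).length) →
          ∃ u ≤ t, s ≤ u ∧ (x u).length < (x s).length) ↔
        ∀ s < t, 0 < s → (∀ r < s, (y r).length < (y s).length) →
          ∃ u ≤ t, s ≤ u ∧ (y u).length < (y s).length := by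
      refine forall₂_congr fun s hs => imp_congr_right fun _ => imp_congr ?_ ?_
      · exact forall₂_congr fun r hr => by rw [h r (by omega), h s hs.le]
      · exact exists_congr fun u => and_congr_right fun hu => by rw [h u hu, h s hs.le]
    simp only [FirstCandidate, h1, h2]
  ne_nil := fun x hx h0 => by
    have := hx.2.1 0 hx.1
    rw [h0] at this
    simp at this
  fresh := fun x hx i hi h => by
    have := hx.2.1 i hi
    have := h.length_le
    omega

lemma IsPath.rel_mem_dead_compl_iff {x : ℕ → Vertex} (h : IsPath x) (t : ℕ) :
    rel t x ∈ deadᶜ ↔ ∀ u ≥ t, (x t).length ≤ (x u).length := by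
  constructor
  · intro h1 u hu
    exact (h.rel_ne_nil_iff t (u - t)).1 (ne_nil_of_mem_dead_compl h1 _) u hu (by omega)
  · rintro h1 ⟨n, hn⟩
    exact (h.rel_ne_nil_iff t n).2 (fun i hi _ => h1 i hi) hn

/-- Splits the first regeneration into an event of the past and the survival of the fresh walk. An
earlier record that is undercut must be undercut by time `t`, since after a regeneration at `t` the
walk stays above all earlier levels. -/
lemma IsPath.firstCandidate_and_iff {x : ℕ → Vertex} (h : IsPath x) (t : ℕ) :
    FirstCandidate t x ∧ rel t x ∈ deadᶜ ↔ 0 < t ∧ IsRegenerationTime x t ∧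
      ∀ s, 0 < s → s < t → ¬ IsRegenerationTime x s := by
  rw [h.rel_mem_dead_compl_iff]
  constructor
  · rintro ⟨⟨h0, h1, h2⟩, h3⟩
    refine ⟨h0, ⟨h1, h3⟩, fun s hs0 hst hs => ?_⟩
    obtain ⟨u, -, hsu, hu⟩ := h2 s hst hs0 hs.1
    exact absurd (hs.2 u hsu) (not_le.2 hu)
  · rintro ⟨h0, ⟨h1, h2⟩, h3⟩
    refine ⟨⟨h0, h1, fun s hst hs0 hs => ?_⟩, h2⟩
    by_contra hno
    refine h3 s hs0 hst ⟨hs, fun u hu => ?_⟩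
    by_contra hlt
    rw [not_le] at hlt
    rcases le_or_gt u t with hut | hut
    · exact hno ⟨u, hut, hu, hlt⟩
    · have := h2 u hut.le
      have := h1 s hst
      omega

/-- After a regeneration at `t`, records of the relative path are records of the whole path: before
time `t` all levels were strictly lower. -/
lemma IsPath.rel_mem_lateRegen {x : ℕ → Vertex} (h : IsPath x) {t n : ℕ}
    (ht : IsRegenerationTime x t) (hn : ∀ s, t < s → s ≤ t + n → ¬ IsRegenerationTime x s) :
    rel t x ∈ lateRegen n := by
  have hd := (h.rel_mem_dead_compl_iff t).2 ht.2
  refine ⟨hd, fun s hs1 hsn hs => hn (t + s) (by omega) (by omega) ⟨fun r hr => ?_, fun u hu => ?_⟩⟩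
  · have e := length_rel (ne_nil_of_mem_dead_compl hd s)
    rcases lt_or_ge r t with hrt | hrt
    · have h1 := ht.1 r hrt
      have h2 := ht.2 (t + s) (by omega)
      omega
    · have e' := length_rel (ne_nil_of_mem_dead_compl hd (r - t))
      rw [show t + (r - t) = r by omega] at e'
      have := hs.1 (r - t) (by omega)
      omega
  · have e := length_rel (ne_nil_of_mem_dead_compl hd s)
    have e' := length_rel (ne_nil_of_mem_dead_compl hd (u - t))
    rw [show t + (u - t) = u by omega] at e'
    have := hs.2 (u - t) (by omega)
    omega

/-- The gap after the first regeneration time exceeds `n`. -/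
def longGap (n : ℕ) : Set (ℕ → Vertex) := {x | ∃ t, FirstCandidate t x ∧ rel t x ∈ lateRegen n}

lemma measurableSet_longGap (n : ℕ) : MeasurableSet (longGap n) := by
  have : longGap n = ⋃ t, {x | FirstCandidate t x} ∩ rel t ⁻¹' lateRegen n := by
    ext x; simp [longGap]
  rw [this]
  exact MeasurableSet.iUnion fun t => (fresh_firstCandidate t).adapted.measurableSet.inter
    (measurable_rel t (measurableSet_lateRegen n))

/-- Each candidate succeeds with probability `freshLaw deadᶜ` given its past, and at most one can
succeed. So the expected number of candidates is at most the inverse of this probability, and each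
of them is followed by a late regeneration with probability `freshLaw (lateRegen n)`. -/
lemma pathLaw_longGap_le (p : PMF ℕ) (hp0 : p 0 = 0) {lam : ℝ} (hlam : 0 < lam)
    (n : ℕ) :
    pathLaw p lam hlam (longGap n) ≤
      (freshLaw p lam hlam deadᶜ)⁻¹ * freshLaw p lam hlam (lateRegen n) := by
  have hsum : (∑' t, pathLaw p lam hlam {x | FirstCandidate t x}) * freshLaw p lam hlam deadᶜ ≤
      1 := by
    rw [← ENNReal.tsum_mul_right]
    calc _ = ∑' t, pathLaw p lam hlam {x | FirstCandidate t x ∧ rel t x ∈ deadᶜ} :=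
          tsum_congr fun t =>
            (pathLaw_fresh p hp0 hlam (fresh_firstCandidate t) measurableSet_dead.compl).symm
      _ ≤ pathLaw p lam hlam Set.univ := by
          refine tsum_measure_le_measure_univ (fun t => MeasurableSet.nullMeasurableSet ?_) ?_
          · exact (fresh_firstCandidate t).adapted.measurableSet.inter
              (measurable_rel t measurableSet_dead.compl)
          · intro s t hst
            have h1 := ae_isPath p hp0 hlam
            rw [ae_iff] at h1
            refine measure_mono_null (t := {x | ¬ IsPath x}) (fun x hx => ?_) h1
            refine fun hp : IsPath x => hst ?_
            obtain ⟨hs0, hs, hs'⟩ := (hp.firstCandidate_and_iff s).1 hx.1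
            obtain ⟨ht0, ht, ht'⟩ := (hp.firstCandidate_and_iff t).1 hx.2
            rcases lt_trichotomy s t with h | h | h
            · exact absurd hs (ht' s hs0 h)
            · exact h
            · exact absurd ht (hs' t ht0 h)
      _ = 1 := measure_univ
  have h1 : longGap n = ⋃ t, {x | FirstCandidate t x ∧ rel t x ∈ lateRegen n} := by
    ext x; simp [longGap]
  calc _ ≤ ∑' t, pathLaw p lam hlam {x | FirstCandidate t x ∧ rel t x ∈ lateRegen n} := by
        rw [h1]; exact measure_iUnion_le _
    _ = (∑' t, pathLaw p lam hlam {x | FirstCandidate t x}) *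
          freshLaw p lam hlam (lateRegen n) := by
        rw [← ENNReal.tsum_mul_right]
        exact tsum_congr fun t =>
          pathLaw_fresh p hp0 hlam (fresh_firstCandidate t) (measurableSet_lateRegen n)
    _ ≤ _ := by
        gcongr
        rwa [ENNReal.le_inv_iff_mul_le]

/-! ### Tail of the first gap -/

lemma pathLaw_slow_le (p : PMF ℕ) (hp0 : p 0 = 0) {lam : ℝ} (hlam : 0 < lam) :
    ∃ C : ℝ, 1 ≤ C ∧ ∀ N n, pathLaw p lam hlam {x | Slow N (1 + n) x} ≤
      ENNReal.ofReal (1 - 1 / (C * (N + 1) ^ 3)) ^ n * ENNReal.ofReal (C * (N + 1) ^ 3) := by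
  obtain ⟨C, hC, h⟩ := exists_quenched_slow_le hlam
  refine ⟨C, hC, fun N n => ?_⟩
  rw [pathLaw_apply p hlam (adapted_slow N (1 + n)).measurableSet]
  calc _ ≤ ∫⁻ _d, ENNReal.ofReal (1 - 1 / (C * (N + 1) ^ 3)) ^ n *
        ENNReal.ofReal (C * (N + 1) ^ 3) ∂gw p := by
        refine lintegral_mono_ae ?_
        filter_upwards [ae_pos p hp0] with d hd using h d hd N n
    _ = _ := by simp

/-- Stretched-exponential form of the bound of `pathLaw_slow_le`. -/
lemma exists_pathLaw_slow_pow_le (p : PMF ℕ) (hp0 : p 0 = 0) {lam : ℝ} (hlam : 0 < lam) :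
    ∃ C κ : ℝ≥0, κ < 1 ∧ ∀ h : ℕ, 2 ≤ h →
      pathLaw p lam hlam {x | Slow ((h + 1) * h * h) (1 + h ^ 10) x} ≤
        (C * h ^ 9 * κ ^ h : ℝ≥0) := by
  obtain ⟨C, hC, hslow⟩ := pathLaw_slow_le p hp0 hlam
  refine ⟨(8 * C).toNNReal, (Real.exp (-(1 / (8 * C)))).toNNReal, ?_, fun h hh => ?_⟩
  · rw [← Real.toNNReal_one, Real.toNNReal_lt_toNNReal_iff zero_lt_one, Real.exp_lt_one_iff]
    have : 0 < 1 / (8 * C) := by positivity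
    linarith
  refine (hslow ((h + 1) * h * h) (h ^ 10)).trans ?_
  have hh' : (2 : ℝ) ≤ h := by exact_mod_cast hh
  have hh0 : (0 : ℝ) < h := by linarith
  set N : ℝ := (((h + 1) * h * h : ℕ) : ℝ) with hN
  have hN1 : N + 1 ≤ 2 * (h : ℝ) ^ 3 := by
    rw [hN]; push_cast; nlinarith [mul_nonneg (sub_nonneg.2 hh') (sq_nonneg (h : ℝ))]
  have hM : C * (N + 1) ^ 3 ≤ 8 * C * (h : ℝ) ^ 9 := by
    have : (N + 1) ^ 3 ≤ (2 * (h : ℝ) ^ 3) ^ 3 := by gcongr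
    nlinarith
  have hM0 : 0 < C * (N + 1) ^ 3 := by positivity
  have h1 : 1 - 1 / (C * (N + 1) ^ 3) ≤ Real.exp (-(1 / (8 * C * (h : ℝ) ^ 9))) := by
    have h2 := Real.add_one_le_exp (-(1 / (8 * C * (h : ℝ) ^ 9)))
    have h3 := one_div_le_one_div_of_le hM0 hM
    linarith
  -- The exponent 10 is chosen here: the relaxation time is of order `h ^ 9`, and one more power of
  -- `h` gives decay exponential in `h`.
  have h2 : Real.exp (-(1 / (8 * C * (h : ℝ) ^ 9))) ^ (h ^ 10) =
      Real.exp (-(1 / (8 * C))) ^ h := by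
    rw [← Real.exp_nat_mul, ← Real.exp_nat_mul]
    congr 1
    push_cast
    field_simp
  calc _ ≤ ENNReal.ofReal (Real.exp (-(1 / (8 * C * (h : ℝ) ^ 9)))) ^ (h ^ 10) *
        ENNReal.ofReal (8 * C * (h : ℝ) ^ 9) := by gcongr
    _ = ENNReal.ofReal (Real.exp (-(1 / (8 * C)))) ^ h * ENNReal.ofReal (8 * C * (h : ℝ) ^ 9) := by
        rw [← ENNReal.ofReal_pow (Real.exp_pos _).le, h2, ENNReal.ofReal_pow (Real.exp_pos _).le]
    _ = _ := by
        rw [ENNReal.ofReal_mul (by positivity), ENNReal.ofReal_pow hh0.le, ENNReal.ofReal_natCast]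
        push_cast
        rw [mul_comm]
        rfl

lemma freshLaw_dead_lt_one (p : PMF ℕ) {lam : ℝ} (hlam : 0 < lam)
    (h0 : freshLaw p lam hlam deadᶜ ≠ 0) : freshLaw p lam hlam dead < 1 := by
  refine lt_of_le_of_ne prob_le_one fun h => h0 ?_
  rw [prob_compl_eq_one_sub measurableSet_dead, h, tsub_self]

/-- With the number of checkpoints, their spacing and the allowed vertices per level all equal to
`h`, every error term is geometric in `h` up to a polynomial; the factor `h ^ 9` from the slow walk
dominates. -/
lemma exists_freshLaw_lateRegen_le (p : PMF ℕ) (hp0 : p 0 = 0) {lam : ℝ} (hlam : 0 < lam)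
    (h0 : freshLaw p lam hlam deadᶜ ≠ 0)
    (hR : ∃ C κ : ℝ≥0, κ < 1 ∧ ∀ n,
      pathLaw p lam hlam {x | ∃ t, ReachReturn (n + 1) t x} ≤ (C * κ ^ n : ℝ≥0)) :
    ∃ D κ : ℝ≥0, κ < 1 ∧ ∀ h : ℕ, 2 ≤ h →
      freshLaw p lam hlam (lateRegen (h ^ 10)) ≤ (D * h ^ 9 * κ ^ h : ℝ≥0) := by
  obtain ⟨C₁, κ₁, hκ₁, h₁⟩ := hR
  obtain ⟨C₂, κ₂, hκ₂, h₂⟩ := exists_pathLaw_slow_pow_le p hp0 hlam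
  obtain ⟨δ, hδ⟩ : ∃ δ : ℝ≥0, (δ : ℝ≥0∞) = freshLaw p lam hlam dead :=
    ⟨_, ENNReal.coe_toNNReal (freshLaw_dead_lt_one p hlam h0).ne_top⟩
  have hδ1 : δ < 1 := by
    have := freshLaw_dead_lt_one p hlam h0
    rw [← hδ] at this
    exact_mod_cast this
  refine ⟨2 + C₂ + (C₁ + 1), max δ (max κ₁ κ₂), max_lt hδ1 (max_lt hκ₁ hκ₂), fun h hh => ?_⟩
  set κ := max δ (max κ₁ κ₂) with hκ
  have e1 : δ ≤ κ := le_max_left _ _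
  have e2 : κ₁ ≤ κ := (le_max_left _ _).trans (le_max_right _ _)
  have e3 : κ₂ ≤ κ := (le_max_right _ _).trans (le_max_right _ _)
  have hh1 : (1 : ℝ≥0) ≤ h := by exact_mod_cast (by omega : 1 ≤ h)
  refine (freshLaw_lateRegen_le p hp0 hlam hh (h ^ 10)).trans ?_
  calc _ ≤ ((h + 1) * h : ℕ) * (δ : ℝ≥0∞) ^ h + (C₂ * h ^ 9 * κ₂ ^ h : ℝ≥0) +
        (h * (C₁ * κ₁ ^ h : ℝ≥0) + (δ : ℝ≥0∞) ^ h) := by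
        rw [← hδ]
        gcongr
        · exact h₂ h hh
        · exact h₁ h
    _ = (((h + 1) * h * δ ^ h + C₂ * h ^ 9 * κ₂ ^ h +
          (h * (C₁ * κ₁ ^ h) + δ ^ h) : ℝ≥0) : ℝ≥0∞) := by push_cast; rfl
    _ ≤ _ := by
        rw [ENNReal.coe_le_coe]
        have hp : ((h : ℝ≥0) + 1) * h ≤ 2 * h ^ 9 := by
          calc ((h : ℝ≥0) + 1) * h ≤ (h + h) * h := by gcongr
            _ = 2 * h ^ 2 := by ring
            _ ≤ 2 * h ^ 9 := by gcongr 2 * ?_; exact pow_le_pow_right₀ hh1 (by norm_num)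
        have hp1 : (h : ℝ≥0) ≤ h ^ 9 := le_self_pow₀ hh1 (by norm_num)
        have hp2 : (1 : ℝ≥0) ≤ h ^ 9 := one_le_pow₀ hh1
        calc _ ≤ 2 * (h : ℝ≥0) ^ 9 * κ ^ h + C₂ * h ^ 9 * κ ^ h +
              (h ^ 9 * (C₁ * κ ^ h) + h ^ 9 * κ ^ h) := by
              gcongr
              calc δ ^ h ≤ κ ^ h := by gcongr
                _ = 1 * κ ^ h := (one_mul _).symm
                _ ≤ _ := by gcongr
          _ = _ := by ring

/-! ### Infinitely many regeneration times -/

/-- The walk is unbounded, so it passes arbitrarily many checkpoints above level `b`. A regeneration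
there comes after time `b`, because the level never exceeds the time. The failure probability tends
to 0 as number and spacing of the checkpoints grow. -/
lemma ae_exists_isRegenerationTime (p : PMF ℕ) (hp0 : p 0 = 0) {lam : ℝ} (hlam : 0 < lam)
    (h0 : freshLaw p lam hlam deadᶜ ≠ 0)
    (hR : ∃ C κ : ℝ≥0, κ < 1 ∧ ∀ n,
      pathLaw p lam hlam {x | ∃ t, ReachReturn (n + 1) t x} ≤ (C * κ ^ n : ℝ≥0)) :
    ∀ᵐ x ∂(pathLaw p lam hlam), ∀ b, ∃ t, b < t ∧ IsRegenerationTime x t := by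
  obtain ⟨C, κ, hκ, hC⟩ := hR
  have hδ := freshLaw_dead_lt_one p hlam h0
  rw [ae_all_iff]
  intro b
  set E : Set (ℕ → Vertex) := {x | ¬ ∃ t, b < t ∧ IsRegenerationTime x t} with hE
  have hle : ∀ h : ℕ, pathLaw p lam hlam E ≤
      (((h + 1 : ℕ) : ℝ≥0) * (C * κ ^ (h + 1)) : ℝ≥0) + freshLaw p lam hlam dead ^ (h + 1) := by
    intro h
    have h1 := pathLaw_no_regeneration_le p hp0 hlam b (h := h + 1) (by omega) (h + 1)
    refine le_trans (measure_mono_ae ?_) (h1.trans ?_)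
    · filter_upwards [ae_isPath p hp0 hlam, ae_unbounded p hp0 hlam] with x hx hu hxE
      obtain ⟨s, hs⟩ := hu (b + (h + 1 + 1) * (h + 1))
      obtain ⟨T, hTs, hT⟩ := hx.exists_levelHit (t := s) hs
      refine ⟨T, hT.1, ?_⟩
      rintro t - ⟨i, hi1, -, hi⟩ hreg
      refine hxE ⟨t, ?_, hreg⟩
      have := hx.length_le t
      have : 1 ≤ i * (h + 1) := Nat.mul_pos hi1 (by omega)
      omega
    · push_cast
      gcongr
      have := hC (h + 1)
      push_cast at this
      exact this
  have hlim : Filter.Tendsto (fun h : ℕ =>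
      ((((h + 1 : ℕ) : ℝ≥0) * (C * κ ^ (h + 1)) : ℝ≥0) : ℝ≥0∞) +
        freshLaw p lam hlam dead ^ (h + 1)) Filter.atTop (nhds (0 + 0)) := by
    refine Filter.Tendsto.add ?_ ?_
    · rw [← ENNReal.coe_zero, ENNReal.tendsto_coe]
      have h1 : Filter.Tendsto (fun n : ℕ => (n : ℝ) * (κ : ℝ) ^ n) Filter.atTop (nhds 0) :=
        tendsto_self_mul_const_pow_of_lt_one κ.2 (by exact_mod_cast hκ)
      have h2 : Filter.Tendsto (fun n : ℕ => (C : ℝ) * ((n : ℝ) * (κ : ℝ) ^ n)) Filter.atTop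
          (nhds 0) := by simpa using h1.const_mul (C : ℝ)
      rw [← NNReal.tendsto_coe]
      refine ((Filter.tendsto_add_atTop_iff_nat 1).2 h2).congr fun n => ?_
      push_cast
      ring
    · exact (Filter.tendsto_add_atTop_iff_nat 1).2
        (ENNReal.tendsto_pow_atTop_nhds_zero_of_lt_one hδ)
  rw [add_zero] at hlim
  exact le_antisymm (ge_of_tendsto' hlim hle) bot_le

/-! ### Moments of the gap -/

/-- A tail bound along the thresholds `N j` is enough: if `N (j + 1)` is the first threshold not
below `f x`, then `x` lies in `G j` and `f x ^ k` is at most `N (j + 1) ^ k`. -/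
lemma lintegral_pow_le_tsum {α : Type*} [MeasurableSpace α] (μ : Measure α)
    [IsProbabilityMeasure μ] (f : α → ℝ≥0∞) (N : ℕ → ℕ) (hN : ∀ n, ∃ j, n ≤ N j)
    (G : ℕ → Set α) (hG : ∀ j, MeasurableSet (G j))
    (hf : ∀ᵐ x ∂μ, ∃ n : ℕ, f x = n ∧ ∀ j, N j < n → x ∈ G j) (k : ℕ) :
    ∫⁻ x, f x ^ k ∂μ ≤ (N 0 : ℝ≥0∞) ^ k + ∑' j, (N (j + 1) : ℝ≥0∞) ^ k * μ (G j) := by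
  classical
  calc _ ≤ ∫⁻ x, ((N 0 : ℝ≥0∞) ^ k +
        ∑' j, (G j).indicator (fun _ => (N (j + 1) : ℝ≥0∞) ^ k) x) ∂μ := by
        refine lintegral_mono_ae ?_
        filter_upwards [hf] with x ⟨n, hn, hx⟩
        rw [hn]
        have hex := hN n
        cases hj : Nat.find hex with
        | zero =>
          have h1 := Nat.find_spec hex
          rw [hj] at h1
          refine le_add_right ?_
          gcongr
        | succ j =>
          have h1 := Nat.find_spec hex
          rw [hj] at h1
          have h2 := hx j (not_le.1 (Nat.find_min hex (by omega : j < Nat.find hex)))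
          refine le_add_left (le_trans ?_ (ENNReal.le_tsum j))
          rw [Set.indicator_of_mem h2]
          gcongr
    _ = _ := by
        rw [lintegral_add_left measurable_const, lintegral_const, measure_univ, mul_one,
          lintegral_tsum fun j => (measurable_const.indicator (hG j)).aemeasurable]
        simp_rw [lintegral_indicator_const (hG _)]

lemma tsum_pow_mul_geometric_lt_top (a b k : ℕ) (D κ : ℝ≥0) (hκ : κ < 1) :
    ∑' j : ℕ, (((j + 2 + 1) ^ a : ℕ) : ℝ≥0∞) ^ k *
      (D * ((j + 2 : ℕ) : ℝ≥0) ^ b * κ ^ (j + 2) : ℝ≥0) < ⊤ := by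
  have hs : Summable fun n : ℕ => (n : ℝ≥0) ^ (a * k + b) * κ ^ n := by
    rw [← NNReal.summable_coe]
    have := summable_pow_mul_geometric_of_norm_lt_one (R := ℝ) (a * k + b)
      (r := (κ : ℝ)) (by rw [Real.norm_of_nonneg κ.coe_nonneg]; exact_mod_cast hκ)
    refine this.congr fun n => ?_
    rw [NNReal.coe_mul, NNReal.coe_pow, NNReal.coe_pow, NNReal.coe_natCast]
  set f : ℕ → ℝ≥0 := fun n => (n : ℝ≥0) ^ (a * k + b) * κ ^ n with hf
  have hs2 : ∑' j : ℕ, ((f (j + 2) : ℝ≥0) : ℝ≥0∞) ≠ ⊤ :=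
    ENNReal.tsum_coe_ne_top_iff_summable.2 (NNReal.summable_nat_add f hs 2)
  have hbound : ∀ n : ℕ, 2 ≤ n → (((n + 1) ^ a : ℕ) : ℝ≥0∞) ^ k *
      (D * (n : ℝ≥0) ^ b * κ ^ n : ℝ≥0) ≤ (2 ^ (a * k) * D : ℝ≥0) * (f n : ℝ≥0∞) := by
    intro n hn
    have h1 : (((n + 1) ^ a : ℕ) : ℝ≥0) ≤ (2 * (n : ℝ≥0)) ^ a := by
      have : (n + 1) ^ a ≤ (2 * n) ^ a := Nat.pow_le_pow_left (by omega) a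
      exact_mod_cast this
    rw [← ENNReal.coe_natCast, ← ENNReal.coe_pow, ← ENNReal.coe_mul, ← ENNReal.coe_mul,
      ENNReal.coe_le_coe, hf]
    calc _ ≤ ((2 * (n : ℝ≥0)) ^ a) ^ k * (D * (n : ℝ≥0) ^ b * κ ^ n) :=
          mul_le_mul' (pow_le_pow_left₀ zero_le h1 k) le_rfl
      _ = _ := by
          simp only [← pow_mul, mul_pow, pow_add _ (a * k) b]
          ac_rfl
  refine lt_of_le_of_lt (ENNReal.tsum_le_tsum fun j => hbound (j + 2) (by omega)) ?_
  rw [ENNReal.tsum_mul_left]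
  exact ENNReal.mul_lt_top ENNReal.coe_lt_top hs2.lt_top

/-- The probabilistic conclusion, isolated from the tree estimates: it only needs that a fresh walk
survives with positive probability and that returns from high levels are exponentially unlikely. -/
theorem regenTime_moments (p : PMF ℕ) (hp0 : p 0 = 0) {lam : ℝ} (hlam : 0 < lam)
    (h0 : freshLaw p lam hlam deadᶜ ≠ 0)
    (hR : ∃ C κ : ℝ≥0, κ < 1 ∧ ∀ n,
      pathLaw p lam hlam {x | ∃ t, ReachReturn (n + 1) t x} ≤ (C * κ ^ n : ℝ≥0)) :
    (∀ᵐ x ∂(pathLaw p lam hlam), regenTime x 2 < ⊤) ∧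
      ∀ k : ℕ, ∫⁻ ω, (((regenTime ω.2 2 - regenTime ω.2 1 : ℕ∞)) : ℝ≥0∞) ^ k
        ∂(annealed p lam hlam) < ⊤ := by
  have hmain : ∀ᵐ x ∂(pathLaw p lam hlam), ∃ t₁ t₂ : ℕ, regenTime x 1 = t₁ ∧
      regenTime x 2 = t₂ ∧ ∀ n, n < t₂ - t₁ → x ∈ longGap n := by
    filter_upwards [ae_isPath p hp0 hlam, ae_exists_isRegenerationTime p hp0 hlam h0 hR]
      with x hx hinf
    obtain ⟨t₁, e₁, h₁, r₁, m₁⟩ := regenTime_succ_eq (x := x) (i := 0) (s := 0) rfl (hinf 0)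
    obtain ⟨t₂, e₂, h₂, r₂, m₂⟩ := regenTime_succ_eq e₁ (hinf t₁)
    refine ⟨t₁, t₂, e₁, e₂, fun n hn => ⟨t₁, ?_, ?_⟩⟩
    · exact ((hx.firstCandidate_and_iff t₁).2 ⟨h₁, r₁, m₁⟩).1
    · exact hx.rel_mem_lateRegen r₁ fun s hs1 hs2 => m₂ s hs1 (by omega)
  refine ⟨?_, fun k => ?_⟩
  · filter_upwards [hmain] with x hx
    obtain ⟨t₁, t₂, -, e, -⟩ := hx
    rw [e]
    exact ENat.natCast_lt_top t₂
  obtain ⟨D, κ, hκ, hD⟩ := exists_freshLaw_lateRegen_le p hp0 hlam h0 hR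
  set γ := freshLaw p lam hlam deadᶜ
  have hae : ∀ᵐ ω ∂(annealed p lam hlam), ∃ n : ℕ,
      ((regenTime ω.2 2 - regenTime ω.2 1 : ℕ∞) : ℝ≥0∞) = n ∧
        ∀ j, (j + 2) ^ 10 < n → ω ∈ Prod.snd ⁻¹' longGap ((j + 2) ^ 10) := by
    filter_upwards [ae_of_ae_map measurable_snd.aemeasurable hmain] with ω hω
    obtain ⟨t₁, t₂, e₁, e₂, h⟩ := hω
    refine ⟨t₂ - t₁, ?_, fun j hj => h _ hj⟩
    rw [e₁, e₂]
    norm_cast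
  have : IsProbabilityMeasure (annealed p lam hlam) := by unfold annealed; infer_instance
  -- The thresholds start at `2 ^ 10` since the tail bound requires `2 ≤ h`.
  refine lt_of_le_of_lt (lintegral_pow_le_tsum _ _ (fun j => (j + 2) ^ 10)
    (fun n => ⟨n, (by omega : n ≤ n + 2).trans (Nat.le_self_pow (by norm_num) _)⟩) _
    (fun j => measurable_snd (measurableSet_longGap _)) hae k)
    (ENNReal.add_lt_top.2 ⟨by finiteness, ?_⟩)
  calc _ ≤ ∑' j : ℕ, γ⁻¹ * ((((j + 2 + 1) ^ 10 : ℕ) : ℝ≥0∞) ^ k *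
        (D * ((j + 2 : ℕ) : ℝ≥0) ^ 9 * κ ^ (j + 2) : ℝ≥0)) := by
        refine ENNReal.tsum_le_tsum fun j => ?_
        rw [← Measure.map_apply measurable_snd (measurableSet_longGap _), mul_left_comm,
          show j + 1 + 2 = j + 2 + 1 by omega]
        gcongr
        refine (pathLaw_longGap_le p hp0 hlam _).trans ?_
        gcongr
        exact hD (j + 2) (by omega)
    _ < ⊤ := by
        rw [ENNReal.tsum_mul_left]
        exact ENNReal.mul_lt_top (ENNReal.inv_lt_top.2 (pos_iff_ne_zero.2 h0))
          (tsum_pow_mul_geometric_lt_top 10 9 k D κ hκ)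

/-! ### Moments of the offspring distribution -/

/-- The exponential moment enters the proof only through this second moment: `k ^ 2 / β ^ k` is
bounded. -/
lemma tsum_sq_mul_ne_top (p : PMF ℕ) {β : ℝ} (hβ : 1 < β)
    (h : ∑' k : ℕ, ENNReal.ofReal β ^ k * p k < ⊤) :
    ∑' k : ℕ, (k : ℝ≥0∞) ^ 2 * p k ≠ ⊤ := by
  have hβ0 : 0 < β := by linarith
  have hlim := tendsto_pow_const_mul_const_pow_of_abs_lt_one 2 (r := β⁻¹)
    (by rw [abs_of_pos (inv_pos.2 hβ0)]; exact inv_lt_one_of_one_lt₀ hβ)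
  obtain ⟨C, hC⟩ := hlim.bddAbove_range
  have hk : ∀ k : ℕ, (k : ℝ≥0∞) ^ 2 ≤ ENNReal.ofReal C * ENNReal.ofReal β ^ k := by
    intro k
    have h1 : (k : ℝ) ^ 2 * β⁻¹ ^ k ≤ C := hC ⟨k, rfl⟩
    have hp : 0 < β ^ k := pow_pos hβ0 k
    have h2 : (k : ℝ) ^ 2 ≤ C * β ^ k := by
      rwa [inv_pow, ← div_eq_mul_inv, div_le_iff₀ hp] at h1
    rw [← ENNReal.ofReal_pow hβ0.le, ← ENNReal.ofReal_mul' hp.le, ← ENNReal.ofReal_natCast,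
      ← ENNReal.ofReal_pow (Nat.cast_nonneg k)]
    exact ENNReal.ofReal_le_ofReal h2
  refine ne_top_of_le_ne_top (ENNReal.mul_lt_top (ENNReal.ofReal_lt_top (r := C)) h).ne ?_
  rw [← ENNReal.tsum_mul_left]
  refine ENNReal.tsum_le_tsum fun k => ?_
  rw [← mul_assoc]
  gcongr
  exact hk k

end GWWalk

end

/-! ### The theorem -/

theorem proposition3 (p : PMF ℕ) (hp0 : p 0 = 0) (hm : 1 < GWWalk.offspringMean p)
    (hexp : ∃ β : ℝ, 1 < β ∧ ∑' k : ℕ, ENNReal.ofReal β ^ k * p k < ⊤)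
    (lam : ℝ) (hlam : 0 < lam) (hlt : ENNReal.ofReal lam < GWWalk.offspringMean p) :
    (∀ᵐ ω ∂(GWWalk.annealed p lam hlam), GWWalk.regenTime ω.2 2 < ⊤) ∧
      ∀ k : ℕ, ∫⁻ ω, (((GWWalk.regenTime ω.2 2 - GWWalk.regenTime ω.2 1 : ℕ∞)) : ℝ≥0∞) ^ k
        ∂(GWWalk.annealed p lam hlam) < ⊤ := by
  obtain ⟨β, hβ, hexp⟩ := hexp
  have hsq := GWWalk.tsum_sq_mul_ne_top p hβ hexp
  have hD : ∫⁻ d, (d [] : ENNReal) ^ 2 ∂(GWWalk.gw p) ≠ ⊤ := by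
    rw [GWWalk.lintegral_root p fun k => (k : ENNReal) ^ 2]
    exact hsq
  have hfin : GWWalk.offspringMean p ≠ ⊤ := by
    refine ne_top_of_le_ne_top hsq (ENNReal.tsum_le_tsum fun k => ?_)
    gcongr
    exact_mod_cast Nat.le_self_pow two_ne_zero k
  have hmean := (ENNReal.coe_toNNReal hfin).symm
  rw [hmean] at hm hlt
  have hm' := ENNReal.one_lt_coe_iff.1 hm
  have hcm := ENNReal.coe_lt_coe.1 hlt
  have h0 : GWWalk.freshLaw p lam hlam GWWalk.deadᶜ ≠ 0 := by
    rw [GWWalk.freshLaw_dead_compl p hp0]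
    exact GWWalk.pathLaw_noReturn_pos p hp0 hlam hmean hm' hcm hD
  obtain ⟨h1, h2⟩ := GWWalk.regenTime_moments p hp0 hlam h0
    (GWWalk.exists_pathLaw_reachReturn_le p hp0 hlam hmean hm' hcm hD)
  exact ⟨MeasureTheory.ae_of_ae_map measurable_snd.aemeasurable h1, h2⟩
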